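/- Let $p>1$, $n\ge p$ be real numbers, $a<b$, and let $F(u)=\frac1{2n}|1-u^2|^n$. For $\varepsilon>0$ put $$E_\varepsilon[w]=\int_a^b\Big[\frac{\varepsilon^{p-1}|w_x|^p}{p}+\frac{F(w)}{\varepsilon}\Big]dx,\qquad c_p=\Big(\frac p{p-1}\Big)^{\frac{p-1}p}\int_{-1}^1F(s)^{\frac{p-1}p}\,ds,\qquad \lambda_p=2^{1-\frac1p}(p-1)^{-\frac1p},$$ and $\alpha=\frac{p-1}p+\frac1n$, $k_1=0$, $k_{m+1}=\alpha(k_m+1)$ for $m\ge1$. Let $v:[a,b]\to\{-1,1\}$ be piecewise constant with exactly $N$ jumps, located at $a<h_1<\dots<h_N<b$, and let $r>0$ satisfy $h_i+r<h_{i+1}-r$ for $1\le i<N$, and $a\le h_i-r$, $h_i+r\le b$ for all $i$. For all small $\varepsilon>0$ let $u^\varepsilon$ be the solution on $[a,b]\times[0,\infty)$ of $$u_t=\varepsilon^p(|u_x|^{p-2}u_x)_x+u(1-u^2)|1-u^2|^{n-2},\qquad u_x(a,t)=u_x(b,t)=0,\qquad u(\cdot,0)=u_0^\varepsilon ,$$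 with $u_0^\varepsilon\in W^{1,p}(a,b)$, understood as the weak solution that for every $T>0$ belongs to $C([a,b]\times[0,\infty))\cap L^\infty(0,T;W^{1,p}(a,b))\cap H^1(0,T;L^2(a,b))$, with $u^\varepsilon(\cdot,t)\in W^{1,p}(a,b)$ for every $t\ge0$, and satisfies, for almost every $t>0$ and every $\varphi\in W^{1,p}(a,b)$, $$\int_a^b\big[u_t\varphi+\varepsilon^p|u_x|^{p-2}u_x\varphi_x-u(1-u^2)|1-u^2|^{n-2}\varphi\big]dx=0 .$$ Assume $\lim_{\varepsilon\to0}\|u_0^\varepsilon-v\|_{L^1(a,b)}=0$ and, for all sufficiently small $\varepsilon>0$, * if $n=p$: $E_\varepsilon[u_0^\varepsilon]\le Nc_p+C\exp(-Ap/(2\varepsilon))$ for some constants $C>0$ and $A\in(0,r\sqrt2\,\lambda_p)$ independent of $\varepsilon$; * if $n>p$: $E_\varepsilon[u_0^\varepsilon]\le Nc_p+\varepsilon^{k_m}$ for some integer $m\ge2$ independent of $\varepsilon$. Let $K\subset\mathbb R\setminus\{\pm1\}$ be closed in $\mathbb R$, write $I_K[w]=\{x\in[a,b]:w(x)\in K\}$,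 and for $X,Y\subset\mathbb R$ let $$d(X,Y)=\max\Big\{\sup_{x\in X}\inf_{y\in Y}|x-y|,\ \sup_{y\in Y}\inf_{x\in X}|x-y|\Big\}\in[0,+\infty]$$ (with $\sup\emptyset=0$, $\inf\emptyset=+\infty$). Given $\delta\in(0,r)$, set $$t_\varepsilon(\delta)=\inf\{t\ge0:\ d(I_K[u^\varepsilon(\cdot,t)],I_K[u_0^\varepsilon])>\delta\}\in[0,+\infty].$$ Then there exists $\varepsilon_0>0$ such that for all $\varepsilon\in(0,\varepsilon_0)$ $$t_\varepsilon(\delta)>\exp\big(Ap/(2\varepsilon)\big)\ \text{ if } n=p,\qquad t_\varepsilon(\delta)>\varepsilon^{-k_m}\ \text{ if } n>p .$$ -/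

import Mathlib

open MeasureTheory Set Filter Topology

noncomputable section

namespace PLaplaceAC

/-- The double well potential `F(u) = |1 - u²|ⁿ / (2n)`. -/
def potential (n u : ℝ) : ℝ := |1 - u ^ 2| ^ n / (2 * n)

/-- The bistable reaction term `f(u) = u (1 - u²) |1 - u²|^(n-2)`, i.e. `f = -F'`. -/
def reaction (n u : ℝ) : ℝ := u * (1 - u ^ 2) * |1 - u ^ 2| ^ (n - 2)

/-- `g : [a,b] → ℝ` is the continuous representative of an element of `W^{1,p}(a,b)`: it is
absolutely continuous on `[a,b]` and its derivative, which exists almost everywhere and is its weak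
derivative, belongs to `L^p(a,b)`. Values of `g` outside `[a,b]` play no role. -/
def MemSobolev (p a b : ℝ) (g : ℝ → ℝ) : Prop :=
  AbsolutelyContinuousOnInterval g a b ∧
    MemLp (deriv g) (ENNReal.ofReal p) (volume.restrict (Ioc a b))

/-- The renormalized energy
`E_ε[g] = ∫_a^b (ε^(p-1) |g'|^p / p + F(g) / ε) dx`, used for `g ∈ W^{1,p}(a,b)`. -/
def energy (p n ε a b : ℝ) (g : ℝ → ℝ) : ℝ :=
  ∫ x in a..b, (ε ^ (p - 1) * |deriv g x| ^ p / p + potential n (g x) / ε)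

/-- The minimal energy of one transition,
`c_p = (p/(p-1))^((p-1)/p) ∫_{-1}^{1} F(s)^((p-1)/p) ds`. -/
def transitionEnergy (p n : ℝ) : ℝ :=
  (p / (p - 1)) ^ ((p - 1) / p) * ∫ s in (-1 : ℝ)..1, potential n s ^ ((p - 1) / p)

/-- `λ_p = 2^(1 - 1/p) (p-1)^(-1/p)`. -/
def lam (p : ℝ) : ℝ := (2 : ℝ) ^ (1 - 1 / p) * (p - 1) ^ (-(1 / p))

/-- For a real exponent `α`, the sequence `k₁ = 0`, `k_{m+1} = α (k_m + 1)` for `m ≥ 1`, so that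
`k₂ = α` (the value at the index `0` is not used). -/
def kSeq (α : ℝ) : ℕ → ℝ
  | 0 => 0
  | 1 => 0
  | (m + 2) => α * (kSeq α (m + 1) + 1)

/-- The exponents `k_m`, for `α = (p-1)/p + 1/n`. -/
def kExp (p n : ℝ) (m : ℕ) : ℝ := kSeq ((p - 1) / p + 1 / n) m

/-- The piecewise constant function with values `±1` which equals the sign `σ` to the left of all
the points `h i` and jumps exactly at the (distinct) points `h i`. -/
def stepFun {N : ℕ} (σ : ℝ) (h : Fin N → ℝ) (x : ℝ) : ℝ :=
  σ * (-1) ^ (Finset.univ.filter (fun i => h i < x)).card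

/-- `u t x` is the (weak, finite energy) solution on `[a,b] × [0,∞)` of
`u_t = ε^p (|u_x|^(p-2) u_x)_x + u (1 - u²) |1 - u²|^(n-2)`, `u_x(a,t) = u_x(b,t) = 0`,
`u(x,0) = u₀(x)`, in the class
`C([a,b] × [0,∞)) ∩ L^∞(0,T; W^{1,p}(a,b)) ∩ H¹(0,T; L²(a,b))` for every `T`.
The test functions are not required to vanish at the end points: this encodes the homogeneous
Neumann boundary condition. -/
structure IsSolution (p n ε a b : ℝ) (u₀ : ℝ → ℝ) (u : ℝ → ℝ → ℝ) : Prop where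
  continuousOn : ContinuousOn (fun z : ℝ × ℝ => u z.1 z.2) (Ici 0 ×ˢ Icc a b)
  initial : ∀ x ∈ Icc a b, u 0 x = u₀ x
  sobolev : ∀ t, 0 ≤ t → MemSobolev p a b (u t)
  bounded : ∀ T, 0 < T → ∃ M : ℝ, ∀ t ∈ Icc 0 T, ∫ x in a..b, |deriv (u t) x| ^ p ≤ M
  equation : ∃ w : ℝ → ℝ → ℝ,
    -- `w` is the time derivative `u_t`, in `L²((0,T) × (a,b))` for every `T`
    (∀ T, 0 < T → MemLp (fun z : ℝ × ℝ => w z.1 z.2) 2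
      ((volume.restrict (Ioc 0 T)).prod (volume.restrict (Ioc a b)))) ∧
    (∀ t, 0 ≤ t → ∀ᵐ x ∂(volume.restrict (Ioc a b)), u t x - u 0 x = ∫ s in 0..t, w s x) ∧
    -- the weak form of the equation at almost every time
    (∀ᵐ t ∂(volume.restrict (Ioi (0 : ℝ))), ∀ φ : ℝ → ℝ, MemSobolev p a b φ →
      ∫ x in a..b, (w t x * φ x
        + ε ^ p * (|deriv (u t) x| ^ (p - 2) * deriv (u t) x) * deriv φ x
        - reaction n (u t x) * φ x) = 0)

/-- The interface `I_K[g] = g⁻¹(K)` of a function `g : [a,b] → ℝ`. -/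
def interfaceSet (a b : ℝ) (K : Set ℝ) (g : ℝ → ℝ) : Set ℝ := {x ∈ Icc a b | g x ∈ K}

/-- `inf {t ≥ 0 : d(I_K[u(·,t)], I_K[u₀]) > δ}` as an extended real number (`+∞` if there is no such
time), where `d(A,B) = max (sup_{x∈A} d(x,B), sup_{y∈B} d(y,A)) ∈ [0,∞]`. -/
def exitTime (a b : ℝ) (K : Set ℝ) (δ : ℝ) (u₀ : ℝ → ℝ) (u : ℝ → ℝ → ℝ) : EReal :=
  sInf ((fun t : ℝ => (t : EReal)) '' {t : ℝ | 0 ≤ t ∧ ENNReal.ofReal δ <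
    Metric.hausdorffEDist (interfaceSet a b K (u t)) (interfaceSet a b K u₀)})

end PLaplaceAC

end

open MeasureTheory Set Filter Topology


namespace PLaplaceAC

/-! ### The double well potential and the induced distance between its values -/

/-! By Young's inequality the energy on an interval dominates the variation there of
`metricPrimitive` along the function, that is, the distance between its end values for the
degenerate metric with density `metricWeight`. The constant c_p is the distance between the wells,
so N transitions cost about N c_p. Write D for the distance to a well, q = p/(p-1), and d(ε) for the
allowed energy excess, exp(-Ap/(2ε)) or ε^{k_m}. Persistence up to time 1/d(ε) rests on one static
and one dynamic estimate.

Static: a function L¹-close to v has energy at least N c_p - C d(ε)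
(`HasTailBound.exists_energy_lower_bound`). If its energy is below N c_p, it is uniformly close to v
away from the jumps (`exists_localization`), and the only loss is that it need not reach the well
within distance r of a jump. This loss is measured by calibration: if a profile φ descends from 1 to
0 along the tail with |φ'| D ≤ (1 - φ^q) F/ε + χ, then the derivative of φ D(w) is bounded by the
energy density plus χ, so the tail pays for D(w) at its inner end up to χ times its length. For n >
p a power profile gives χ of order ε^{α/(1-α)}; this exponent is at least every k_m, so no induction
on m is needed. For n = p an exponential profile followed by a short affine one gives an error
exp(-Ap/(2ε)) up to a constant.

Dynamic: for almost every T the squared L¹ displacement up to time T is at most T (b-a) ε (E(0) -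
E(T)) (`IsSolution.sq_displacement_le`). Since u_t is not an admissible test function for a weak
solution, the equation at time t is tested with u(t-h) - u(t); convexity of the gradient term gives
a discrete inequality, which is integrated in t before h → 0.

Together: while the solution stays L¹-close to v, its energy loss is at most (C + C₁) d(ε), so up to
time 2/d(ε) the squared displacement is O(ε), and continuity in time closes the argument. At all
these times the solution is localized. Since K keeps a positive distance from ±1, interface points
lie within δ/2 of a jump, and the intermediate value theorem matches the interfaces at two times up
to δ. -/

theorem potential_nonneg {n : ℝ} (hn : 0 < n) (s : ℝ) : 0 ≤ potential n s := by
  unfold potential; positivity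

theorem potential_neg (n s : ℝ) : potential n (-s) = potential n s := by
  simp [potential]

theorem potential_pos {n : ℝ} (hn : 0 < n) {s : ℝ} (h : s ^ 2 ≠ 1) : 0 < potential n s := by
  have : 0 < |1 - s ^ 2| := abs_pos.2 (sub_ne_zero.2 (Ne.symm h))
  unfold potential; positivity

theorem continuous_potential {n : ℝ} (hn : 0 < n) : Continuous (potential n) := by
  unfold potential
  refine Continuous.div_const ?_ _
  exact (by fun_prop : Continuous fun u : ℝ => |1 - u ^ 2|).rpow_const fun _ => Or.inr hn.le

/-- The weight `(p/(p-1))^((p-1)/p) F^((p-1)/p)` of the degenerate metric whose length bounds the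
energy from below. -/
noncomputable def metricWeight (p n s : ℝ) : ℝ :=
  (p / (p - 1)) ^ ((p - 1) / p) * potential n s ^ ((p - 1) / p)

/-- The primitive of the metric weight which vanishes at the origin. -/
noncomputable def metricPrimitive (p n s : ℝ) : ℝ := ∫ t in (0 : ℝ)..s, metricWeight p n t

/-- The distance of `s` to the point `m` for the degenerate metric. -/
noncomputable def wellDist (p n m s : ℝ) : ℝ := |metricPrimitive p n m - metricPrimitive p n s|

section
variable {p n : ℝ} (hp : 1 < p) (hn : 0 < n)

include hp in
theorem exponent_pos : 0 < (p - 1) / p := div_pos (by linarith) (by linarith)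

include hp in
theorem conjExponent_pos : 0 < p / (p - 1) := div_pos (by linarith) (by linarith)

include hp hn in
theorem metricWeight_nonneg (s : ℝ) : 0 ≤ metricWeight p n s := by
  have := potential_nonneg hn s
  have := conjExponent_pos hp
  unfold metricWeight; positivity

include hp hn in
theorem metricWeight_pos {s : ℝ} (h : s ^ 2 ≠ 1) : 0 < metricWeight p n s := by
  have := potential_pos hn h
  have := conjExponent_pos hp
  unfold metricWeight; positivity

theorem metricWeight_neg (s : ℝ) : metricWeight p n (-s) = metricWeight p n s := by
  simp [metricWeight, potential_neg]

include hp hn in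
theorem continuous_metricWeight : Continuous (metricWeight p n) := by
  unfold metricWeight
  exact continuous_const.mul ((continuous_potential hn).rpow_const
    fun _ => Or.inr (exponent_pos hp).le)

include hp hn in
theorem metricPrimitive_sub (s t : ℝ) :
    metricPrimitive p n t - metricPrimitive p n s = ∫ x in s..t, metricWeight p n x :=
  intervalIntegral.integral_interval_sub_left
    ((continuous_metricWeight hp hn).intervalIntegrable _ _)
    ((continuous_metricWeight hp hn).intervalIntegrable _ _)

include hp hn in
theorem hasDerivAt_metricPrimitive (s : ℝ) :
    HasDerivAt (metricPrimitive p n) (metricWeight p n s) s :=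
  ((continuous_metricWeight hp hn).integral_hasStrictDerivAt 0 s).hasDerivAt

include hp hn in
theorem contDiff_metricPrimitive : ContDiff ℝ 1 (metricPrimitive p n) := by
  rw [contDiff_one_iff_deriv]
  refine ⟨fun s => (hasDerivAt_metricPrimitive hp hn s).differentiableAt, ?_⟩
  rw [show deriv (metricPrimitive p n) = metricWeight p n from
    funext fun s => (hasDerivAt_metricPrimitive hp hn s).deriv]
  exact continuous_metricWeight hp hn

theorem metricPrimitive_neg (s : ℝ) : metricPrimitive p n (-s) = -metricPrimitive p n s := by
  unfold metricPrimitive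
  have h := intervalIntegral.integral_comp_neg (a := 0) (b := s) (metricWeight p n)
  simp only [metricWeight_neg, neg_zero] at h
  rw [h, intervalIntegral.integral_symm]

include hp hn in
theorem monotone_metricPrimitive : Monotone (metricPrimitive p n) := by
  intro s t hst
  have := metricPrimitive_sub hp hn s t
  have h := intervalIntegral.integral_nonneg (μ := volume) hst
    (fun x _ => metricWeight_nonneg hp hn x)
  linarith

include hp hn in
theorem metricPrimitive_lt {s t : ℝ} (hst : s < t) (h : ∀ x ∈ Ioo s t, x ^ 2 ≠ 1) :
    metricPrimitive p n s < metricPrimitive p n t := by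
  have := metricPrimitive_sub hp hn s t
  have h := intervalIntegral.intervalIntegral_pos_of_pos_on
    ((continuous_metricWeight hp hn).intervalIntegrable s t)
    (fun x hx => metricWeight_pos hp hn (h x hx)) hst
  linarith

-- This identifies c_p as the length of [-1, 1] in the degenerate metric, which turns energy bounds
-- into triangle inequalities.
include hp hn in
theorem transitionEnergy_eq :
    transitionEnergy p n = metricPrimitive p n 1 - metricPrimitive p n (-1) := by
  rw [metricPrimitive_sub hp hn, transitionEnergy]
  simp only [metricWeight, intervalIntegral.integral_const_mul]

theorem wellDist_nonneg (m s : ℝ) : 0 ≤ wellDist p n m s := abs_nonneg _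

theorem wellDist_self (m : ℝ) : wellDist p n m m = 0 := by simp [wellDist]

theorem wellDist_neg (m s : ℝ) : wellDist p n (-m) s = wellDist p n m (-s) := by
  simp only [wellDist, metricPrimitive_neg]
  rw [← abs_neg]; ring_nf

include hp hn in
theorem continuous_wellDist (m : ℝ) : Continuous (wellDist p n m) := by
  have := (contDiff_metricPrimitive hp hn).continuous
  unfold wellDist
  fun_prop

-- Triangle inequality: any path between the wells through s costs at least c_p.
include hp hn in
theorem transitionEnergy_le_wellDist_add {m : ℝ} (hm : m = 1 ∨ m = -1) (s : ℝ) :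
    transitionEnergy p n ≤ wellDist p n m s + wellDist p n (-m) s := by
  rw [transitionEnergy_eq hp hn]
  unfold wellDist
  rcases hm with rfl | rfl
  · have h1 := le_abs_self (metricPrimitive p n 1 - metricPrimitive p n s)
    have h2 := neg_abs_le (metricPrimitive p n (-1) - metricPrimitive p n s)
    linarith
  · rw [neg_neg]
    have h1 := le_abs_self (metricPrimitive p n 1 - metricPrimitive p n s)
    have h2 := neg_abs_le (metricPrimitive p n (-1) - metricPrimitive p n s)
    linarith

include hp hn in
/-- The energy needed to leave a neighbourhood of a well is bounded from below; moreover the path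
through a point outside `[-1-θ, 1+θ]` costs more than one transition. -/
theorem exists_wellDist_lower {θ : ℝ} (h0 : 0 < θ) (h1 : θ < 1) :
    ∃ d > 0, (∀ m s : ℝ, (m = 1 ∨ m = -1) → θ < |s - m| → d ≤ wellDist p n m s) ∧
      ∀ m s : ℝ, (m = 1 ∨ m = -1) → 1 + θ < |s| →
        transitionEnergy p n + d ≤ wellDist p n m s + wellDist p n (-m) s := by
  have mono := monotone_metricPrimitive hp hn
  have e1 : metricPrimitive p n (1 - θ) < metricPrimitive p n 1 :=
    metricPrimitive_lt hp hn (by linarith) fun x hx => by nlinarith [hx.1, hx.2]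
  have e2 : metricPrimitive p n 1 < metricPrimitive p n (1 + θ) :=
    metricPrimitive_lt hp hn (by linarith) fun x hx => by nlinarith [hx.1, hx.2]
  -- The smaller of the metric lengths of [1-θ, 1] and [1, 1+θ]. A detour beyond 1+θ traverses the
  -- second stretch twice. The well -1 follows by evenness of the weight.
  set d := min (metricPrimitive p n 1 - metricPrimitive p n (1 - θ))
    (metricPrimitive p n (1 + θ) - metricPrimitive p n 1) with hd
  have hd1 := min_le_left (metricPrimitive p n 1 - metricPrimitive p n (1 - θ))
    (metricPrimitive p n (1 + θ) - metricPrimitive p n 1)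
  have hd2 := min_le_right (metricPrimitive p n 1 - metricPrimitive p n (1 - θ))
    (metricPrimitive p n (1 + θ) - metricPrimitive p n 1)
  have key : ∀ s, θ < |s - 1| → d ≤ wellDist p n 1 s := by
    intro s hs
    unfold wellDist
    rcases lt_abs.1 hs with h | h
    · have := mono (show 1 + θ ≤ s by linarith)
      rw [abs_sub_comm]
      linarith [le_abs_self (metricPrimitive p n s - metricPrimitive p n 1)]
    · have := mono (show s ≤ 1 - θ by linarith)
      linarith [le_abs_self (metricPrimitive p n 1 - metricPrimitive p n s)]
  have key2 : ∀ s, 1 + θ < s →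
      transitionEnergy p n + d ≤ wellDist p n 1 s + wellDist p n (-1) s := by
    intro s hs
    rw [transitionEnergy_eq hp hn]
    unfold wellDist
    have := mono (show 1 + θ ≤ s by linarith)
    have h1 := neg_abs_le (metricPrimitive p n 1 - metricPrimitive p n s)
    have h2 := neg_abs_le (metricPrimitive p n (-1) - metricPrimitive p n s)
    linarith
  have key3 : ∀ s, 1 + θ < |s| →
      transitionEnergy p n + d ≤ wellDist p n 1 s + wellDist p n (-1) s := by
    intro s hs
    rcases lt_abs.1 hs with h | h
    · exact key2 s h
    · have := key2 (-s) h
      rw [← wellDist_neg, wellDist_neg 1 (-s), neg_neg] at this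
      linarith
  refine ⟨d, lt_min (by linarith) (by linarith), ?_, ?_⟩
  · rintro m s (rfl | rfl) hs
    · exact key s hs
    · rw [wellDist_neg]
      exact key _ (by rwa [← abs_neg, show -(-s - 1) = s - -1 by ring])
  · rintro m s (rfl | rfl) hs
    · exact key3 s hs
    · rw [neg_neg, add_comm (wellDist p n (-1) s)]
      exact key3 s hs

include hp hn in
/-- The weighted Young inequality behind all lower bounds for the energy. -/
theorem metricWeight_mul_le {ε φ : ℝ} (hε : 0 < ε) (hφ : 0 ≤ φ) (s ξ : ℝ) :
    φ * metricWeight p n s * |ξ| ≤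
      ε ^ (p - 1) * |ξ| ^ p / p + φ ^ (p / (p - 1)) * (potential n s / ε) := by
  have hp0 : 0 < p := by linarith
  have hp1 : 0 < p - 1 := by linarith
  have hF := potential_nonneg hn s
  have hconj : p.HolderConjugate (p / (p - 1)) := Real.HolderConjugate.conjExponent hp
  -- The powers of ε cancel in the product ab, while b^q = φ^q q F/ε, whose factor q is removed by
  -- the 1/q in Young's inequality.
  have hy := Real.young_inequality_of_nonneg
    (a := ε ^ ((p - 1) / p) * |ξ|)
    (b := φ * ((p / (p - 1)) ^ ((p - 1) / p) * potential n s ^ ((p - 1) / p) *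
      ε ^ (-((p - 1) / p)))) (by positivity) (by positivity) hconj
  have e1 : (p - 1) / p * p = p - 1 := by field_simp
  have e2 : (p - 1) / p * (p / (p - 1)) = 1 := by field_simp
  have e3 : -((p - 1) / p) * (p / (p - 1)) = -1 := by field_simp
  rw [Real.mul_rpow (by positivity) (by positivity), ← Real.rpow_mul hε.le, e1,
    Real.mul_rpow hφ (by positivity), Real.mul_rpow (by positivity) (by positivity),
    Real.mul_rpow (by positivity) (by positivity), ← Real.rpow_mul (by positivity),
    ← Real.rpow_mul hF, ← Real.rpow_mul hε.le, e2, e3, Real.rpow_one, Real.rpow_one,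
    Real.rpow_neg_one] at hy
  have e4 : ε ^ ((p - 1) / p) * |ξ| * (φ * ((p / (p - 1)) ^ ((p - 1) / p) *
      potential n s ^ ((p - 1) / p) * ε ^ (-((p - 1) / p)))) =
      φ * metricWeight p n s * |ξ| := by
    have : ε ^ ((p - 1) / p) * ε ^ (-((p - 1) / p)) = 1 := by
      rw [← Real.rpow_add hε]; simp
    unfold metricWeight
    linear_combination (|ξ| * φ * ((p / (p - 1)) ^ ((p - 1) / p) *
      potential n s ^ ((p - 1) / p))) * this
  rw [e4] at hy
  refine hy.trans (le_of_eq ?_)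
  congr 1
  field_simp

-- Since |1 - s²| ≤ (2+θ)|s - m|, the weight vanishes at the well to order n(p-1)/p, and integration
-- raises the order by one. The constant is kept explicit because the critical case needs its value
-- as θ → 0.
include hp hn in
theorem wellDist_le_near {θ : ℝ} (h0 : 0 ≤ θ) {m s : ℝ} (hm : m = 1 ∨ m = -1)
    (hs : |s - m| ≤ θ) :
    wellDist p n m s ≤ (p / (p - 1) / (2 * n)) ^ ((p - 1) / p) * (2 + θ) ^ (n * ((p - 1) / p)) *
      (|s - m| ^ (n * ((p - 1) / p) + 1) / (n * ((p - 1) / p) + 1)) := by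
  have hq := conjExponent_pos hp
  have hr := exponent_pos hp
  set β := n * ((p - 1) / p) with hβ
  have hβ0 : 0 < β := by positivity
  set c := (p / (p - 1) / (2 * n)) ^ ((p - 1) / p) * (2 + θ) ^ β with hc
  -- the weight near the well `1`
  have hw : ∀ t : ℝ, |t| ≤ θ → metricWeight p n (1 + t) ≤ c * |t| ^ β := by
    intro t ht
    have a1 : |1 - (1 + t) ^ 2| ≤ (2 + θ) * |t| := by
      rw [show 1 - (1 + t) ^ 2 = -((2 + t) * t) by ring, abs_neg, abs_mul]
      gcongr
      calc |2 + t| ≤ |2| + |t| := abs_add_le _ _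
        _ ≤ 2 + θ := by rw [abs_two]; linarith
    unfold metricWeight potential
    rw [← Real.mul_rpow hq.le (by positivity),
      show p / (p - 1) * (|1 - (1 + t) ^ 2| ^ n / (2 * n)) =
        p / (p - 1) / (2 * n) * |1 - (1 + t) ^ 2| ^ n by ring,
      Real.mul_rpow (by positivity) (by positivity), ← Real.rpow_mul (abs_nonneg _), ← hβ, hc,
      mul_assoc]
    gcongr
    rw [← Real.mul_rpow (by positivity) (abs_nonneg _)]
    gcongr
  -- The sign τ treats the two sides of the well 1 at once.
  have key : ∀ τ : ℝ, (τ = 1 ∨ τ = -1) → ∀ y, 0 ≤ y → y ≤ θ →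
      ∫ t in (0 : ℝ)..y, metricWeight p n (1 + τ * t) ≤ c * (y ^ (β + 1) / (β + 1)) := by
    intro τ hτ y hy0 hy
    have hcont : Continuous fun t => metricWeight p n (1 + τ * t) :=
      (continuous_metricWeight hp hn).comp (by fun_prop)
    have hcont2 : Continuous fun t : ℝ => c * |t| ^ β :=
      continuous_const.mul (continuous_abs.rpow_const fun _ => Or.inr hβ0.le)
    calc ∫ t in (0 : ℝ)..y, metricWeight p n (1 + τ * t)
        ≤ ∫ t in (0 : ℝ)..y, c * |t| ^ β := by
          refine intervalIntegral.integral_mono_on hy0 (hcont.intervalIntegrable _ _)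
            (hcont2.intervalIntegrable _ _) fun t ht => ?_
          have hab : |τ * t| = |t| := by
            rcases hτ with rfl | rfl <;> simp
          have := hw (τ * t) (by rw [hab, abs_of_nonneg ht.1]; linarith [ht.2])
          rwa [hab] at this
      _ = ∫ t in (0 : ℝ)..y, c * t ^ β := by
          refine intervalIntegral.integral_congr fun t ht => ?_
          rw [uIcc_of_le hy0] at ht
          simp only [abs_of_nonneg ht.1]
      _ = c * (y ^ (β + 1) / (β + 1)) := by
          rw [intervalIntegral.integral_const_mul, integral_rpow (Or.inl (by linarith)),
            Real.zero_rpow (by linarith), sub_zero]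
  have main : ∀ s : ℝ, |s - 1| ≤ θ →
      wellDist p n 1 s ≤ c * (|s - 1| ^ (β + 1) / (β + 1)) := by
    intro s hs
    unfold wellDist
    rcases le_total 1 s with h | h
    · have hk := key 1 (Or.inl rfl) (s - 1) (by linarith) ((le_abs_self _).trans hs)
      rw [abs_sub_comm, metricPrimitive_sub hp hn, abs_of_nonneg
        (intervalIntegral.integral_nonneg h fun x _ => metricWeight_nonneg hp hn x),
        abs_of_nonneg (sub_nonneg.2 h)]
      simp only [one_mul] at hk
      rwa [intervalIntegral.integral_comp_add_left, add_zero, add_sub_cancel] at hk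
    · have hk := key (-1) (Or.inr rfl) (1 - s) (by linarith) (by
        rw [abs_sub_comm] at hs; exact (le_abs_self _).trans hs)
      rw [metricPrimitive_sub hp hn, abs_of_nonneg
        (intervalIntegral.integral_nonneg h fun x _ => metricWeight_nonneg hp hn x),
        abs_sub_comm, abs_of_nonneg (sub_nonneg.2 h)]
      simp only [neg_mul, one_mul, ← sub_eq_add_neg] at hk
      rwa [intervalIntegral.integral_comp_sub_left (fun x => metricWeight p n x), sub_zero,
        sub_sub_cancel] at hk
  rcases hm with rfl | rfl
  · exact main s hs
  · have e : |-s - 1| = |s - -1| := by rw [← abs_neg]; ring_nf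
    rw [wellDist_neg, ← e]
    exact main (-s) (e ▸ hs)

-- The factor |s + m| of |1 - s²| is at least 2 - θ. Paired with `wellDist_le_near`, this compares D
-- with F near a well.
include hn in
theorem potential_ge_near {θ : ℝ} (h2 : θ ≤ 1) {m s : ℝ} (hm : m = 1 ∨ m = -1)
    (hs : |s - m| ≤ θ) :
    (2 - θ) ^ n * |s - m| ^ n / (2 * n) ≤ potential n s := by
  have main : ∀ s : ℝ, |s - 1| ≤ θ → (2 - θ) ^ n * |s - 1| ^ n / (2 * n) ≤ potential n s := by
    intro s hs
    unfold potential
    rw [← Real.mul_rpow (by linarith) (abs_nonneg _)]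
    have h2θ : 0 ≤ 2 - θ := by linarith
    have : (2 - θ) * |s - 1| ≤ |1 - s ^ 2| := by
      rw [show 1 - s ^ 2 = -((1 + s) * (s - 1)) by ring, abs_neg, abs_mul]
      gcongr
      have := abs_le.1 hs
      exact le_trans (by linarith) (le_abs_self _)
    gcongr
  rcases hm with rfl | rfl
  · exact main s hs
  · have e : |-s - 1| = |s - -1| := by rw [← abs_neg]; ring_nf
    rw [← potential_neg, ← e]
    exact main (-s) (e ▸ hs)

end

end PLaplaceAC

namespace PLaplaceAC

/-! ### Absolutely continuous functions and the calibration inequality -/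

/-- The inner function is bounded, and a C¹ function is Lipschitz on a compact interval containing
its range. -/
theorem _root_.AbsolutelyContinuousOnInterval.comp_contDiff {f g : ℝ → ℝ} {a b : ℝ}
    (hg : AbsolutelyContinuousOnInterval g a b) (hf : ContDiff ℝ 1 f) :
    AbsolutelyContinuousOnInterval (fun x => f (g x)) a b := by
  obtain ⟨C, hC⟩ := hg.exists_bound
  obtain ⟨K, hK⟩ := hf.contDiffOn.exists_lipschitzOnWith (by decide) (convex_Icc (-C) C)
    isCompact_Icc
  have hm : ∀ x ∈ uIcc a b, g x ∈ Icc (-C) C := fun x hx => abs_le.1 (hC x hx)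
  have h0 := (hg.const_mul (K : ℝ))
  rw [absolutelyContinuousOnInterval_iff] at h0 ⊢
  intro ε hε
  obtain ⟨δ, hδ, h⟩ := h0 ε hε
  refine ⟨δ, hδ, fun E hE hs => lt_of_le_of_lt (Finset.sum_le_sum fun i hi => ?_) (h E hE hs)⟩
  have h1 := hK.dist_le_mul _ (hm _ (hE.1 i hi).1) _ (hm _ (hE.1 i hi).2)
  refine h1.trans (le_of_eq ?_)
  rw [Real.dist_eq, Real.dist_eq, ← mul_sub, abs_mul, NNReal.abs_eq]

theorem _root_.AbsolutelyContinuousOnInterval.abs_comp {g : ℝ → ℝ} {a b : ℝ}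
    (hg : AbsolutelyContinuousOnInterval g a b) :
    AbsolutelyContinuousOnInterval (fun x => |g x|) a b := by
  rw [absolutelyContinuousOnInterval_iff] at hg ⊢
  intro ε hε
  obtain ⟨δ, hδ, h⟩ := hg ε hε
  refine ⟨δ, hδ, fun E hE hs => lt_of_le_of_lt (Finset.sum_le_sum fun i hi => ?_) (h E hE hs)⟩
  rw [Real.dist_eq, Real.dist_eq]
  exact abs_abs_sub_abs_le _ _

/-- Taking absolute values does not increase the modulus of the derivative. -/
theorem abs_deriv_abs_le {f : ℝ → ℝ} {f' y' x : ℝ} (hf : HasDerivAt f f' x)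
    (hy : HasDerivAt (fun t => |f t|) y' x) : |y'| ≤ |f'| := by
  rw [hasDerivAt_iff_tendsto_slope] at hf hy
  refine le_of_tendsto_of_tendsto' hy.abs hf.abs fun t => ?_
  simp only [slope_def_field, abs_div]
  exact div_le_div_of_nonneg_right (abs_abs_sub_abs_le (f t) (f x)) (abs_nonneg _)

theorem MemSobolev.mono {p a b c d : ℝ} {g : ℝ → ℝ} (h : MemSobolev p a b g) (hac : a ≤ c)
    (hcd : c ≤ d) (hdb : d ≤ b) : MemSobolev p c d g := by
  refine ⟨h.1.mono ?_, h.2.mono_measure (Measure.restrict_mono (Ioc_subset_Ioc hac hdb) le_rfl)⟩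
  rw [uIcc_of_le hcd, uIcc_of_le (by linarith)]
  exact Icc_subset_Icc hac hdb

/-- The energy density. -/
noncomputable def energyDensity (p n ε : ℝ) (g : ℝ → ℝ) (x : ℝ) : ℝ :=
  ε ^ (p - 1) * |deriv g x| ^ p / p + potential n (g x) / ε

section
variable {p n : ℝ} (hp : 1 < p) (hn : 0 < n)

include hp in
theorem MemSobolev.integrableOn_rpow {a b : ℝ} {g : ℝ → ℝ} (h : MemSobolev p a b g) :
    IntegrableOn (fun x => |deriv g x| ^ p) (Ioc a b) := by
  have h2 := h.2.integrable_norm_rpow (by simpa using by linarith) ENNReal.ofReal_ne_top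
  rwa [ENNReal.toReal_ofReal (by linarith)] at h2

theorem MemSobolev.continuousOn {a b : ℝ} {g : ℝ → ℝ} (hab : a ≤ b) (h : MemSobolev p a b g) :
    ContinuousOn g (Icc a b) := by
  have := h.1.continuousOn
  rwa [uIcc_of_le hab] at this

theorem energyDensity_nonneg (hp : 1 < p) (hn : 0 < n) {ε : ℝ} (hε : 0 < ε) (g : ℝ → ℝ) (x : ℝ) :
    0 ≤ energyDensity p n ε g x := by
  have := potential_nonneg hn (g x)
  have : 0 < p := by linarith
  unfold energyDensity; positivity

include hp hn in
theorem MemSobolev.integrableOn_energyDensity {a b ε : ℝ} {g : ℝ → ℝ} (hab : a ≤ b)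
    (h : MemSobolev p a b g) : IntegrableOn (energyDensity p n ε g) (Ioc a b) := by
  have h1 : IntegrableOn (fun x => potential n (g x)) (Ioc a b) :=
    (((continuous_potential hn).comp_continuousOn
      (h.continuousOn hab)).integrableOn_Icc).mono_set Ioc_subset_Icc_self
  exact ((((h.integrableOn_rpow hp).const_mul _).div_const _).add (h1.div_const _))

include hp hn in
/-- The calibration inequality: the energy on an interval controls the variation of a weighted
distance to a well. -/
theorem calibration {x₁ x₂ ε m χ : ℝ} (hx : x₁ ≤ x₂) (hε : 0 < ε) {w φ : ℝ → ℝ}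
    (hw : MemSobolev p x₁ x₂ w) (hφ : ContDiff ℝ 1 φ) (hφ0 : ∀ x ∈ Icc x₁ x₂, 0 ≤ φ x)
    (hineq : ∀ x ∈ Icc x₁ x₂, |deriv φ x| * wellDist p n m (w x) ≤
      (1 - φ x ^ (p / (p - 1))) * (potential n (w x) / ε) + χ) :
    |φ x₂ * wellDist p n m (w x₂) - φ x₁ * wellDist p n m (w x₁)| ≤
      (∫ x in x₁..x₂, energyDensity p n ε w x) + χ * (x₂ - x₁) := by
  have hZ : ContDiff ℝ 1 fun s => metricPrimitive p n m - metricPrimitive p n s :=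
    contDiff_const.sub (contDiff_metricPrimitive hp hn)
  have hY := (hw.1.comp_contDiff hZ).abs_comp
  have hS := (hφ.contDiffOn.absolutelyContinuousOnInterval (a := x₁) (b := x₂)).fun_mul hY
  have hint : IntervalIntegrable (fun x => energyDensity p n ε w x + χ) volume x₁ x₂ :=
    ((intervalIntegrable_iff_integrableOn_Ioc_of_le hx).2
      (hw.integrableOn_energyDensity hp hn hx)).add intervalIntegrable_const
  have e : (∫ x in x₁..x₂, energyDensity p n ε w x) + χ * (x₂ - x₁) =
      ∫ x in x₁..x₂, (energyDensity p n ε w x + χ) := by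
    rw [intervalIntegral.integral_add _ intervalIntegrable_const,
      intervalIntegral.integral_const, smul_eq_mul, mul_comm]
    exact (intervalIntegrable_iff_integrableOn_Ioc_of_le hx).2
      (hw.integrableOn_energyDensity hp hn hx)
  have hSd := hS.integral_deriv_eq_sub
  simp only [wellDist]
  rw [← hSd, e, ← Real.norm_eq_abs]
  refine intervalIntegral.norm_integral_le_of_norm_le hx ?_ hint
  filter_upwards [hw.1.ae_differentiableAt, hY.ae_differentiableAt] with x h1 h2 hxI
  have hxc : x ∈ Icc x₁ x₂ := Ioc_subset_Icc_self hxI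
  have hxu : x ∈ uIcc x₁ x₂ := by rwa [uIcc_of_le hx]
  have dw := (h1 hxu).hasDerivAt
  have dY := (h2 hxu).hasDerivAt
  have dφ := ((hφ.differentiable (by simp)) x).hasDerivAt
  have dZ : HasDerivAt (fun t => metricPrimitive p n m - metricPrimitive p n (w t))
      (0 - metricWeight p n (w x) * deriv w x) x :=
    (hasDerivAt_const x _).sub ((hasDerivAt_metricPrimitive hp hn (w x)).comp x dw)
  have b1 := abs_deriv_abs_le dZ dY
  rw [zero_sub, abs_neg, abs_mul, abs_of_nonneg (metricWeight_nonneg hp hn _)] at b1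
  rw [(dφ.fun_mul dY).deriv, Real.norm_eq_abs]
  -- The potential is split in two: b2 pays for |φ'| D with (1 - φ^q) F/ε + χ, and b3 pays for φ
  -- |D'| with the remaining φ^q F/ε and the gradient term.
  have b2 := hineq x hxc
  have b3 := metricWeight_mul_le hp hn hε (hφ0 x hxc) (w x) (deriv w x)
  have b4 := abs_add_le (deriv φ x * |metricPrimitive p n m - metricPrimitive p n (w x)|)
    (φ x * deriv (fun t => |metricPrimitive p n m - metricPrimitive p n (w t)|) x)
  rw [abs_mul, abs_abs, abs_mul, abs_of_nonneg (hφ0 x hxc)] at b4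
  have b5 := mul_le_mul_of_nonneg_left b1 (hφ0 x hxc)
  unfold wellDist at b2
  unfold energyDensity
  linarith

-- Calibration with the constant profile φ = 1 and no error.
include hp hn in
theorem abs_wellDist_sub_le {x₁ x₂ ε : ℝ} (m : ℝ) (hx : x₁ ≤ x₂) (hε : 0 < ε) {w : ℝ → ℝ}
    (hw : MemSobolev p x₁ x₂ w) :
    |wellDist p n m (w x₂) - wellDist p n m (w x₁)| ≤
      ∫ x in x₁..x₂, energyDensity p n ε w x := by
  have h := calibration (m := m) (χ := 0) (φ := fun _ => 1) hp hn hx hε hw contDiff_const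
    (by simp) (by simp)
  simpa using h

include hp hn in
/-- The calibration inequality for a profile depending on the distance to one end point, for both
end points. -/
theorem calibration_profile {x₁ x₂ ε m χ θ ℓ : ℝ} (hℓ : 0 ≤ ℓ) (hx : x₂ - x₁ = ℓ) (hε : 0 < ε)
    {w φ : ℝ → ℝ} (hw : MemSobolev p x₁ x₂ w) (hwm : ∀ x ∈ Icc x₁ x₂, |w x - m| ≤ θ)
    (hφ : ContDiff ℝ 1 φ) (hφ0 : ∀ y ∈ Icc 0 ℓ, 0 ≤ φ y)
    (hineq : ∀ y ∈ Icc 0 ℓ, ∀ s, |s - m| ≤ θ → |deriv φ y| * wellDist p n m s ≤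
      (1 - φ y ^ (p / (p - 1))) * (potential n s / ε) + χ) :
    φ 0 * wellDist p n m (w x₁) - φ ℓ * wellDist p n m (w x₂) ≤
      (∫ x in x₁..x₂, energyDensity p n ε w x) + χ * ℓ ∧
    φ 0 * wellDist p n m (w x₂) - φ ℓ * wellDist p n m (w x₁) ≤
      (∫ x in x₁..x₂, energyDensity p n ε w x) + χ * ℓ := by
  have hx12 : x₁ ≤ x₂ := by linarith
  constructor
  · have h := calibration (m := m) (χ := χ) (φ := fun x => φ (x - x₁)) hp hn hx12 hε hw
      (hφ.comp (contDiff_id.sub contDiff_const))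
      (fun x hx' => hφ0 _ ⟨by linarith [hx'.1], by linarith [hx'.2]⟩)
      (fun x hx' => by
        rw [deriv_comp_sub_const]
        exact hineq _ ⟨by linarith [hx'.1], by linarith [hx'.2]⟩ _ (hwm x hx'))
    simp only [hx, sub_self] at h
    linarith [neg_abs_le (φ ℓ * wellDist p n m (w x₂) - φ 0 * wellDist p n m (w x₁))]
  · have h := calibration (m := m) (χ := χ) (φ := fun x => φ (x₂ - x)) hp hn hx12 hε hw
      (hφ.comp (contDiff_const.sub contDiff_id))
      (fun x hx' => hφ0 _ ⟨by linarith [hx'.2], by linarith [hx'.1]⟩)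
      (fun x hx' => by
        rw [deriv_comp_const_sub, abs_neg]
        exact hineq _ ⟨by linarith [hx'.2], by linarith [hx'.1]⟩ _ (hwm x hx'))
    simp only [hx, sub_self] at h
    linarith [le_abs_self (φ 0 * wellDist p n m (w x₂) - φ ℓ * wellDist p n m (w x₁))]

end

end PLaplaceAC

namespace PLaplaceAC

/-! ### Half transitions -/

/-- Up to a defect of order `d ε`, a function which stays close to a well on an interval of length
`r - ρ` spends there as much energy as is needed to reach the well. -/
def HasTailBound (p n r : ℝ) (d : ℝ → ℝ) : Prop :=
  ∃ θ ρ C : ℝ, 0 < θ ∧ θ < 1 ∧ 0 < ρ ∧ ρ < r ∧ 0 ≤ C ∧ ∀ᶠ ε in 𝓝[>] (0 : ℝ),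
    ∀ m : ℝ, (m = 1 ∨ m = -1) → ∀ x₁ x₂ : ℝ, x₂ - x₁ = r - ρ → ∀ w : ℝ → ℝ,
      MemSobolev p x₁ x₂ w → (∀ x ∈ Icc x₁ x₂, |w x - m| ≤ θ) →
        wellDist p n m (w x₁) ≤ (∫ x in x₁..x₂, energyDensity p n ε w x) + C * d ε ∧
        wellDist p n m (w x₂) ≤ (∫ x in x₁..x₂, energyDensity p n ε w x) + C * d ε

/-- The bound α/(1-α) is the fixed point of the increasing map k ↦ α(k+1), and the sequence starts
below it. -/
theorem kSeq_le {α : ℝ} (h0 : 0 < α) (h1 : α < 1) (m : ℕ) : kSeq α m ≤ α / (1 - α) := by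
  have h2 : 0 < 1 - α := by linarith
  induction m using kSeq.induct with
  | case1 => simp only [kSeq]; positivity
  | case2 => simp only [kSeq]; positivity
  | case3 m ih =>
    simp only [kSeq]
    calc α * (kSeq α (m + 1) + 1) ≤ α * (α / (1 - α) + 1) := by gcongr
      _ = α / (1 - α) := by field_simp; ring

section
variable {p n : ℝ}

/-- Near a well D is at most of order |s-m|^{n(p-1)/p+1} = |s-m|^{nα}, whereas F is at least of
order |s-m|^n. -/
theorem exists_wellDist_le_potential_rpow (hp : 1 < p) (hn : 0 < n) :
    ∃ M > 0, ∀ m s : ℝ, (m = 1 ∨ m = -1) → |s - m| ≤ 1 / 2 →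
      wellDist p n m s ≤ M * potential n s ^ ((p - 1) / p + 1 / n) := by
  have hq := conjExponent_pos hp
  have hr := exponent_pos hp
  set α := (p - 1) / p + 1 / n with hα
  have hα0 : 0 < α := by positivity
  set c := ((2 - 1 / 2 : ℝ) ^ n / (2 * n)) with hc
  have hc0 : 0 < c := by
    have : (0 : ℝ) < 2 - 1 / 2 := by norm_num
    positivity
  set c' := (p / (p - 1) / (2 * n)) ^ ((p - 1) / p) * (2 + 1 / 2 : ℝ) ^ (n * ((p - 1) / p)) /
    (n * ((p - 1) / p) + 1) with hc'
  have hc'0 : 0 < c' := by positivity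
  refine ⟨c' / c ^ α, by positivity, fun m s hm hs => ?_⟩
  have h1 := wellDist_le_near hp hn (θ := 1 / 2) (by norm_num) hm hs
  have h2 := potential_ge_near hn (θ := 1 / 2) (by norm_num) hm hs
  have e : n * ((p - 1) / p) + 1 = n * α := by rw [hα]; field_simp
  calc wellDist p n m s ≤ c' * |s - m| ^ (n * α) := by
        rw [← e]; refine h1.trans (le_of_eq ?_); rw [hc']; ring
    _ = c' / c ^ α * (c * |s - m| ^ n) ^ α := by
        rw [Real.mul_rpow hc0.le (by positivity), ← Real.rpow_mul (abs_nonneg _)]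
        field_simp
    _ ≤ c' / c ^ α * potential n s ^ α := by
        gcongr
        refine le_trans (le_of_eq ?_) h2
        rw [hc]; ring

/-- The profile φ = 1 - (y/ℓ)^k is calibrated with error χ = c^k ε^{αk}: D ≤ M F^α, and α < 1 allows
Young's inequality to absorb |φ'| D into the potential. -/
theorem hasTailBound_degenerate (hp : 1 < p) (hpn : p < n) {r : ℝ} (hr : 0 < r) (m : ℕ) :
    HasTailBound p n r fun ε => ε ^ kExp p n m := by
  have hn : 0 < n := by linarith
  have hp0 : 0 < p := by linarith
  have hp1 : 0 < p - 1 := by linarith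
  obtain ⟨M, hM, hD⟩ := exists_wellDist_le_potential_rpow hp hn
  set α := (p - 1) / p + 1 / n with hα
  have hα0 : 0 < α := by positivity
  have hα1 : α < 1 := by
    have : 1 / n < 1 / p := one_div_lt_one_div_of_lt hp0 hpn
    have e : (p - 1) / p = 1 - 1 / p := by field_simp
    linarith
  have hα2 : 0 < 1 - α := by linarith
  -- The exponent conjugate to 1/α. As k - 1 = αk, the product τ^{k-1} F^α is exactly (τ^k F)^α, to
  -- which Young's inequality applies.
  set k := 1 / (1 - α) with hk
  have hk1 : 1 < k := by rw [hk, lt_div_iff₀ hα2]; linarith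
  have hk2 : α * k = k - 1 := by rw [hk]; field_simp; ring
  set ℓ := r / 2 with hℓ
  have hℓ0 : 0 < ℓ := by positivity
  set c := k * M / ℓ with hc
  have hc0 : 0 < c := by positivity
  refine ⟨1 / 2, r / 2, c ^ k * ℓ, by norm_num, by norm_num, by positivity, by linarith,
    by positivity, ?_⟩
  filter_upwards [Ioo_mem_nhdsGT (zero_lt_one' ℝ)] with ε hε
  obtain ⟨hε, hε1⟩ := hε
  intro σ hσ x₁ x₂ hx w hw hwm
  have hq1 : 1 ≤ p / (p - 1) := by rw [le_div_iff₀ hp1]; linarith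
  have hφ : ContDiff ℝ 1 fun y : ℝ => 1 - (y / ℓ) ^ k :=
    contDiff_const.sub ((Real.contDiff_rpow_const_of_le (n := 1) (by exact_mod_cast hk1.le)).comp
      (contDiff_id.div_const ℓ))
  have hτ : ∀ y ∈ Icc 0 ℓ, 0 ≤ y / ℓ ∧ y / ℓ ≤ 1 := fun y hy =>
    ⟨div_nonneg hy.1 hℓ0.le, (div_le_one hℓ0).2 hy.2⟩
  have hφ0 : ∀ y ∈ Icc 0 ℓ, 0 ≤ 1 - (y / ℓ) ^ k := fun y hy =>
    sub_nonneg.2 (Real.rpow_le_one (hτ y hy).1 (hτ y hy).2 (by linarith))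
  have hd : ∀ y, deriv (fun y : ℝ => 1 - (y / ℓ) ^ k) y = -(k / ℓ * (y / ℓ) ^ (k - 1)) := by
    intro y
    have h1 : HasDerivAt (fun y : ℝ => y / ℓ) (1 / ℓ) y := (hasDerivAt_id y).div_const ℓ
    have h2 := (h1.rpow_const (p := k) (Or.inr hk1.le)).const_sub 1
    rw [h2.deriv]; ring
  have main := calibration_profile (χ := c ^ k * ε ^ (α * k)) (θ := 1 / 2) (m := σ) hp hn hℓ0.le
    (by rw [hx]; ring) hε hw hwm hφ hφ0 (fun y hy s hs => by
      have hF := potential_nonneg hn s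
      obtain ⟨t0, t1⟩ := hτ y hy
      set τ := y / ℓ
      rw [hd, abs_neg, abs_of_nonneg (by positivity)]
      have hX : 0 ≤ τ ^ k * potential n s := by positivity
      set X := τ ^ k * potential n s with hXdef
      have e1 : k / ℓ * τ ^ (k - 1) * wellDist p n σ s ≤ c * X ^ α := by
        calc k / ℓ * τ ^ (k - 1) * wellDist p n σ s
            ≤ k / ℓ * τ ^ (k - 1) * (M * potential n s ^ α) := by gcongr; exact hD σ s hσ hs
          _ = c * X ^ α := by
            rw [hXdef, Real.mul_rpow (by positivity) hF, ← Real.rpow_mul t0, mul_comm k α, hk2, hc]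
            ring
      have e2 : c * X ^ α ≤ X / ε + c ^ k * ε ^ (α * k) := by
        have hconj : (1 / α).HolderConjugate k := by
          rw [Real.holderConjugate_iff]
          refine ⟨by rw [lt_div_iff₀ hα0]; linarith, ?_⟩
          rw [hk]; field_simp; ring
        have hy := Real.young_inequality_of_nonneg (a := (X / ε) ^ α) (b := c * ε ^ α)
          (by positivity) (by positivity) hconj
        rw [← Real.rpow_mul (by positivity), mul_one_div_cancel hα0.ne', Real.rpow_one,
          Real.mul_rpow hc0.le (by positivity), ← Real.rpow_mul hε.le] at hy
        have e3 : (X / ε) ^ α * (c * ε ^ α) = c * X ^ α := by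
          rw [Real.div_rpow hX hε.le]; field_simp
        have e4 : X / ε / (1 / α) ≤ X / ε := by
          rw [div_div_eq_mul_div, div_one]
          exact mul_le_of_le_one_right (by positivity) hα1.le
        have e5 : c ^ k * ε ^ (α * k) / k ≤ c ^ k * ε ^ (α * k) :=
          div_le_self (by positivity) hk1.le
        linarith
      -- A power q ≥ 1 decreases the number 1 - τ^k of [0, 1].
      have e6 : τ ^ k ≤ 1 - (1 - τ ^ k) ^ (p / (p - 1)) := by
        have := Real.rpow_le_rpow_of_exponent_ge_of_imp (hφ0 y hy)
          (sub_le_self _ (by positivity : 0 ≤ τ ^ k)) hq1 (fun _ h => absurd h (by positivity))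
        rw [Real.rpow_one] at this
        linarith
      have e7 : X / ε ≤ (1 - (1 - τ ^ k) ^ (p / (p - 1))) * (potential n s / ε) := by
        rw [hXdef, mul_div_assoc]; gcongr
      linarith)
  -- Here αk = α/(1-α) bounds every k_m from above, and ε < 1 reverses the order of the powers.
  have hbd : c ^ k * ε ^ (α * k) * ℓ ≤ c ^ k * ℓ * ε ^ kExp p n m := by
    have h1 : kExp p n m ≤ α * k := by
      rw [hk, mul_one_div]; exact kSeq_le hα0 hα1 m
    have := Real.rpow_le_rpow_of_exponent_ge hε hε1.le h1
    calc c ^ k * ε ^ (α * k) * ℓ ≤ c ^ k * ε ^ kExp p n m * ℓ := by gcongr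
      _ = _ := by ring
  simp only [zero_div, div_self hℓ0.ne', Real.one_rpow, Real.zero_rpow (by linarith : k ≠ 0),
    sub_zero, sub_self, zero_mul, one_mul] at main
  exact ⟨main.1.trans (by linarith), main.2.trans (by linarith)⟩

/-- In the critical case the potential controls the distance to the well linearly, with a constant
which is almost optimal close to the well. -/
theorem exists_mul_wellDist_le_potential (hp : 1 < p) :
    ∃ θ, 0 < θ ∧ θ < 1 ∧ ∀ m s : ℝ, (m = 1 ∨ m = -1) → |s - m| ≤ θ →
      19 / 20 * ((p - 1) * lam p) * wellDist p p m s ≤ potential p s := by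
  have hp0 : 0 < p := by linarith
  have hp1 : 0 < p - 1 := by linarith
  have hl0 : 0 < lam p := by unfold lam; positivity
  set μ := 19 / 20 * ((p - 1) * lam p) with hμ
  have hμ0 : 0 < μ := by positivity
  set c := (p / (p - 1) / (2 * p)) ^ ((p - 1) / p) with hc
  have hβ : p * ((p - 1) / p) = p - 1 := by field_simp
  -- At θ = 0 the two expansions at the well give the ratio F/D = 1/c = (p-1)λ_p. The factor 19/20
  -- leaves room for some θ > 0.
  have hlc : (p - 1) * lam p * c = 1 := by
    have e1 : p / (p - 1) / (2 * p) = (2 * (p - 1))⁻¹ := by field_simp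
    have e2 : (p - 1) / p = 1 - 1 / p := by field_simp
    rw [hc, e1, e2, lam, Real.inv_rpow (by positivity), Real.mul_rpow (by norm_num) hp1.le,
      Real.rpow_sub hp1, Real.rpow_one, Real.rpow_neg hp1.le]
    have : (0 : ℝ) < 2 ^ (1 - 1 / p) := by positivity
    have : (0 : ℝ) < (p - 1) ^ (1 / p) := by positivity
    field_simp
  have hev : ∀ᶠ θ in 𝓝[>] (0 : ℝ),
      μ * (c * (2 + θ) ^ (p - 1)) * 2 ≤ (2 - θ) ^ p := by
    have hcont1 : ContinuousAt (fun θ : ℝ => μ * (c * (2 + θ) ^ (p - 1)) * 2) 0 := by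
      have : ContinuousAt (fun θ : ℝ => (2 + θ) ^ (p - 1)) 0 :=
        ContinuousAt.rpow_const (by fun_prop) (Or.inl (by norm_num))
      fun_prop
    have hcont2 : ContinuousAt (fun θ : ℝ => (2 - θ) ^ p) 0 :=
      ContinuousAt.rpow_const (by fun_prop) (Or.inl (by norm_num))
    have hlt : μ * (c * (2 + (0 : ℝ)) ^ (p - 1)) * 2 < (2 - (0 : ℝ)) ^ p := by
      have e : (2 : ℝ) ^ p = 2 ^ (p - 1) * 2 := by
        rw [Real.rpow_sub (by norm_num), Real.rpow_one]; field_simp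
      have h2 : (0 : ℝ) < 2 ^ (p - 1) := by positivity
      rw [add_zero, sub_zero, e, hμ]
      have : 19 / 20 * ((p - 1) * lam p) * (c * 2 ^ (p - 1)) * 2 =
        19 / 20 * ((p - 1) * lam p * c) * (2 ^ (p - 1) * 2) := by ring
      rw [this, hlc]; linarith
    exact ((hcont1.eventually_lt hcont2 hlt).filter_mono nhdsWithin_le_nhds).mono
      fun _ h => h.le
  obtain ⟨θ, hθ, hθ0, hθ1⟩ := (hev.and (Ioo_mem_nhdsGT (zero_lt_one' ℝ))).exists
  refine ⟨θ, hθ0, hθ1, fun m s hm hs => ?_⟩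
  have h1 := wellDist_le_near hp hp0 hθ0.le hm hs
  have h2 := potential_ge_near hp0 hθ1.le hm hs
  rw [hβ, sub_add_cancel] at h1
  refine le_trans ?_ h2
  calc μ * wellDist p p m s ≤ μ * (c * (2 + θ) ^ (p - 1) * (|s - m| ^ p / p)) := by gcongr
    _ = μ * (c * (2 + θ) ^ (p - 1)) * 2 * (|s - m| ^ p / (2 * p)) := by field_simp
    _ ≤ (2 - θ) ^ p * (|s - m| ^ p / (2 * p)) := by gcongr
    _ = _ := by ring

/-- Bernoulli gives (1+ψ)^q ≥ 1 + qψ, and (1+ψ)^q (1-ψ)^q ≤ 1; hence (1-ψ)^q ≤ 1/(1+qψ). -/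
theorem mul_le_one_sub_rpow {q ψ : ℝ} (hq : 1 ≤ q) (h0 : 0 ≤ ψ) (h1 : ψ ≤ 1) :
    q * ψ ≤ (1 + q * ψ) * (1 - (1 - ψ) ^ q) := by
  have hA : 0 ≤ (1 - ψ) ^ q := Real.rpow_nonneg (by linarith) _
  have hB := one_add_mul_self_le_rpow_one_add (s := ψ) (by linarith) hq
  have hAB : (1 + ψ) ^ q * (1 - ψ) ^ q ≤ 1 := by
    rw [← Real.mul_rpow (by linarith) (by linarith)]
    exact Real.rpow_le_one (by nlinarith) (by nlinarith) (by linarith)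
  nlinarith [mul_le_mul_of_nonneg_right hB hA]

/-- The deficit ψ = 1 - φ solves ψ' = νψ/ε, so the calibration condition reduces to νψ ≤ μ(1 -
(1-ψ)^q), and the error χ is 0. -/
theorem exp_profile_bound {μ ν q ψ₁ ε ℓ D F y : ℝ} (hε : 0 < ε) (hν : 0 ≤ ν) (hq : 0 ≤ q)
    (hψ0 : 0 ≤ ψ₁) (hψ1 : ψ₁ ≤ 1)
    (hexp : ∀ ψ, 0 ≤ ψ → ψ ≤ ψ₁ → ν * ψ ≤ μ * (1 - (1 - ψ) ^ q)) (hD : 0 ≤ D) (hF : μ * D ≤ F)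
    (hy : y ≤ ℓ) :
    0 ≤ 1 - ψ₁ * Real.exp (ν * (y - ℓ) / ε) ∧
    |deriv (fun y => 1 - ψ₁ * Real.exp (ν * (y - ℓ) / ε)) y| * D ≤
      (1 - (1 - ψ₁ * Real.exp (ν * (y - ℓ) / ε)) ^ q) * (F / ε) + 0 := by
  have hE : Real.exp (ν * (y - ℓ) / ε) ≤ 1 := Real.exp_le_one_iff.2
    (div_nonpos_of_nonpos_of_nonneg
      (mul_nonpos_of_nonneg_of_nonpos hν (by linarith)) hε.le)
  have hd : deriv (fun y => 1 - ψ₁ * Real.exp (ν * (y - ℓ) / ε)) y =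
      -(ν * (ψ₁ * Real.exp (ν * (y - ℓ) / ε)) / ε) := by
    have h1 : HasDerivAt (fun y : ℝ => ν * (y - ℓ) / ε) (ν * 1 / ε) y :=
      (((hasDerivAt_id y).sub_const ℓ).const_mul ν).div_const ε
    rw [((h1.exp.const_mul ψ₁).const_sub 1).deriv]; ring
  rw [hd, abs_neg, abs_of_nonneg (by positivity), add_zero]
  set ψ := ψ₁ * Real.exp (ν * (y - ℓ) / ε) with hψ
  have hψ0' : 0 ≤ ψ := by positivity
  have hψ1' : ψ ≤ ψ₁ := mul_le_of_le_one_right hψ0 hE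
  have h4 : 0 ≤ 1 - (1 - ψ) ^ q :=
    sub_nonneg.2 (Real.rpow_le_one (by linarith) (by linarith) hq)
  refine ⟨by linarith, ?_⟩
  calc ν * ψ / ε * D ≤ μ * (1 - (1 - ψ) ^ q) / ε * D :=
        mul_le_mul_of_nonneg_right (div_le_div_of_nonneg_right (hexp ψ hψ0' hψ1') hε.le) hD
    _ = (1 - (1 - ψ) ^ q) * (μ * D / ε) := by ring
    _ ≤ (1 - (1 - ψ) ^ q) * (F / ε) :=
        mul_le_mul_of_nonneg_left (div_le_div_of_nonneg_right hF hε.le) h4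

/-- Once φ ≤ 1 - ψ₁, the reserve 1 - φ^q is at least ψ₁, so ψ₁F/ε dominates the fixed slope (1-ψ₁)/ℓ
times D for small ε, again with χ = 0. -/
theorem affine_profile_bound {μ q ψ₁ ε ℓ D F y : ℝ} (hε : 0 < ε) (hq : 1 ≤ q) (hμ : 0 < μ)
    (hψ0 : 0 < ψ₁) (hψ1 : ψ₁ ≤ 1) (hℓ : 0 < ℓ) (hεs : ε ≤ μ * ψ₁ * ℓ) (hD : 0 ≤ D)
    (hF : μ * D ≤ F) (hy : y ∈ Icc 0 ℓ) :
    0 ≤ (1 - ψ₁) * (1 - y / ℓ) ∧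
    |deriv (fun y => (1 - ψ₁) * (1 - y / ℓ)) y| * D ≤
      (1 - ((1 - ψ₁) * (1 - y / ℓ)) ^ q) * (F / ε) + 0 := by
  have hd : deriv (fun y => (1 - ψ₁) * (1 - y / ℓ)) y = -((1 - ψ₁) / ℓ) := by
    have h1 : HasDerivAt (fun y : ℝ => y / ℓ) (1 / ℓ) y := (hasDerivAt_id y).div_const ℓ
    rw [((h1.const_sub 1).const_mul (1 - ψ₁)).deriv]; ring
  have t0 : 0 ≤ y / ℓ := div_nonneg hy.1 hℓ.le
  have t1 : y / ℓ ≤ 1 := (div_le_one hℓ).2 hy.2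
  rw [hd, abs_neg, abs_of_nonneg (div_nonneg (by linarith) hℓ.le), add_zero]
  set t := (1 - ψ₁) * (1 - y / ℓ) with ht
  have ht0 : 0 ≤ t := mul_nonneg (by linarith) (by linarith)
  have ht1 : t ≤ 1 - ψ₁ := mul_le_of_le_one_right (by linarith) (by linarith)
  have h3 : t ^ q ≤ t := by
    have := Real.rpow_le_rpow_of_exponent_ge_of_imp ht0 (by linarith : t ≤ 1) hq
      (fun _ h => absurd h (by linarith))
    rwa [Real.rpow_one] at this
  have h5 : (1 - ψ₁) / ℓ ≤ ψ₁ * μ / ε := by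
    rw [div_le_div_iff₀ hℓ hε]
    nlinarith
  have hF0 : 0 ≤ F := le_trans (by positivity) hF
  refine ⟨ht0, ?_⟩
  calc (1 - ψ₁) / ℓ * D ≤ ψ₁ * μ / ε * D := mul_le_mul_of_nonneg_right h5 hD
    _ = ψ₁ * (μ * D / ε) := by ring
    _ ≤ ψ₁ * (F / ε) := by gcongr
    _ ≤ (1 - t ^ q) * (F / ε) := by gcongr; linarith

/-- Two profiles are glued at the value 1 - ψ₁: an exponential one on length ℓ₁ next to the chosen
end, then an affine one reaching 0 on length ℓ₂. The only loss is the deficit ψ₁ exp(-νℓ₁/ε) of φ at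
that end. -/
theorem hasTailBound_critical (hp : 1 < p) {r A : ℝ} (hr : 0 < r) (hA : A < r * √2 * lam p) :
    HasTailBound p p r fun ε => Real.exp (-(A * p) / (2 * ε)) := by
  have hp0 : 0 < p := by linarith
  have hp1 : 0 < p - 1 := by linarith
  have hl0 : 0 < lam p := by unfold lam; positivity
  obtain ⟨θ, hθ0, hθ1, hD⟩ := exists_mul_wellDist_le_potential hp
  -- Linearizing 1 - (1-ψ)^q at ψ = 0 allows the rate μq = (19/20) p λ_p. The smaller ν leaves the
  -- ratio 19/18, and ψ₁ = 1/(18q) keeps the factor 1 + qψ below it.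
  set μ := 19 / 20 * ((p - 1) * lam p) with hμ
  have hμ0 : 0 < μ := by positivity
  set q := p / (p - 1) with hq
  have hq1 : 1 ≤ q := by rw [hq, le_div_iff₀ hp1]; linarith
  have hq0 : 0 < q := by linarith
  set ν := 9 / 10 * (p * lam p) with hν
  have hν0 : 0 < ν := by positivity
  have hμq : μ * q = 19 / 18 * ν := by rw [hμ, hq, hν]; field_simp; ring
  set ψ₁ := 1 / (18 * q) with hψ₁
  have hψ0 : 0 < ψ₁ := by positivity
  have hψq : q * ψ₁ = 1 / 18 := by rw [hψ₁]; field_simp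
  have hψ1 : ψ₁ < 1 := by nlinarith
  -- The exponent is νℓ₁ = 0.81 p λ_p r, which exceeds Ap/2 because A < r√2 λ_p and √2/2 ≤ 0.75.
  -- With ℓ₂ = r/20 the tail has length r - r/20.
  set ℓ₁ := 9 / 10 * r with hℓ₁
  have hℓ₁0 : 0 < ℓ₁ := by positivity
  set ℓ₂ := r / 20 with hℓ₂
  have hℓ₂0 : 0 < ℓ₂ := by positivity
  have hrate : A * p / 2 ≤ ν * ℓ₁ := by
    have h2 : √2 ≤ 1.5 := by
      rw [show (1.5 : ℝ) = √(1.5 ^ 2) by rw [Real.sqrt_sq (by norm_num)]]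
      exact Real.sqrt_le_sqrt (by norm_num)
    have h3 : A ≤ r * lam p * 1.5 := by
      have : r * lam p * √2 ≤ r * lam p * 1.5 := by gcongr
      nlinarith
    have h4 : A * p ≤ r * lam p * 1.5 * p := by gcongr
    have h5 : 0 < r * lam p * p := by positivity
    rw [hν, hℓ₁]
    nlinarith
  have hexp : ∀ ψ, 0 ≤ ψ → ψ ≤ ψ₁ → ν * ψ ≤ μ * (1 - (1 - ψ) ^ q) := by
    intro ψ h0 h1
    have hb := mul_le_one_sub_rpow hq1 h0 (by linarith)
    have h3 : q * ψ ≤ 1 / 18 := by rw [← hψq]; gcongr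
    have h4 : 0 ≤ 1 - (1 - ψ) ^ q :=
      sub_nonneg.2 (Real.rpow_le_one (by linarith) (by linarith) hq0.le)
    have h5 : q * ψ ≤ 19 / 18 * (1 - (1 - ψ) ^ q) :=
      hb.trans (by gcongr; linarith)
    have h6 : μ * q * ψ ≤ 19 / 18 * (μ * (1 - (1 - ψ) ^ q)) := by
      calc μ * q * ψ = μ * (q * ψ) := by ring
        _ ≤ μ * (19 / 18 * (1 - (1 - ψ) ^ q)) := by gcongr
        _ = _ := by ring
    rw [hμq] at h6
    linarith
  have hDbd : ∃ B, 0 ≤ B ∧ ∀ m s : ℝ, (m = 1 ∨ m = -1) → |s - m| ≤ θ → wellDist p p m s ≤ B := by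
    have hcomp : ∀ m : ℝ, ∃ B, ∀ s ∈ Icc (m - θ) (m + θ), wellDist p p m s ≤ B := fun m =>
      (isCompact_Icc.bddAbove_image
        (continuous_wellDist hp hp0 m).continuousOn).imp fun B hB s hs =>
          hB (mem_image_of_mem _ hs)
    obtain ⟨B₁, h1⟩ := hcomp 1
    obtain ⟨B₂, h2⟩ := hcomp (-1)
    refine ⟨max 0 (max B₁ B₂), le_max_left _ _, ?_⟩
    rintro m s (rfl | rfl) hs
    · exact (h1 s ⟨by linarith [(abs_le.1 hs).1], by linarith [(abs_le.1 hs).2]⟩).trans (by simp)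
    · exact (h2 s ⟨by linarith [(abs_le.1 hs).1], by linarith [(abs_le.1 hs).2]⟩).trans (by simp)
  obtain ⟨B, hB0, hB⟩ := hDbd
  refine ⟨θ, r / 20, B, hθ0, hθ1, by positivity, by linarith, hB0, ?_⟩
  filter_upwards [Ioo_mem_nhdsGT (show 0 < μ * ψ₁ * ℓ₂ by positivity)] with ε hε'
  obtain ⟨hε, hεs⟩ := hε'
  intro σ hσ x₁ x₂ hx w hw hwm
  have p1 : ∀ y₁ y₂ : ℝ, y₂ - y₁ = ℓ₁ → x₁ ≤ y₁ → y₂ ≤ x₂ → _ := fun y₁ y₂ hy h1 h2 =>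
    calibration_profile (χ := 0) (m := σ) (θ := θ)
      (φ := fun y => 1 - ψ₁ * Real.exp (ν * (y - ℓ₁) / ε)) hp hp0 hℓ₁0.le hy hε
      (hw.mono h1 (by linarith) h2) (fun x hx' => hwm x ⟨h1.trans hx'.1, hx'.2.trans h2⟩)
      (by fun_prop)
      (fun y hy => (exp_profile_bound hε hν0.le hq0.le hψ0.le hψ1.le hexp (wellDist_nonneg σ σ)
        (hD σ σ hσ (by simpa using hθ0.le)) hy.2).1)
      (fun y hy s hs => (exp_profile_bound hε hν0.le hq0.le hψ0.le hψ1.le hexp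
        (wellDist_nonneg σ s) (hD σ s hσ hs) hy.2).2)
  have p2 : ∀ y₁ y₂ : ℝ, y₂ - y₁ = ℓ₂ → x₁ ≤ y₁ → y₂ ≤ x₂ → _ := fun y₁ y₂ hy h1 h2 =>
    calibration_profile (χ := 0) (m := σ) (θ := θ)
      (φ := fun y => (1 - ψ₁) * (1 - y / ℓ₂)) hp hp0 hℓ₂0.le hy hε
      (hw.mono h1 (by linarith) h2) (fun x hx' => hwm x ⟨h1.trans hx'.1, hx'.2.trans h2⟩)
      (by fun_prop)
      (fun y hy => (affine_profile_bound hε hq1 hμ0 hψ0 hψ1.le hℓ₂0 hεs.le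
        (wellDist_nonneg σ σ) (hD σ σ hσ (by simpa using hθ0.le)) hy).1)
      (fun y hy s hs => (affine_profile_bound hε hq1 hμ0 hψ0 hψ1.le hℓ₂0 hεs.le
        (wellDist_nonneg σ s) (hD σ s hσ hs) hy).2)
  have hx12 : x₁ ≤ x₂ := by linarith
  have hdef : ψ₁ * Real.exp (ν * (0 - ℓ₁) / ε) ≤ Real.exp (-(A * p) / (2 * ε)) := by
    have h1 : ν * (0 - ℓ₁) / ε ≤ -(A * p) / (2 * ε) := by
      rw [div_le_div_iff₀ hε (by positivity)]
      nlinarith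
    calc ψ₁ * Real.exp (ν * (0 - ℓ₁) / ε) ≤ 1 * Real.exp (-(A * p) / (2 * ε)) := by gcongr
      _ = _ := one_mul _
  have hbound : ∀ x ∈ Icc x₁ x₂, ψ₁ * Real.exp (ν * (0 - ℓ₁) / ε) * wellDist p p σ (w x) ≤
      B * Real.exp (-(A * p) / (2 * ε)) := fun x hx' => by
    have := hB σ (w x) hσ (hwm x hx')
    have := wellDist_nonneg (p := p) (n := p) σ (w x)
    rw [mul_comm B]
    gcongr
  have hadd : ∀ y ∈ Icc x₁ x₂, (∫ x in x₁..y, energyDensity p p ε w x) +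
      (∫ x in y..x₂, energyDensity p p ε w x) = ∫ x in x₁..x₂, energyDensity p p ε w x := by
    intro y hy
    have hI := hw.integrableOn_energyDensity hp hp0 hx12 (ε := ε)
    refine intervalIntegral.integral_add_adjacent_intervals ?_ ?_
    · exact (intervalIntegrable_iff_integrableOn_Ioc_of_le hy.1).2
        (hI.mono_set (Ioc_subset_Ioc_right hy.2))
    · exact (intervalIntegrable_iff_integrableOn_Ioc_of_le hy.2).2
        (hI.mono_set (Ioc_subset_Ioc_left hy.1))
  have hsum : ℓ₁ + ℓ₂ = r - r / 20 := by rw [hℓ₁, hℓ₂]; ring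
  -- For the left end the exponential piece comes first and the affine piece second; for the right
  -- end the order is reflected.
  constructor
  · have a1 := (p1 x₁ (x₁ + ℓ₁) (by ring) le_rfl (by linarith)).1
    have a2 := (p2 (x₁ + ℓ₁) x₂ (by linarith) (by linarith) le_rfl).1
    have a3 := hadd (x₁ + ℓ₁) ⟨by linarith, by linarith⟩
    have a4 := hbound x₁ ⟨le_rfl, hx12⟩
    simp only [sub_self, mul_zero, zero_div, Real.exp_zero, mul_one, div_self hℓ₂0.ne', sub_zero,
      zero_mul, add_zero] at a1 a2
    linarith
  · have a1 := (p1 (x₁ + ℓ₂) x₂ (by linarith) (by linarith) le_rfl).2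
    have a2 := (p2 x₁ (x₁ + ℓ₂) (by ring) le_rfl (by linarith)).2
    have a3 := hadd (x₁ + ℓ₂) ⟨by linarith, by linarith⟩
    have a4 := hbound x₂ ⟨hx12, le_rfl⟩
    simp only [sub_self, mul_zero, zero_div, Real.exp_zero, mul_one, div_self hℓ₂0.ne', sub_zero,
      zero_mul, add_zero] at a1 a2
    linarith

end

end PLaplaceAC

namespace PLaplaceAC

/-! ### Functions close to a step function -/

section StepFun

variable {N : ℕ} {h : Fin N → ℝ} {σ : ℝ}

theorem stepFun_eq_or (hσ : σ = 1 ∨ σ = -1) (x : ℝ) : stepFun σ h x = 1 ∨ stepFun σ h x = -1 := by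
  unfold stepFun
  rcases neg_one_pow_eq_or ℝ (Finset.univ.filter fun i => h i < x).card with e | e <;>
    rcases hσ with rfl | rfl <;> simp [e]

theorem abs_stepFun (hσ : σ = 1 ∨ σ = -1) (x : ℝ) : |stepFun σ h x| = 1 := by
  rcases stepFun_eq_or (h := h) hσ x with e | e <;> simp [e]

theorem stepFun_eq_of_forall {x y : ℝ} (hxy : x ≤ y) (hno : ∀ i, x ≤ h i → ¬h i < y) :
    stepFun σ h x = stepFun σ h y := by
  unfold stepFun
  congr 3
  ext i
  simp only [Finset.mem_filter, Finset.mem_univ, true_and]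
  exact ⟨fun hi => hi.trans_le hxy, fun hi => not_le.1 fun hx => hno i hx hi⟩

theorem measurable_stepFun : Measurable (stepFun σ h) := by
  have hc : Measurable fun x : ℝ => (Finset.univ.filter fun i => h i < x).card := by
    simp only [Finset.card_filter]
    exact Finset.measurable_sum _ fun i _ =>
      Measurable.ite measurableSet_Ioi measurable_const measurable_const
  exact (measurable_of_countable fun k : ℕ => σ * (-1 : ℝ) ^ k).comp hc

variable {r : ℝ} (hr : 0 < r) (hsep : ∀ i j : Fin N, i < j → h i + r < h j - r)

include hsep in
theorem two_mul_lt_abs_sub {i j : Fin N} (hij : i ≠ j) : 2 * r < |h i - h j| := by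
  rcases lt_or_gt_of_ne hij with hlt | hlt
  · have := hsep i j hlt
    rw [abs_sub_comm]
    linarith [le_abs_self (h j - h i)]
  · have := hsep j i hlt
    linarith [le_abs_self (h i - h j)]

include hr hsep in
theorem stepFun_right {i : Fin N} {x : ℝ} (hx : x ∈ Ioc (h i) (h i + r)) :
    stepFun σ h x = stepFun σ h (h i + r) := by
  refine stepFun_eq_of_forall hx.2 fun j hj hj2 => ?_
  have hne : j ≠ i := by rintro rfl; linarith [hx.1]
  have h1 := two_mul_lt_abs_sub hsep hne
  have h2 : |h j - h i| ≤ r := abs_le.2 ⟨by linarith [hx.1], by linarith⟩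
  linarith

-- Passing h i adds exactly one jump to the count, the others being more than 2r away. Jumps are
-- counted by strict inequality, so h i itself carries the left value.
include hr hsep in
theorem stepFun_left {i : Fin N} {x : ℝ} (hx : x ∈ Icc (h i - r) (h i)) :
    stepFun σ h x = -stepFun σ h (h i + r) := by
  have e : (Finset.univ.filter fun j => h j < h i + r) =
      insert i (Finset.univ.filter fun j => h j < x) := by
    ext j
    simp only [Finset.mem_filter, Finset.mem_univ, true_and, Finset.mem_insert]
    by_cases hji : j = i
    · subst hji; simp [hr]
    · have h1 := two_mul_lt_abs_sub hsep hji
      simp only [hji, false_or]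
      refine ⟨fun hj => not_le.1 fun hx2 => ?_, fun hj => by linarith [hx.2]⟩
      have h2 : |h j - h i| ≤ r := abs_le.2 ⟨by linarith [hx.1], by linarith⟩
      linarith
  have hni : i ∉ Finset.univ.filter fun j => h j < x := by simpa using hx.2
  unfold stepFun
  rw [e, Finset.card_insert_of_notMem hni, pow_succ]
  ring

end StepFun

/-- Energies on disjoint subintervals add up to at most the total energy. -/
theorem sum_integral_le_of_pairwise_disjoint {ι : Type*} [Fintype ι] {f : ℝ → ℝ} {a b : ℝ}
    (hab : a ≤ b) (hf : IntegrableOn f (Ioc a b)) (hf0 : ∀ x, 0 ≤ f x) {c d : ι → ℝ}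
    (hcd : ∀ i, c i ≤ d i) (ha : ∀ i, a ≤ c i) (hb : ∀ i, d i ≤ b)
    (hdisj : Pairwise fun i j => Disjoint (Ioc (c i) (d i)) (Ioc (c j) (d j))) :
    ∑ i, ∫ x in c i..d i, f x ≤ ∫ x in a..b, f x := by
  have hsub : (⋃ i, Ioc (c i) (d i)) ⊆ Ioc a b :=
    iUnion_subset fun i => Ioc_subset_Ioc (ha i) (hb i)
  simp only [intervalIntegral.integral_of_le (hcd _), intervalIntegral.integral_of_le hab]
  rw [← integral_iUnion_fintype (fun i => measurableSet_Ioc) hdisj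
    fun i => hf.mono_set (Ioc_subset_Ioc (ha i) (hb i))]
  exact setIntegral_mono_set hf (ae_of_all _ hf0) hsub.eventuallyLE

section
variable {p n a b r σ : ℝ} {N : ℕ} {h : Fin N → ℝ}

theorem integrableOn_abs_sub_stepFun (hσ : σ = 1 ∨ σ = -1) {w : ℝ → ℝ}
    (hw : ContinuousOn w (Icc a b)) :
    IntegrableOn (fun x => |w x - stepFun σ h x|) (Ioc a b) := by
  refine Integrable.abs (Integrable.sub ?_ ?_)
  · exact (hw.integrableOn_Icc).mono_set Ioc_subset_Icc_self
  · refine Measure.integrableOn_of_bounded (M := 1) (by simp)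
      measurable_stepFun.aestronglyMeasurable (ae_of_all _ fun x => ?_)
    rw [Real.norm_eq_abs, abs_stepFun hσ]

/-- A function which is close to a step function in `L¹` is close to it somewhere on every interval
which is not too short. -/
theorem exists_abs_sub_stepFun_le (hab : a ≤ b) (hσ : σ = 1 ∨ σ = -1) {w : ℝ → ℝ}
    (hw : ContinuousOn w (Icc a b)) {c d κ : ℝ} (hcd : c ≤ d) (hac : a ≤ c) (hdb : d ≤ b)
    (hlt : ∫ x in a..b, |w x - stepFun σ h x| < κ * (d - c)) :
    ∃ x ∈ Icc c d, |w x - stepFun σ h x| ≤ κ := by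
  by_contra! hcon
  have hI := integrableOn_abs_sub_stepFun (h := h) hσ hw
  have h1 : ∫ x in c..d, κ ≤ ∫ x in c..d, |w x - stepFun σ h x| :=
    intervalIntegral.integral_mono_on hcd intervalIntegrable_const
      ((intervalIntegrable_iff_integrableOn_Ioc_of_le hcd).2
        (hI.mono_set (Ioc_subset_Ioc hac hdb))) fun x hx => (hcon x hx).le
  have h2 : ∫ x in c..d, |w x - stepFun σ h x| ≤ ∫ x in a..b, |w x - stepFun σ h x| := by
    rw [intervalIntegral.integral_of_le hcd, intervalIntegral.integral_of_le hab]
    exact setIntegral_mono_set hI (ae_of_all _ fun x => abs_nonneg _)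
      (Ioc_subset_Ioc hac hdb).eventuallyLE
  rw [intervalIntegral.integral_const, smul_eq_mul] at h1
  linarith

/-- The energy of a path between the wells through a prescribed value. -/
theorem wellDist_add_le_integral (hp : 1 < p) (hn : 0 < n) {ε m η l x y : ℝ} (hε : 0 < ε)
    {w : ℝ → ℝ} (hw : MemSobolev p l y w) (hlx : l ≤ x) (hxy : x ≤ y)
    (hl : wellDist p n (-m) (w l) ≤ η) (hy : wellDist p n m (w y) ≤ η) :
    wellDist p n m (w x) + wellDist p n (-m) (w x) - 2 * η ≤
      ∫ t in l..y, energyDensity p n ε w t := by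
  have hly := hlx.trans hxy
  have h1 := abs_wellDist_sub_le hp hn (-m) hlx hε (hw.mono le_rfl hlx hxy)
  have h2 := abs_wellDist_sub_le hp hn m hxy hε (hw.mono hlx hxy le_rfl)
  have hI := hw.integrableOn_energyDensity hp hn hly (ε := ε)
  have h3 := intervalIntegral.integral_add_adjacent_intervals
    ((intervalIntegrable_iff_integrableOn_Ioc_of_le hlx).2
      (hI.mono_set (Ioc_subset_Ioc_right hxy)))
    ((intervalIntegrable_iff_integrableOn_Ioc_of_le hxy).2
      (hI.mono_set (Ioc_subset_Ioc_left hlx)))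
  have h4 := le_abs_self (wellDist p n (-m) (w x) - wellDist p n (-m) (w l))
  have h5 := neg_abs_le (wellDist p n m (w y) - wellDist p n m (w x))
  linarith

theorem exists_wellDist_le (hp : 1 < p) (hn : 0 < n) {η : ℝ} (hη : 0 < η) :
    ∃ κ > 0, ∀ m s : ℝ, (m = 1 ∨ m = -1) → |s - m| ≤ κ → wellDist p n m s ≤ η := by
  obtain ⟨κ, hκ, H⟩ := Metric.continuousAt_iff.1
    (continuous_wellDist hp hn 1).continuousAt η hη
  have main : ∀ s, |s - 1| ≤ κ / 2 → wellDist p n 1 s ≤ η := fun s hs => by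
    have := H (x := s) (by rw [Real.dist_eq]; linarith)
    rw [wellDist_self, Real.dist_eq, sub_zero] at this
    exact (le_abs_self _).trans this.le
  refine ⟨κ / 2, by positivity, ?_⟩
  rintro m s (rfl | rfl) hs
  · exact main s hs
  · rw [wellDist_neg]
    exact main _ (by rwa [← abs_neg, show -(-s - 1) = s - -1 by ring])

/-- If `w` is close to a step function with `N` jumps in `L¹` and its energy is not much larger than
`N` times the minimal energy of a transition, then it is uniformly close to the step function away
from the jumps, and does not leave a neighbourhood of `[-1, 1]`. -/
theorem exists_localization (hp : 1 < p) (hn : 0 < n) (hab : a < b) (hσ : σ = 1 ∨ σ = -1)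
    (hr : 0 < r) (hsep : ∀ i j : Fin N, i < j → h i + r < h j - r)
    (ha : ∀ i, a ≤ h i - r) (hb : ∀ i, h i + r ≤ b) {θ ρ : ℝ} (hθ0 : 0 < θ) (hθ1 : θ < 1)
    (hρ0 : 0 < ρ) (hρr : ρ < r) :
    ∃ δ₀ > 0, ∀ ε > 0, ∀ w : ℝ → ℝ, MemSobolev p a b w →
      ∫ x in a..b, |w x - stepFun σ h x| ≤ δ₀ →
      energy p n ε a b w ≤ N * transitionEnergy p n + δ₀ →
      (∀ x ∈ Icc a b, (∀ i, ρ ≤ |x - h i|) → |w x - stepFun σ h x| ≤ θ) ∧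
        ∀ x ∈ Icc a b, |w x| ≤ 1 + θ := by
  obtain ⟨d, hd0, hd1, hd2⟩ := exists_wellDist_lower hp hn hθ0 hθ1
  -- Each transition loses at most 2η and a possible extra interval loses η. The total is at most
  -- d/2, so a surplus d contradicts the allowed excess d/4.
  set η := d / (4 * (N + 1)) with hη
  have hη0 : 0 < η := by positivity
  have hηN : (2 * N + 1) * η ≤ d / 2 := by
    rw [hη, mul_div_assoc', div_le_div_iff₀ (by positivity) (by norm_num)]
    nlinarith
  obtain ⟨κ, hκ0, hκ⟩ := exists_wellDist_le hp hn hη0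
  -- The length of the intervals on which L¹ closeness yields a good point: it fits in the annuli
  -- ρ/6 to ρ/3 and ρ to r around a jump, and on at least one side of any point of [a, b].
  set τ := min (ρ / 6) (min (r - ρ) ((b - a) / 2)) with hτ
  have hτ0 : 0 < τ := lt_min (by positivity) (lt_min (by linarith) (by linarith))
  have hτ1 : τ ≤ ρ / 6 := min_le_left _ _
  have hτ2 : τ ≤ r - ρ := (min_le_right _ _).trans (min_le_left _ _)
  have hτ3 : τ ≤ (b - a) / 2 := (min_le_right _ _).trans (min_le_right _ _)
  refine ⟨min (d / 4) (κ * τ / 2), lt_min (by positivity) (by positivity), ?_⟩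
  intro ε hε w hw hL1 hE
  have hL1' : ∫ x in a..b, |w x - stepFun σ h x| < κ * τ :=
    (hL1.trans (min_le_right _ _)).trans_lt (half_lt_self (by positivity))
  have hE' : energy p n ε a b w ≤ N * transitionEnergy p n + d / 4 :=
    hE.trans (by gcongr; exact min_le_left _ _)
  have hwc := hw.continuousOn hab.le
  have hI := hw.integrableOn_energyDensity hp hn hab.le (ε := ε)
  have hI0 := energyDensity_nonneg hp hn hε w
  have hm : ∀ i, stepFun σ h (h i + r) = 1 ∨ stepFun σ h (h i + r) = -1 :=
    fun i => stepFun_eq_or hσ _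
  -- points close to the wells on both sides of the jumps
  have good : ∀ c e : ℝ, τ ≤ e - c → a ≤ c → e ≤ b →
      ∃ x ∈ Icc c e, wellDist p n (stepFun σ h x) (w x) ≤ η := by
    intro c e hce hac heb
    obtain ⟨x, hx, hx2⟩ := exists_abs_sub_stepFun_le (h := h) hab.le hσ hwc (by linarith) hac heb
      (hL1'.trans_le (show κ * τ ≤ κ * (e - c) by gcongr))
    exact ⟨x, hx, hκ _ _ (stepFun_eq_or hσ x) hx2⟩
  have pts : ∀ s t : ℝ, 0 < s → s + τ ≤ t → t ≤ r → ∀ i, ∃ l y : ℝ,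
      l ∈ Icc (h i - t) (h i - s) ∧ y ∈ Icc (h i + s) (h i + t) ∧
      wellDist p n (-stepFun σ h (h i + r)) (w l) ≤ η ∧
      wellDist p n (stepFun σ h (h i + r)) (w y) ≤ η := by
    intro s t hs hst htr i
    have hai := ha i
    have hbi := hb i
    obtain ⟨l, hl, hl2⟩ := good (h i - t) (h i - s) (by linarith) (by linarith) (by linarith)
    obtain ⟨y, hy, hy2⟩ := good (h i + s) (h i + t) (by linarith) (by linarith) (by linarith)
    rw [stepFun_left hr hsep ⟨by linarith [hl.1], by linarith [hl.2]⟩] at hl2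
    rw [stepFun_right hr hsep ⟨by linarith [hy.1], by linarith [hy.2]⟩] at hy2
    exact ⟨l, y, hl, hy, hl2, hy2⟩
  have part1 : ∀ x ∈ Icc a b, (∀ i, ρ ≤ |x - h i|) → |w x - stepFun σ h x| ≤ θ := by
    intro x hx hfar
    by_contra! hbad
    -- The transitions are confined within ρ/3 of the jumps, leaving the ρ/6-neighbourhood of x free
    -- for a separate excursion of cost d - η.
    choose l y hl hy hl2 hy2 using pts (ρ / 6) (ρ / 3) (by positivity) (by linarith) (by linarith)
    have hDx := hd1 _ _ (stepFun_eq_or hσ x) hbad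
    have hconst : ∀ z, |z - x| ≤ ρ / 6 → stepFun σ h z = stepFun σ h x := by
      intro z hz
      rw [abs_le] at hz
      rcases le_total z x with hzx | hzx
      · refine stepFun_eq_of_forall hzx fun i hi hi2 => ?_
        have := hfar i
        rw [abs_of_nonneg (by linarith)] at this
        linarith
      · refine (stepFun_eq_of_forall hzx fun i hi hi2 => ?_).symm
        have := hfar i
        rw [abs_of_nonpos (by linarith)] at this
        linarith
    have hxint : ∃ c e : ℝ, a ≤ c ∧ c ≤ e ∧ e ≤ b ∧ |c - x| ≤ ρ / 6 ∧ |e - x| ≤ ρ / 6 ∧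
        d - η ≤ ∫ t in c..e, energyDensity p n ε w t := by
      rcases le_total (x + τ) b with hc | hc
      · obtain ⟨z, hz, hz2⟩ := good x (x + τ) (by linarith) hx.1 hc
        have hzx : |z - x| ≤ ρ / 6 := abs_le.2 ⟨by linarith [hz.1], by linarith [hz.2]⟩
        refine ⟨x, z, hx.1, hz.1, hz.2.trans hc, by simp; positivity, hzx, ?_⟩
        rw [hconst z hzx] at hz2
        have h1 := abs_wellDist_sub_le hp hn (stepFun σ h x) hz.1 hε
          (hw.mono hx.1 hz.1 (hz.2.trans hc))
        have h2 := neg_abs_le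
          (wellDist p n (stepFun σ h x) (w z) - wellDist p n (stepFun σ h x) (w x))
        linarith
      · obtain ⟨z, hz, hz2⟩ := good (x - τ) x (by linarith) (by linarith) hx.2
        have hzx : |z - x| ≤ ρ / 6 := abs_le.2 ⟨by linarith [hz.1], by linarith [hz.2]⟩
        have haz : a ≤ z := by linarith [hz.1]
        refine ⟨z, x, haz, hz.2, hx.2, hzx, by simp; positivity, ?_⟩
        rw [hconst z hzx] at hz2
        have h1 := abs_wellDist_sub_le hp hn (stepFun σ h x) hz.2 hε
          (hw.mono haz hz.2 hx.2)
        have h2 := le_abs_self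
          (wellDist p n (stepFun σ h x) (w x) - wellDist p n (stepFun σ h x) (w z))
        linarith
    obtain ⟨c, e, hac, hce, heb, hcx, hex, hint⟩ := hxint
    have hly : ∀ i, l i ≤ y i := fun i => by linarith [(hl i).2, (hy i).1]
    -- The index `none` carries the excursion near x, the others the transitions.
    have hsum := sum_integral_le_of_pairwise_disjoint (ι := Option (Fin N)) hab.le hI hI0
      (c := fun o => o.elim c l) (d := fun o => o.elim e y)
      (by rintro (_ | i); exacts [hce, hly i])
      (by rintro (_ | i); exacts [hac, by have := (hl i).1; have := ha i; simp; linarith])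
      (by rintro (_ | i); exacts [heb, by have := (hy i).2; have := hb i; simp; linarith])
      (by
        have hmix : ∀ i, Disjoint (Ioc c e) (Ioc (l i) (y i)) := fun i => by
          rw [Set.disjoint_left]
          intro z hz hz2
          have h1 := hfar i
          have h2 : |x - h i| < ρ := by
            rw [abs_le] at hcx hex
            rw [abs_lt]
            constructor <;> linarith [hz.1, hz.2, hz2.1, hz2.2, (hl i).1, (hy i).2]
          linarith
        rintro (_ | i) (_ | j) hij
        · exact absurd rfl hij
        · exact hmix j
        · exact (hmix i).symm
        · have hne : i ≠ j := fun e => hij (by rw [e])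
          have h1 := two_mul_lt_abs_sub hsep hne
          simp only [Option.elim]
          rw [Set.disjoint_left]
          intro z hz hz2
          have h2 : |h i - h j| ≤ 2 * r := by
            rw [abs_le]
            constructor <;> linarith [hz.1, hz.2, hz2.1, hz2.2, (hl i).1, (hy i).2, (hl j).1,
              (hy j).2]
          linarith)
    rw [Fintype.sum_option] at hsum
    simp only [Option.elim] at hsum
    have hlow : (N : ℝ) * (transitionEnergy p n - 2 * η) ≤
        ∑ i, ∫ t in l i..y i, energyDensity p n ε w t := by
      refine le_trans (le_of_eq (by simp; ring)) (Finset.sum_le_sum (s := Finset.univ)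
        (f := fun _ => transitionEnergy p n - 2 * η) fun i _ => ?_)
      have h1 := wellDist_add_le_integral hp hn hε (x := l i)
        (hw.mono (by linarith [(hl i).1, ha i]) (hly i) (by linarith [(hy i).2, hb i]))
        le_rfl (hly i) (hl2 i) (hy2 i)
      have h2 := transitionEnergy_le_wellDist_add hp hn (hm i) (w (l i))
      linarith
    have hEdef : energy p n ε a b w = ∫ t in a..b, energyDensity p n ε w t := rfl
    nlinarith
  refine ⟨part1, fun x hx => ?_⟩
  by_contra! hbad
  by_cases hfar : ∀ i, ρ ≤ |x - h i|
  · have h1 := part1 x hx hfar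
    have h2 := abs_sub_abs_le_abs_sub (w x) (stepFun σ h x)
    rw [abs_stepFun hσ] at h2
    linarith
  push Not at hfar
  obtain ⟨j, hj⟩ := hfar
  -- Good points are now taken beyond ρ, so x lies between those of the jump j, whose transition
  -- must pass through w x and costs an extra d.
  choose l y hl hy hl2 hy2 using pts ρ r hρ0 (by linarith) le_rfl
  have hly : ∀ i, l i ≤ y i := fun i => by linarith [(hl i).2, (hy i).1]
  have hsum := sum_integral_le_of_pairwise_disjoint hab.le hI hI0 hly
    (fun i => (ha i).trans (hl i).1) (fun i => (hy i).2.trans (hb i)) (by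
      intro i j hij
      have h1 := two_mul_lt_abs_sub hsep hij
      rw [Set.disjoint_left]
      intro z hz hz2
      have h2 : |h i - h j| ≤ 2 * r := by
        rw [abs_le]
        constructor <;> linarith [hz.1, hz.2, hz2.1, hz2.2, (hl i).1, (hy i).2, (hl j).1,
          (hy j).2]
      linarith)
  have hlow : ∑ i, ((transitionEnergy p n - 2 * η) + if i = j then d else 0) ≤
      ∑ i, ∫ t in l i..y i, energyDensity p n ε w t := by
    refine Finset.sum_le_sum fun i _ => ?_
    have hwi := hw.mono ((ha i).trans (hl i).1) (hly i) ((hy i).2.trans (hb i))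
    split_ifs with hij
    · subst hij
      rw [abs_lt] at hj
      have h1 := wellDist_add_le_integral hp hn hε (x := x) hwi
        (by linarith [(hl i).2]) (by linarith [(hy i).1]) (hl2 i) (hy2 i)
      have h2 := hd2 _ _ (hm i) hbad
      linarith
    · have h1 := wellDist_add_le_integral hp hn hε (x := l i) hwi le_rfl (hly i) (hl2 i) (hy2 i)
      have h2 := transitionEnergy_le_wellDist_add hp hn (hm i) (w (l i))
      linarith
  rw [Finset.sum_add_distrib, Finset.sum_const, Finset.sum_ite_eq' Finset.univ j, Finset.card_univ,
    Fintype.card_fin, nsmul_eq_mul, if_pos (Finset.mem_univ _)] at hlow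
  have hEdef : energy p n ε a b w = ∫ t in a..b, energyDensity p n ε w t := rfl
  nlinarith

/-- The lower bound for the energy of a function which is close to a step function in `L¹`. -/
theorem HasTailBound.exists_energy_lower_bound (hp : 1 < p) (hn : 0 < n) (hab : a < b)
    (hσ : σ = 1 ∨ σ = -1) (hr : 0 < r) (hsep : ∀ i j : Fin N, i < j → h i + r < h j - r)
    (ha : ∀ i, a ≤ h i - r) (hb : ∀ i, h i + r ≤ b) {d : ℝ → ℝ} (hd : ∀ ε > 0, 0 ≤ d ε)
    (htail : HasTailBound p n r d) :
    ∃ δ₀ > 0, ∃ C ≥ 0, ∀ᶠ ε in 𝓝[>] (0 : ℝ), ∀ w : ℝ → ℝ, MemSobolev p a b w →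
      ∫ x in a..b, |w x - stepFun σ h x| ≤ δ₀ →
      N * transitionEnergy p n - C * d ε ≤ energy p n ε a b w := by
  obtain ⟨θ, ρ, C, hθ0, hθ1, hρ0, hρr, hC, hev⟩ := htail
  obtain ⟨δ₀, hδ₀, hloc⟩ :=
    exists_localization hp hn hab hσ hr hsep ha hb hθ0 hθ1 hρ0 hρr
  refine ⟨δ₀, hδ₀, N * (2 * C), by positivity, ?_⟩
  filter_upwards [hev, self_mem_nhdsWithin] with ε hεt hε w hw hL1
  replace hε : 0 < ε := hε
  have hdε := hd ε hε
  -- Only energies below N c_p need an argument, and these satisfy the energy bound required for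
  -- localization.
  by_cases hE : N * transitionEnergy p n ≤ energy p n ε a b w
  · have : 0 ≤ N * (2 * C) * d ε := by positivity
    linarith
  push Not at hE
  have hclose := (hloc ε hε w hw hL1 (by linarith)).1
  have hI := hw.integrableOn_energyDensity hp hn hab.le (ε := ε)
  have hII : ∀ c e, a ≤ c → c ≤ e → e ≤ b →
      IntervalIntegrable (energyDensity p n ε w) volume c e := fun c e h1 h2 h3 =>
    (intervalIntegrable_iff_integrableOn_Ioc_of_le h2).2 (hI.mono_set (Ioc_subset_Ioc h1 h3))
  have hfar : ∀ i x, ρ ≤ |x - h i| → |x - h i| ≤ r → ∀ j, ρ ≤ |x - h j| := by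
    intro i x h1 h2 j
    by_cases hij : i = j
    · rwa [← hij]
    · have h3 := two_mul_lt_abs_sub hsep hij
      have h4 := abs_sub_le (h i) x (h j)
      rw [abs_sub_comm (h i) x] at h4
      linarith
  have hsum := sum_integral_le_of_pairwise_disjoint hab.le hI (energyDensity_nonneg hp hn hε w)
    (c := fun i => h i - r) (d := fun i => h i + r) (fun i => by linarith) ha hb (by
      intro i j hij
      have h1 := two_mul_lt_abs_sub hsep hij
      rw [Set.disjoint_left]
      intro z hz hz2
      have h2 : |h i - h j| ≤ 2 * r := by
        rw [abs_le]
        constructor <;> linarith [hz.1, hz.2, hz2.1, hz2.2]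
      linarith)
  have hlow : (N : ℝ) * (transitionEnergy p n - 2 * C * d ε) ≤
      ∑ i, ∫ t in (h i - r)..(h i + r), energyDensity p n ε w t := by
    refine le_trans (le_of_eq (by simp; ring)) (Finset.sum_le_sum (s := Finset.univ)
      (f := fun _ => transitionEnergy p n - 2 * C * d ε) fun i _ => ?_)
    have hai := ha i
    have hbi := hb i
    have hm : stepFun σ h (h i + r) = 1 ∨ stepFun σ h (h i + r) = -1 := stepFun_eq_or hσ _
    have hm' : -stepFun σ h (h i + r) = 1 ∨ -stepFun σ h (h i + r) = -1 := by
      rcases hm with e | e <;> simp [e]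
    set m := stepFun σ h (h i + r) with hmdef
    -- The two tails t1 and t2 pay for D at h i ± ρ up to C d ε each; the core pays for the
    -- variation of D up to h i, where the distances to both wells add up to at least c_p.
    have t1 := (hεt m hm (h i + ρ) (h i + r) (by ring) w
      (hw.mono (by linarith) (by linarith) (by linarith)) (fun x hx => by
        have e : |x - h i| = x - h i := abs_of_nonneg (by linarith [hx.1])
        rw [hmdef, ← stepFun_right hr hsep (x := x) ⟨by linarith [hx.1], hx.2⟩]
        exact hclose x ⟨by linarith [hx.1], by linarith [hx.2]⟩
          (hfar i x (by rw [e]; linarith [hx.1]) (by rw [e]; linarith [hx.2])))).1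
    have t2 := (hεt (-m) hm' (h i - r) (h i - ρ) (by ring) w
      (hw.mono (by linarith) (by linarith) (by linarith)) (fun x hx => by
        have e : |x - h i| = -(x - h i) := abs_of_nonpos (by linarith [hx.2])
        rw [hmdef, ← stepFun_left hr hsep (x := x) ⟨hx.1, by linarith [hx.2]⟩]
        exact hclose x ⟨by linarith [hx.1], by linarith [hx.2]⟩
          (hfar i x (by rw [e]; linarith [hx.2]) (by rw [e]; linarith [hx.1])))).2
    have t3 := abs_wellDist_sub_le hp hn m (show h i ≤ h i + ρ by linarith) hε
      (hw.mono (by linarith) (by linarith) (by linarith))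
    have t4 := abs_wellDist_sub_le hp hn (-m) (show h i - ρ ≤ h i by linarith) hε
      (hw.mono (by linarith) (by linarith) (by linarith))
    have t5 := transitionEnergy_le_wellDist_add hp hn hm (w (h i))
    have t6 := neg_abs_le (wellDist p n m (w (h i + ρ)) - wellDist p n m (w (h i)))
    have t7 := le_abs_self (wellDist p n (-m) (w (h i)) - wellDist p n (-m) (w (h i - ρ)))
    have s1 := intervalIntegral.integral_add_adjacent_intervals
      (hII (h i - r) (h i - ρ) (by linarith) (by linarith) (by linarith))
      (hII (h i - ρ) (h i) (by linarith) (by linarith) (by linarith))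
    have s2 := intervalIntegral.integral_add_adjacent_intervals
      (hII (h i) (h i + ρ) (by linarith) (by linarith) (by linarith))
      (hII (h i + ρ) (h i + r) (by linarith) (by linarith) (by linarith))
    have s3 := intervalIntegral.integral_add_adjacent_intervals
      (hII (h i - r) (h i) (by linarith) (by linarith) (by linarith))
      (hII (h i) (h i + r) (by linarith) (by linarith) (by linarith))
    linarith
  have hEdef : energy p n ε a b w = ∫ t in a..b, energyDensity p n ε w t := rfl
  linarith

end

end PLaplaceAC

namespace PLaplaceAC

/-! ### The subgradient inequality at a fixed time -/

theorem hasDerivAt_potential {n : ℝ} (hn : 1 < n) (s : ℝ) :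
    HasDerivAt (potential n) (-reaction n s) s := by
  have h1 : HasDerivAt (fun s : ℝ => 1 - s ^ 2) (-(2 * s)) s := by
    simpa using (hasDerivAt_pow 2 s).const_sub 1
  have h2 := ((hasDerivAt_abs_rpow (1 - s ^ 2) hn).comp s h1).div_const (2 * n)
  refine h2.congr_deriv ?_
  unfold reaction
  field_simp

/-- For n < 2 the formula contains a negative power of |1 - u²|; continuity at ±1 is read off from f
= -F' with F of class C¹. -/
theorem continuous_reaction {n : ℝ} (hn : 1 < n) : Continuous (reaction n) := by
  have h1 : ContDiff ℝ 1 (potential n) := by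
    have h := ((contDiff_norm_rpow (E := ℝ) hn).comp
      (contDiff_const.sub (contDiff_id.pow 2) : ContDiff ℝ 1 fun s : ℝ => 1 - s ^ 2)).div_const
        (2 * n)
    exact h
  have h2 := (h1.continuous_deriv le_rfl).neg
  have h3 : reaction n = -deriv (potential n) := by
    funext s
    rw [Pi.neg_apply, (hasDerivAt_potential hn s).deriv, neg_neg]
  rw [h3]
  exact h2

/-- Convexity of |·|^p in tangent-line form, obtained from Young's inequality for |y| and |x|^{p-1}.
-/
theorem abs_rpow_add_le {p : ℝ} (hp : 1 < p) (x y : ℝ) :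
    |x| ^ p + p * (|x| ^ (p - 2) * x) * (y - x) ≤ |y| ^ p := by
  have hp0 : 0 < p := by linarith
  have hp1 : 0 < p - 1 := by linarith
  have hy := Real.young_inequality_of_nonneg (a := |y|) (b := |x| ^ (p - 1)) (abs_nonneg y)
    (by positivity) (Real.HolderConjugate.conjExponent hp)
  have e1 : (p - 1) * (p / (p - 1)) = p := by field_simp
  rw [Real.conjExponent, ← Real.rpow_mul (abs_nonneg x), e1] at hy
  -- At x = 0 the power |x|^(p-2) takes a conventional value, which the factor x annihilates.
  have e2 : |x| ^ (p - 2) * x * x = |x| ^ p := by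
    rcases eq_or_ne x 0 with rfl | h
    · simp [Real.zero_rpow hp0.ne']
    · rw [mul_assoc, ← sq, ← sq_abs x, ← Real.rpow_natCast, ← Real.rpow_add (abs_pos.2 h)]
      norm_num
  have e3 : |x| ^ (p - 2) * x * y ≤ |y| * |x| ^ (p - 1) := by
    rcases eq_or_ne x 0 with rfl | h
    · simp; positivity
    · have e4 : |x| ^ (p - 1) = |x| ^ (p - 2) * |x| := by
        rw [← Real.rpow_add_one (abs_pos.2 h).ne']; ring_nf
      rw [e4, mul_comm |y|, mul_assoc, mul_assoc, ← abs_mul]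
      gcongr
      exact le_abs_self _
  have e5 : p * (|y| ^ p / p + |x| ^ p / (p / (p - 1))) = |y| ^ p + (p - 1) * |x| ^ p := by
    field_simp
  have e6 := mul_le_mul_of_nonneg_left (e3.trans hy) hp0.le
  rw [e5] at e6
  linear_combination e6 + (-p) * e2

theorem MemSobolev.sub {p a b : ℝ} {f g : ℝ → ℝ} (hab : a ≤ b) (hf : MemSobolev p a b f)
    (hg : MemSobolev p a b g) :
    MemSobolev p a b (fun x => f x - g x) ∧
      ∀ᵐ x ∂volume.restrict (Ioc a b), deriv (fun x => f x - g x) x = deriv f x - deriv g x := by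
  have hd : ∀ᵐ x ∂volume.restrict (Ioc a b),
      deriv (fun x => f x - g x) x = deriv f x - deriv g x := by
    rw [ae_restrict_iff' measurableSet_Ioc]
    filter_upwards [hf.1.ae_differentiableAt, hg.1.ae_differentiableAt] with x h1 h2 hx
    have hx' : x ∈ uIcc a b := by rw [uIcc_of_le hab]; exact Ioc_subset_Icc_self hx
    exact deriv_fun_sub (h1 hx') (h2 hx')
  exact ⟨⟨hf.1.sub hg.1, (memLp_congr_ae hd).2 (hf.2.sub hg.2)⟩, hd⟩

theorem mul_energy_eq {p n ε a b : ℝ} (hε : 0 < ε) (g : ℝ → ℝ) :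
    ε * energy p n ε a b g = ∫ x in a..b, (ε ^ p / p * |deriv g x| ^ p + potential n (g x)) := by
  unfold energy
  rw [← intervalIntegral.integral_const_mul]
  congr 1
  funext x
  have : ε ^ p = ε * ε ^ (p - 1) := by
    rw [Real.rpow_sub hε, Real.rpow_one]; field_simp
  rw [this]
  field_simp

/-- The equation is tested with k - g and the gradient term is handled by convexity. The potential
is not convex, so its first-order Taylor remainder is kept on the right. -/
theorem subgradient_inequality {p n ε a b : ℝ} (hp : 1 < p) (hn : 1 < n) (hab : a < b) (hε : 0 < ε)
    {g k v : ℝ → ℝ} (hg : MemSobolev p a b g) (hk : MemSobolev p a b k)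
    (hv : IntegrableOn v (Ioc a b))
    (heq : ∀ φ : ℝ → ℝ, MemSobolev p a b φ → ∫ x in a..b, (v x * φ x
        + ε ^ p * (|deriv g x| ^ (p - 2) * deriv g x) * deriv φ x
        - reaction n (g x) * φ x) = 0) :
    ε * energy p n ε a b g + ∫ x in a..b, v x * (g x - k x) ≤
      ε * energy p n ε a b k + ∫ x in a..b, (reaction n (g x) * (g x - k x) +
        potential n (g x) - potential n (k x)) := by
  have hp0 : 0 < p := by linarith
  have hn0 : 0 < n := by linarith
  obtain ⟨hφ, hd⟩ := hk.sub hab.le hg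
  have h0 := heq _ hφ
  have hgc := hg.continuousOn hab.le
  have hkc := hk.continuousOn hab.le
  have icont : ∀ f : ℝ → ℝ, ContinuousOn f (Icc a b) → IntegrableOn f (Ioc a b) := fun f hf =>
    hf.integrableOn_Icc.mono_set Ioc_subset_Icc_self
  have iv : IntegrableOn (fun x => v x * (g x - k x)) (Ioc a b) := by
    obtain ⟨C, hC⟩ := isCompact_Icc.exists_bound_of_continuousOn (hgc.sub hkc)
    exact Integrable.mul_bdd (c := C) hv (icont _ (hgc.sub hkc)).aestronglyMeasurable
      ((ae_restrict_iff' measurableSet_Ioc).2 (ae_of_all _ fun x hx => hC x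
        (Ioc_subset_Icc_self hx)))
  have ig := hg.integrableOn_rpow hp
  have ik := hk.integrableOn_rpow hp
  have iφ := hφ.integrableOn_rpow hp
  -- The flux times the test derivative is integrable because ξ^{p-1} ζ ≤ max(ξ, ζ)^p ≤ ξ^p + ζ^p.
  have ifl : IntegrableOn (fun x => ε ^ p * (|deriv g x| ^ (p - 2) * deriv g x) *
      deriv (fun x => k x - g x) x) (Ioc a b) := by
    refine Integrable.mono' ((ig.add iφ).const_mul (ε ^ p)) ?_ (ae_of_all _ fun x => ?_)
    · have m1 := measurable_deriv g
      have m2 := measurable_deriv fun x => k x - g x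
      exact (by fun_prop : Measurable _).aestronglyMeasurable
    · have hbd : |deriv g x| ^ (p - 2) * |deriv g x| * |deriv (fun x => k x - g x) x| ≤
          |deriv g x| ^ p + |deriv (fun x => k x - g x) x| ^ p := by
        set ξ := |deriv g x|
        set ζ := |deriv (fun x => k x - g x) x|
        have hξ : 0 ≤ ξ := abs_nonneg _
        have hζ : 0 ≤ ζ := abs_nonneg _
        have key : ξ ^ (p - 2) * ξ ≤ max ξ ζ ^ (p - 1) := by
          rcases hξ.eq_or_lt with e | e
          · rw [← e, mul_zero]; positivity
          · calc ξ ^ (p - 2) * ξ = ξ ^ (p - 1) := by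
                  rw [← Real.rpow_add_one e.ne']; ring_nf
              _ ≤ _ := Real.rpow_le_rpow hξ (le_max_left _ _) (by linarith)
        have key2 : ξ ^ (p - 2) * ξ * ζ ≤ max ξ ζ ^ p := by
          calc ξ ^ (p - 2) * ξ * ζ ≤ max ξ ζ ^ (p - 1) * max ξ ζ := by
                gcongr; exact le_max_right _ _
            _ ≤ max ξ ζ ^ p := by
                rcases (le_max_of_le_left hξ : 0 ≤ max ξ ζ).eq_or_lt with e | e
                · rw [← e, mul_zero]; positivity
                · rw [← Real.rpow_add_one e.ne']; ring_nf; rfl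
        have hξp : 0 ≤ ξ ^ p := by positivity
        have hζp : 0 ≤ ζ ^ p := by positivity
        rcases max_choice ξ ζ with e | e <;> rw [e] at key2 <;> linarith
      rw [Real.norm_eq_abs, abs_mul, abs_mul, abs_mul, abs_of_nonneg (by positivity : 0 ≤ ε ^ p),
        abs_of_nonneg (by positivity : 0 ≤ |deriv g x| ^ (p - 2)), mul_assoc]
      simp only [Pi.add_apply]
      gcongr
  have ir : IntegrableOn (fun x => reaction n (g x) * (g x - k x)) (Ioc a b) :=
    icont _ (((continuous_reaction hn).comp_continuousOn hgc).mul (hgc.sub hkc))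
  have ipg : IntegrableOn (fun x => potential n (g x)) (Ioc a b) :=
    icont _ ((continuous_potential hn0).comp_continuousOn hgc)
  have ipk : IntegrableOn (fun x => potential n (k x)) (Ioc a b) :=
    icont _ ((continuous_potential hn0).comp_continuousOn hkc)
  rw [mul_energy_eq hε, mul_energy_eq hε]
  rw [intervalIntegral.integral_of_le hab.le] at h0
  simp only [intervalIntegral.integral_of_le hab.le]
  have hle : 0 ≤ ∫ x in Ioc a b, (-(v x * (g x - k x)) +
      (ε ^ p / p * |deriv k x| ^ p - ε ^ p / p * |deriv g x| ^ p) +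
      reaction n (g x) * (g x - k x)) := by
    rw [← h0]
    refine integral_mono_ae ?_
      ((iv.neg.add ((ik.const_mul _).sub (ig.const_mul _))).add ir) ?_
    · have e : (fun x => v x * (k x - g x) + ε ^ p * (|deriv g x| ^ (p - 2) * deriv g x) *
          deriv (fun x => k x - g x) x - reaction n (g x) * (k x - g x)) =
          fun x => -(v x * (g x - k x)) + ε ^ p * (|deriv g x| ^ (p - 2) * deriv g x) *
          deriv (fun x => k x - g x) x + reaction n (g x) * (g x - k x) := by
        funext x; ring
      rw [e]
      exact (iv.neg.add ifl).add ir
    · filter_upwards [hd] with x hx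
      rw [hx]
      have := mul_le_mul_of_nonneg_left (abs_rpow_add_le hp (deriv g x) (deriv k x))
        (by positivity : 0 ≤ ε ^ p / p)
      have e : ε ^ p / p * (|deriv g x| ^ p +
          p * (|deriv g x| ^ (p - 2) * deriv g x) * (deriv k x - deriv g x)) =
          ε ^ p / p * |deriv g x| ^ p +
          ε ^ p * (|deriv g x| ^ (p - 2) * deriv g x) * (deriv k x - deriv g x) := by
        field_simp
      rw [e] at this
      linarith
  have i1 : IntegrableOn (fun x => -(v x * (g x - k x))) (Ioc a b) := iv.neg
  have i2 : IntegrableOn (fun x => ε ^ p / p * |deriv g x| ^ p) (Ioc a b) := ig.const_mul _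
  have i3 : IntegrableOn (fun x => ε ^ p / p * |deriv k x| ^ p) (Ioc a b) := ik.const_mul _
  have i4 : IntegrableOn (fun x => ε ^ p / p * |deriv k x| ^ p - ε ^ p / p * |deriv g x| ^ p)
    (Ioc a b) := i3.sub i2
  have i5 : IntegrableOn (fun x => -(v x * (g x - k x)) +
    (ε ^ p / p * |deriv k x| ^ p - ε ^ p / p * |deriv g x| ^ p)) (Ioc a b) := i1.add i4
  have i6 : IntegrableOn (fun x => reaction n (g x) * (g x - k x) + potential n (g x))
    (Ioc a b) := ir.add ipg
  rw [integral_add i5 ir, integral_add i1 i4, integral_sub i3 i2, integral_neg] at hle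
  rw [integral_add i2 ipg, integral_add i3 ipk, integral_sub i6 ipk, integral_add ir ipg]
  linarith

end PLaplaceAC

namespace PLaplaceAC

/-! ### Time averages of square integrable functions -/

theorem measurePreserving_timeShift (s : ℝ) :
    MeasurePreserving (fun z : ℝ × ℝ => (z.1 - s, z.2)) volume volume :=
  (measurePreserving_sub_right volume s).prod (MeasurePreserving.id volume)

/-- Translations in time are weakly continuous on `L²`. -/
theorem tendsto_integral_mul_timeShift {W : ℝ × ℝ → ℝ} (hW : MemLp W 2) :
    Tendsto (fun s : ℝ => ∫ z, W z * W (z.1 - s, z.2)) (𝓝 0) (𝓝 (∫ z, W z * W z)) := by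
  let g : ℝ → C(ℝ × ℝ, ℝ × ℝ) := fun s => ⟨fun z => (z.1 - s, z.2), by fun_prop⟩
  have hg : Continuous g := by
    refine ContinuousMap.continuous_of_continuous_uncurry _ ?_
    exact (by fun_prop : Continuous fun q : ℝ × (ℝ × ℝ) => ((q.2.1 - q.1, q.2.2) : ℝ × ℝ))
  have hgm : ∀ s, MeasurePreserving (g s) volume volume := measurePreserving_timeShift
  have hc : Continuous fun s => Lp.compMeasurePreserving (g s) (hgm s) hW.toLp :=
    continuous_const.compMeasurePreservingLp hg hgm (by simp)
  have hin : ∀ s, ∫ z, W z * W (z.1 - s, z.2) =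
      inner ℝ hW.toLp (Lp.compMeasurePreserving (g s) (hgm s) hW.toLp) := by
    intro s
    rw [L2.inner_def]
    refine integral_congr_ae ?_
    filter_upwards [hW.coeFn_toLp, Lp.coeFn_compMeasurePreserving hW.toLp (hgm s),
      (hgm s).quasiMeasurePreserving.ae_eq_comp hW.coeFn_toLp] with z h1 h2 h3
    rw [h1, h2, h3]
    change W z * W (g s z) = inner ℝ (W z) (W (g s z))
    simp [mul_comm]
  have h0 : ∫ z, W z * W z = ∫ z, W z * W (z.1 - 0, z.2) := by simp
  rw [h0, hin 0]
  simp_rw [hin]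
  exact (continuous_const.inner hc).tendsto 0

/-- |AB| ≤ A² + B² and invariance of the measure under shifts; the shift parameter ranges over a set
of finite measure. This justifies Fubini below. -/
theorem integrable_mul_timeShift {A B : ℝ × ℝ → ℝ} (hA : Measurable A) (hB : Measurable B)
    (hA2 : Integrable fun z => A z ^ 2) (hB2 : Integrable fun z => B z ^ 2) {h : ℝ} :
    Integrable (fun q : (ℝ × ℝ) × ℝ => A q.1 * B (q.1.1 - q.2, q.1.2))
      (volume.prod (volume.restrict (Ioc 0 h))) := by
  have hfin : IsFiniteMeasure (volume.restrict (Ioc 0 h)) := inferInstance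
  have i1 : Integrable (fun q : (ℝ × ℝ) × ℝ => A q.1 ^ 2)
      (volume.prod (volume.restrict (Ioc 0 h))) := hA2.comp_fst _
  have i2 : Integrable (fun q : (ℝ × ℝ) × ℝ => B (q.1.1 - q.2, q.1.2) ^ 2)
      (volume.prod (volume.restrict (Ioc 0 h))) := by
    have m2 : AEStronglyMeasurable (fun q : (ℝ × ℝ) × ℝ => B (q.1.1 - q.2, q.1.2) ^ 2)
        (volume.prod (volume.restrict (Ioc 0 h))) :=
      (by fun_prop : Measurable _).aestronglyMeasurable
    rw [integrable_prod_iff' m2]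
    refine ⟨ae_of_all _ fun s => ((measurePreserving_timeShift s).integrable_comp
      hB2.aestronglyMeasurable).2 hB2, ?_⟩
    have e : (fun s : ℝ => ∫ z : ℝ × ℝ, ‖B (z.1 - s, z.2) ^ 2‖) =
        fun _ => ∫ z, ‖B z ^ 2‖ := by
      funext s
      exact (measurePreserving_timeShift s).integral_comp
        (MeasurableEquiv.prodCongr (MeasurableEquiv.subRight s)
          (MeasurableEquiv.refl ℝ)).measurableEmbedding (fun z => ‖B z ^ 2‖)
    rw [e]
    exact integrable_const _
  refine (i1.add i2).mono' (by fun_prop : Measurable _).aestronglyMeasurable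
    (ae_of_all _ fun q => ?_)
  rw [Real.norm_eq_abs, abs_le]
  simp only [Pi.add_apply]
  constructor <;> nlinarith [sq_nonneg (A q.1 + B (q.1.1 - q.2, q.1.2)),
    sq_nonneg (A q.1 - B (q.1.1 - q.2, q.1.2))]

theorem integral_mul_timeAverage {A B : ℝ × ℝ → ℝ} (hA : Measurable A) (hB : Measurable B)
    (hA2 : Integrable fun z => A z ^ 2) (hB2 : Integrable fun z => B z ^ 2) {h : ℝ} (hh : 0 ≤ h) :
    Integrable (fun z : ℝ × ℝ => A z * ∫ s in (0 : ℝ)..h, B (z.1 - s, z.2)) ∧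
    ∫ z : ℝ × ℝ, A z * (∫ s in (0 : ℝ)..h, B (z.1 - s, z.2)) =
      ∫ s in (0 : ℝ)..h, ∫ z : ℝ × ℝ, A z * B (z.1 - s, z.2) ∧
    IntervalIntegrable (fun s => ∫ z : ℝ × ℝ, A z * B (z.1 - s, z.2)) volume 0 h := by
  have hI := integrable_mul_timeShift hA hB hA2 hB2 (h := h)
  have e : (fun z : ℝ × ℝ => A z * ∫ s in (0 : ℝ)..h, B (z.1 - s, z.2)) =
      fun z => ∫ s in Ioc 0 h, A z * B (z.1 - s, z.2) := by
    funext z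
    rw [integral_const_mul, intervalIntegral.integral_of_le hh]
  rw [e, intervalIntegral.integral_of_le hh]
  exact ⟨hI.integral_prod_left, integral_integral_swap hI,
    (intervalIntegrable_iff_integrableOn_Ioc_of_le hh).2 hI.integral_prod_right⟩

theorem integral_mul_timeShift_le {A B : ℝ × ℝ → ℝ}
    (hA2 : Integrable fun z => A z ^ 2) (hB2 : Integrable fun z => B z ^ 2) (s : ℝ) :
    ∫ z : ℝ × ℝ, A z * B (z.1 - s, z.2) ≤ (∫ z, A z ^ 2) + ∫ z, B z ^ 2 := by
  have hs : Integrable fun z : ℝ × ℝ => B (z.1 - s, z.2) ^ 2 :=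
    ((measurePreserving_timeShift s).integrable_comp hB2.aestronglyMeasurable).2 hB2
  have e : ∫ z : ℝ × ℝ, B (z.1 - s, z.2) ^ 2 = ∫ z, B z ^ 2 :=
    (measurePreserving_timeShift s).integral_comp
      (MeasurableEquiv.prodCongr (MeasurableEquiv.subRight s)
        (MeasurableEquiv.refl ℝ)).measurableEmbedding (fun z => B z ^ 2)
  rw [← e, ← integral_add hA2 hs]
  have hsum : Integrable fun z : ℝ × ℝ => A z ^ 2 + B (z.1 - s, z.2) ^ 2 := hA2.add hs
  refine (Real.le_norm_self _).trans (norm_integral_le_of_norm_le hsum (ae_of_all _ fun z => ?_))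
  rw [Real.norm_eq_abs, abs_le]
  constructor <;> nlinarith [sq_nonneg (A z + B (z.1 - s, z.2)), sq_nonneg (A z - B (z.1 - s, z.2))]

/-- Passage to the limit in the time discrete energy inequality. -/
theorem energy_dissipation_of_discrete {T a b : ℝ} (hT : 0 < T) {W : ℝ × ℝ → ℝ}
    (hWm : Measurable W) (hW : MemLp W 2) (hW0 : ∀ z, z ∉ Ioc 0 T ×ˢ Ioc a b → W z = 0)
    {Ψ : ℝ → ℝ} (hΨ : ∀ c d, c ≤ T → d ≤ T → IntervalIntegrable Ψ volume c d)
    (hΨ0 : ∀ t ≤ 0, Ψ t = Ψ 0)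
    (hlim : ∀ η > 0, ∀ᶠ s in 𝓝[<] T, Ψ T - η ≤ Ψ s)
    (hdisc : ∀ η > 0, ∀ᶠ h in 𝓝[>] (0 : ℝ), ∀ᵐ t ∂volume.restrict (Ioc 0 T),
      Ψ t + ∫ x, W (t, x) * (∫ s in (0 : ℝ)..h, W (t - s, x)) ≤
        Ψ (t - h) + η * ∫ x, (Ioc 0 T ×ˢ Ioc a b).indicator 1 (t, x) *
          (∫ s in (0 : ℝ)..h, |W (t - s, x)|)) :
    Ψ T + ∫ z, W z ^ 2 ≤ Ψ 0 := by
  set Q : Set (ℝ × ℝ) := Ioc 0 T ×ˢ Ioc a b with hQ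
  have hQm : MeasurableSet Q := measurableSet_Ioc.prod measurableSet_Ioc
  have hQfin : volume Q < ⊤ := by
    rw [hQ, Measure.volume_eq_prod, Measure.prod_prod]
    exact ENNReal.mul_lt_top (by simp) (by simp)
  have hW2 : Integrable fun z => W z ^ 2 := hW.integrable_sq
  have hWa2 : Integrable fun z => |W z| ^ 2 := by simpa only [sq_abs] using hW2
  set χ : ℝ × ℝ → ℝ := Q.indicator 1 with hχ
  have hχm : Measurable χ := measurable_one.indicator hQm
  have hχ2 : Integrable fun z => χ z ^ 2 := by
    have : (fun z => χ z ^ 2) = Q.indicator 1 := by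
      funext z
      rw [hχ]
      by_cases hz : z ∈ Q <;> simp [hz]
    rw [this]
    exact (integrable_indicator_iff hQm).2 (integrableOn_const hQfin.ne)
  set c₀ := ∫ z, W z ^ 2 with hc₀
  set B := (∫ z, χ z ^ 2) + ∫ z, |W z| ^ 2 with hB
  have hB0 : 0 ≤ B := add_nonneg (integral_nonneg fun _ => sq_nonneg _)
    (integral_nonneg fun _ => sq_nonneg _)
  -- The error is η from the semicontinuity at T, η from the correlation of W with its shifts, and
  -- ηB from the remainder term.
  suffices H : ∀ η > 0, Ψ T + c₀ ≤ Ψ 0 + η * (2 + B) by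
    refine le_of_forall_pos_le_add fun e he => ?_
    have := H (e / (2 + B)) (by positivity)
    rwa [div_mul_cancel₀ _ (by positivity)] at this
  intro η hη
  have hcorr : ∀ᶠ s in 𝓝 (0 : ℝ), c₀ - η ≤ ∫ z, W z * W (z.1 - s, z.2) := by
    have h1 := tendsto_integral_mul_timeShift hW
    have e : ∫ z, W z * W z = c₀ := by simp only [hc₀, sq]
    rw [e] at h1
    exact (h1.eventually (lt_mem_nhds (sub_lt_self c₀ hη))).mono fun _ h => h.le
  obtain ⟨r₁, hr₁, H1⟩ := Metric.eventually_nhds_iff.1 hcorr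
  obtain ⟨l, hl, H2⟩ := mem_nhdsLT_iff_exists_Ioo_subset.1 (hlim η hη)
  obtain ⟨h, hh, hh0, hh1⟩ := ((hdisc η hη).and
    (Ioo_mem_nhdsGT (show 0 < min r₁ (T - l) from lt_min hr₁ (sub_pos.2 hl)))).exists
  have hhr : h < r₁ := hh1.trans_le (min_le_left _ _)
  have hhl : h < T - l := hh1.trans_le (min_le_right _ _)
  obtain ⟨i1, e1, j1⟩ := integral_mul_timeAverage hWm hWm hW2 hW2 hh0.le
  obtain ⟨i2, e2, j2⟩ := integral_mul_timeAverage hχm (hWm.abs : Measurable fun z => |W z|) hχ2 hWa2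
    hh0.le
  -- integrals over the strip are integrals over the plane
  have strip : ∀ f : ℝ × ℝ → ℝ, Integrable f → (∀ z, z ∉ Q → f z = 0) →
      IntegrableOn (fun t => ∫ x, f (t, x)) (Ioc 0 T) ∧
      ∫ t in Ioc 0 T, ∫ x, f (t, x) = ∫ z, f z := by
    intro f hf hf0
    refine ⟨hf.integral_prod_left.integrableOn, ?_⟩
    rw [Measure.volume_eq_prod, integral_prod f hf]
    refine setIntegral_eq_integral_of_forall_compl_eq_zero fun t ht => ?_
    have : ∀ x, f (t, x) = 0 := fun x => hf0 _ fun hz => ht hz.1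
    simp [this]
  obtain ⟨k1, s1⟩ := strip _ i1 fun z hz => by rw [hW0 z hz, zero_mul]
  obtain ⟨k2, s2⟩ := strip _ i2 fun z hz => by
    rw [hχ, indicator_of_notMem hz, zero_mul]
  have kΨ : IntegrableOn Ψ (Ioc 0 T) :=
    (intervalIntegrable_iff_integrableOn_Ioc_of_le hT.le).1 (hΨ 0 T hT.le le_rfl)
  have kΨh' : IntervalIntegrable (fun t => Ψ (t - h)) volume 0 T := by
    have := (hΨ (0 - h) (T - h) (by linarith) (by linarith)).comp_sub_right h
    simpa using this
  have kΨh : IntegrableOn (fun t => Ψ (t - h)) (Ioc 0 T) :=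
    (intervalIntegrable_iff_integrableOn_Ioc_of_le hT.le).1 kΨh'
  -- The discrete inequality is integrated over (0, T]. Fubini turns the product terms into averages
  -- over shifts s in (0, h], each of order h.
  have hint := integral_mono_ae (kΨ.add k1) (kΨh.add (k2.const_mul η)) hh
  rw [integral_add' kΨ k1, integral_add' kΨh (k2.const_mul η), s1, integral_const_mul, s2, e1, e2,
    ← intervalIntegral.integral_of_le hT.le, ← intervalIntegral.integral_of_le hT.le,
    intervalIntegral.integral_comp_sub_right] at hint
  have f1 : h * (c₀ - η) ≤ ∫ s in (0 : ℝ)..h, ∫ z : ℝ × ℝ, W z * W (z.1 - s, z.2) := by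
    have := intervalIntegral.integral_mono_on hh0.le intervalIntegrable_const j1
      (fun s hs => H1 (y := s) (by
        rw [Real.dist_eq, sub_zero, abs_of_nonneg hs.1]; exact hs.2.trans_lt hhr))
    rwa [intervalIntegral.integral_const, smul_eq_mul, sub_zero] at this
  have f2 : ∫ s in (0 : ℝ)..h, ∫ z : ℝ × ℝ, χ z * |W (z.1 - s, z.2)| ≤ h * B := by
    have := intervalIntegral.integral_mono_on hh0.le j2 intervalIntegrable_const
      (fun s _ => integral_mul_timeShift_le hχ2 hWa2 s)
    rwa [intervalIntegral.integral_const, smul_eq_mul, sub_zero] at this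
  -- Telescoping: only the layers of width h at T and at 0 survive. On the lower one Ψ is constant,
  -- by its extension to negative times.
  have f3 : (∫ t in (0 : ℝ)..T, Ψ t) - ∫ t in (0 - h)..(T - h), Ψ t =
      (∫ t in (T - h)..T, Ψ t) - ∫ t in (0 - h)..0, Ψ t := by
    have g1 := intervalIntegral.integral_add_adjacent_intervals
      (hΨ (0 - h) 0 (by linarith) hT.le) (hΨ 0 T hT.le le_rfl)
    have g2 := intervalIntegral.integral_add_adjacent_intervals
      (hΨ (0 - h) (T - h) (by linarith) (by linarith)) (hΨ (T - h) T (by linarith) le_rfl)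
    linarith
  have f4 : ∫ t in (0 - h)..0, Ψ t = h * Ψ 0 := by
    rw [intervalIntegral.integral_congr (g := fun _ => Ψ 0) fun t ht => ?_]
    · simp
    · rw [uIcc_of_le (by linarith)] at ht
      exact hΨ0 t ht.2
  have f5 : h * (Ψ T - η) ≤ ∫ t in (T - h)..T, Ψ t := by
    have := intervalIntegral.integral_mono_on_of_le_Ioo (show T - h ≤ T by linarith)
      intervalIntegrable_const (hΨ (T - h) T (by linarith) le_rfl)
      (fun s hs => H2 (show s ∈ Ioo l T from ⟨by linarith [hs.1], hs.2⟩))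
    rwa [intervalIntegral.integral_const, smul_eq_mul, sub_sub_cancel] at this
  have f6 : η * ∫ s in (0 : ℝ)..h, ∫ z : ℝ × ℝ, χ z * |W (z.1 - s, z.2)| ≤ η * (h * B) := by gcongr
  have f7 : h * (Ψ T + c₀) ≤ h * (Ψ 0 + η * (2 + B)) := by nlinarith
  exact le_of_mul_le_mul_left f7 hh0

end PLaplaceAC

namespace PLaplaceAC

/-! ### The energy inequality -/

/-- Since F' = -f, the left side is a first-order Taylor remainder of F. Uniform continuity of f on
a compact interval makes it o(|y - z|). -/
theorem exists_reaction_modulus {n : ℝ} (hn : 1 < n) (R : ℝ) {η : ℝ} (hη : 0 < η) :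
    ∃ κ > 0, ∀ y ∈ Icc (-R) R, ∀ z ∈ Icc (-R) R, |y - z| ≤ κ →
      reaction n y * (y - z) + potential n y - potential n z ≤ η * |y - z| := by
  have huc := isCompact_Icc.uniformContinuousOn_of_continuous
    (continuous_reaction hn).continuousOn (s := Icc (-R) R)
  obtain ⟨κ, hκ, H⟩ := Metric.uniformContinuousOn_iff.1 huc η hη
  refine ⟨κ / 2, by positivity, fun y hy z hz hyz => ?_⟩
  have hsub : uIcc y z ⊆ Icc (-R) R := uIcc_subset_Icc hy hz
  have hbd : ∀ s ∈ uIcc y z, ‖reaction n y - reaction n s‖ ≤ η := by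
    intro s hs
    have h1 : |y - s| ≤ |y - z| := by
      rw [abs_sub_comm y s, abs_sub_comm y z]; exact abs_sub_left_of_mem_uIcc hs
    have h2 := H y hy s (hsub hs) (by rw [Real.dist_eq]; linarith)
    rw [Real.dist_eq] at h2
    exact h2.le
  have hmv := (convex_uIcc y z).norm_image_sub_le_of_norm_hasDerivWithin_le
    (f := fun s => reaction n y * s + potential n s)
    (f' := fun s => reaction n y - reaction n s) (C := η)
    (fun s _ => by
      have := ((hasDerivAt_id s).const_mul (reaction n y)).add (hasDerivAt_potential hn s)
      rw [mul_one, ← sub_eq_add_neg] at this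
      exact this.hasDerivWithinAt) hbd right_mem_uIcc left_mem_uIcc
  rw [Real.norm_eq_abs, Real.norm_eq_abs] at hmv
  have := le_abs_self (reaction n y * y + potential n y - (reaction n y * z + potential n z))
  linarith

section
variable {p n ε a b : ℝ} {u₀ : ℝ → ℝ} {u : ℝ → ℝ → ℝ}

theorem IsSolution.exists_uniform_modulus (hu : IsSolution p n ε a b u₀ u) (T : ℝ)
    {κ : ℝ} (hκ : 0 < κ) :
    ∃ ρ > 0, ∀ s ∈ Icc 0 T, ∀ t ∈ Icc 0 T, |t - s| < ρ → ∀ x ∈ Icc a b,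
      |u t x - u s x| ≤ κ := by
  have hc : ContinuousOn (fun z : ℝ × ℝ => u z.1 z.2) (Icc 0 T ×ˢ Icc a b) :=
    hu.continuousOn.mono (prod_mono Icc_subset_Ici_self le_rfl)
  obtain ⟨ρ, hρ, H⟩ := Metric.uniformContinuousOn_iff.1
    ((isCompact_Icc.prod isCompact_Icc).uniformContinuousOn_of_continuous hc) κ hκ
  refine ⟨ρ, hρ, fun s hs t ht hts x hx => ?_⟩
  have := H (t, x) ⟨ht, hx⟩ (s, x) ⟨hs, hx⟩ (by
    rw [Prod.dist_eq, dist_self, max_eq_left dist_nonneg, Real.dist_eq]; exact hts)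
  rw [Real.dist_eq] at this
  exact this.le

theorem IsSolution.exists_bound (hu : IsSolution p n ε a b u₀ u) (T : ℝ) :
    ∃ R, ∀ t ∈ Icc 0 T, ∀ x ∈ Icc a b, u t x ∈ Icc (-R) R := by
  have hc : ContinuousOn (fun z : ℝ × ℝ => u z.1 z.2) (Icc 0 T ×ˢ Icc a b) :=
    hu.continuousOn.mono (prod_mono Icc_subset_Ici_self le_rfl)
  obtain ⟨R, hR⟩ := (isCompact_Icc.prod isCompact_Icc).exists_bound_of_continuousOn hc
  exact ⟨R, fun t ht x hx => abs_le.1 (hR (t, x) ⟨ht, hx⟩)⟩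

theorem IsSolution.exists_potential_modulus (hn : 1 < n) (hu : IsSolution p n ε a b u₀ u) (T : ℝ)
    {η : ℝ} (hη : 0 < η) :
    ∃ ρ > 0, ∀ s ∈ Icc 0 T, ∀ t ∈ Icc 0 T, |t - s| < ρ → ∀ x ∈ Icc a b,
      reaction n (u t x) * (u t x - u s x) + potential n (u t x) - potential n (u s x) ≤
        η * |u t x - u s x| := by
  obtain ⟨R, hR⟩ := hu.exists_bound T
  obtain ⟨κ, hκ, H⟩ := exists_reaction_modulus hn R hη
  obtain ⟨ρ, hρ, H2⟩ := hu.exists_uniform_modulus T hκ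
  exact ⟨ρ, hρ, fun s hs t ht hts x hx => H _ (hR t ht x hx) _ (hR s hs x hx)
    (H2 s hs t ht hts x hx)⟩

/-- The weak form of the equation at a fixed time, with time derivative `v`. -/
def WeakEquation (p n ε a b : ℝ) (v g : ℝ → ℝ) : Prop :=
  IntegrableOn v (Ioc a b) ∧ ∀ φ : ℝ → ℝ, MemSobolev p a b φ → ∫ x in a..b, (v x * φ x
    + ε ^ p * (|deriv g x| ^ (p - 2) * deriv g x) * deriv φ x - reaction n (g x) * φ x) = 0

/-- The time derivative of the solution, extended by zero outside `(0,T] × (a,b]`. -/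
theorem IsSolution.exists_timeDeriv (hab : a < b) (hu : IsSolution p n ε a b u₀ u) :
    (∀ᵐ t ∂volume.restrict (Ioi (0 : ℝ)), ∃ v, WeakEquation p n ε a b v (u t)) ∧
    ∀ T > 0, ∃ W : ℝ × ℝ → ℝ, Measurable W ∧ MemLp W 2 ∧ Integrable W ∧
      (∀ z, z ∉ Ioc 0 T ×ˢ Ioc a b → W z = 0) ∧
      (∀ᵐ t ∂volume.restrict (Ioc 0 T), WeakEquation p n ε a b (fun x => W (t, x)) (u t)) ∧
      ∀ t ∈ Icc 0 T, ∀ᵐ x ∂volume.restrict (Ioc a b),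
        u t x - u 0 x = ∫ s in (0 : ℝ)..t, W (s, x) := by
  obtain ⟨w, hwL, hwt, hwe⟩ := hu.equation
  have hwi : ∀ T, 0 < T → Integrable (fun z : ℝ × ℝ => w z.1 z.2)
      ((volume.restrict (Ioc 0 T)).prod (volume.restrict (Ioc a b))) := fun T hT =>
    (hwL T hT).integrable (by norm_num)
  constructor
  · have hsl : ∀ᵐ t ∂volume.restrict (Ioi (0 : ℝ)), IntegrableOn (w t) (Ioc a b) := by
      have hU : Ioi (0 : ℝ) = ⋃ k : ℕ, Ioc (0 : ℝ) (k + 1) := by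
        ext t
        simp only [mem_Ioi, mem_iUnion, mem_Ioc]
        refine ⟨fun ht => ?_, fun ⟨_, h, _⟩ => h⟩
        obtain ⟨k, hk⟩ := exists_nat_ge t
        exact ⟨k, ht, by linarith⟩
      rw [hU, ae_restrict_iUnion_iff]
      exact fun k => (hwi (k + 1) (by positivity)).prod_right_ae
    filter_upwards [hsl, hwe] with t h1 h2
    exact ⟨w t, h1, h2⟩
  intro T hT
  have hQm : MeasurableSet (Ioc 0 T ×ˢ Ioc a b) := measurableSet_Ioc.prod measurableSet_Ioc
  -- A measurable representative is needed for the shifts and Fubini; slicing the null set in both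
  -- orders transfers the equation and the increment formula to it.
  obtain ⟨m, hm, hmw⟩ := (hwL T hT).aestronglyMeasurable
  have hmL : MemLp m 2 ((volume.restrict (Ioc 0 T)).prod (volume.restrict (Ioc a b))) :=
    (memLp_congr_ae hmw).1 (hwL T hT)
  have hmi := hmL.integrable (by norm_num)
  have hμ : (volume.restrict (Ioc 0 T)).prod (volume.restrict (Ioc a b)) =
      (volume : Measure (ℝ × ℝ)).restrict (Ioc 0 T ×ˢ Ioc a b) := by
    rw [Measure.prod_restrict, Measure.volume_eq_prod]
  set W : ℝ × ℝ → ℝ := (Ioc 0 T ×ˢ Ioc a b).indicator m with hW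
  have hWQ : ∀ t ∈ Ioc 0 T, ∀ x ∈ Ioc a b, W (t, x) = m (t, x) := fun t ht x hx =>
    indicator_of_mem (show (t, x) ∈ Ioc 0 T ×ˢ Ioc a b from ⟨ht, hx⟩) m
  refine ⟨W, hm.measurable.indicator hQm, ?_, ?_, fun z hz => indicator_of_notMem hz m, ?_, ?_⟩
  · rw [hW, memLp_indicator_iff_restrict hQm, ← hμ]
    exact hmL
  · rw [hW, integrable_indicator_iff hQm, IntegrableOn, ← hμ]
    exact hmi
  · have hsl : ∀ᵐ t ∂volume.restrict (Ioc 0 T), ∀ᵐ x ∂volume.restrict (Ioc a b),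
        w t x = m (t, x) := Measure.ae_ae_of_ae_prod hmw
    have hwe' : ∀ᵐ t ∂volume.restrict (Ioc 0 T), _ :=
      ae_restrict_of_ae_restrict_of_subset (Ioc_subset_Ioi_self) hwe
    filter_upwards [hsl, hwe', (hwi T hT).prod_right_ae, ae_restrict_mem measurableSet_Ioc]
      with t h1 h2 h3 ht
    have h4 : w t =ᵐ[volume.restrict (Ioc a b)] fun x => W (t, x) := by
      filter_upwards [h1, ae_restrict_mem measurableSet_Ioc] with x hx hx2
      rw [hx, hWQ t ht x hx2]
    refine ⟨h3.congr h4, fun φ hφ => ?_⟩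
    rw [← h2 φ hφ]
    simp only [intervalIntegral.integral_of_le hab.le]
    refine integral_congr_ae ?_
    filter_upwards [h4] with x hx
    rw [hx]
  · intro t ht
    have hsw : ∀ᵐ x ∂volume.restrict (Ioc a b), ∀ᵐ s ∂volume.restrict (Ioc 0 T),
        w s x = m (s, x) :=
      Measure.ae_ae_of_ae_prod
        (Measure.measurePreserving_swap.quasiMeasurePreserving.ae hmw)
    filter_upwards [hsw, hwt t ht.1, ae_restrict_mem measurableSet_Ioc] with x h1 h2 hx
    rw [h2, intervalIntegral.integral_of_le ht.1, intervalIntegral.integral_of_le ht.1]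
    refine integral_congr_ae ?_
    filter_upwards [ae_restrict_of_ae_restrict_of_subset (Ioc_subset_Ioc_right ht.2) h1,
      ae_restrict_mem measurableSet_Ioc] with s hs hs2
    rw [hs, hWQ s ⟨hs2.1, hs2.2.trans ht.2⟩ x hx]

/-- The energy along a solution, extended to negative times, is bounded and measurable. -/
theorem IsSolution.intervalIntegrable_energy (hp : 1 < p) (hn : 1 < n) (hab : a < b) (hε : 0 < ε)
    (hu : IsSolution p n ε a b u₀ u) {T : ℝ} (hT : 0 < T) {c d : ℝ} (hc : c ≤ T) (hd : d ≤ T) :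
    IntervalIntegrable (fun t => ε * energy p n ε a b (u (max t 0))) volume c d := by
  have hp0 : 0 < p := by linarith
  have hn0 : 0 < n := by linarith
  -- A continuous extension of u to the plane makes (t, x) ↦ deriv (U t) x measurable. It agrees
  -- with the spatial derivative of u only inside (a, b), hence the passage to open intervals.
  let U : ℝ → ℝ → ℝ := fun t x => u (max t 0) (projIcc a b hab.le x)
  have hU : Continuous (Function.uncurry U) := by
    refine hu.continuousOn.comp_continuous
      (f := fun z : ℝ × ℝ => (max z.1 0, (projIcc a b hab.le z.2 : ℝ))) ?_ fun z =>
        ⟨(le_max_right _ _ : (0 : ℝ) ≤ max z.1 0), (projIcc a b hab.le z.2).2⟩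
    exact (by fun_prop : Continuous fun z : ℝ × ℝ => max z.1 0).prodMk
      (continuous_subtype_val.comp (continuous_projIcc.comp continuous_snd))
  have hform : (fun t => ε * energy p n ε a b (u (max t 0))) = fun t =>
      ∫ x in Ioc a b, (ε ^ p / p * |deriv (U t) x| ^ p + potential n (U t x)) := by
    funext t
    rw [mul_energy_eq hε, intervalIntegral.integral_of_le hab.le, integral_Ioc_eq_integral_Ioo,
      integral_Ioc_eq_integral_Ioo]
    refine setIntegral_congr_fun measurableSet_Ioo fun x hx => ?_
    have hEq : U t =ᶠ[𝓝 x] u (max t 0) := by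
      filter_upwards [Icc_mem_nhds hx.1 hx.2] with y hy
      simp only [U, projIcc_of_mem hab.le hy]
    simp only [hEq.deriv_eq, hEq.eq_of_nhds]
  have hmeas : StronglyMeasurable fun t => ε * energy p n ε a b (u (max t 0)) := by
    rw [hform]
    have m1 : Measurable fun z : ℝ × ℝ => deriv (U z.1) z.2 := measurable_deriv_with_param hU
    have m2 : Measurable fun z : ℝ × ℝ => potential n (U z.1 z.2) :=
      ((continuous_potential hn0).comp hU).measurable
    have m3 : Measurable fun z : ℝ × ℝ =>
      ε ^ p / p * |deriv (U z.1) z.2| ^ p + potential n (U z.1 z.2) := by fun_prop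
    exact m3.stronglyMeasurable.integral_prod_right
  obtain ⟨M, hM⟩ := hu.bounded T hT
  obtain ⟨R, hR⟩ := hu.exists_bound T
  obtain ⟨D, hD⟩ := isCompact_Icc.exists_bound_of_continuousOn
    (continuous_potential hn0).continuousOn (s := Icc (-R) R)
  refine (intervalIntegrable_const (c := ε ^ p / p * M + D * (b - a))).mono_fun'
    hmeas.aestronglyMeasurable ?_
  rw [EventuallyLE, ae_restrict_iff' measurableSet_uIoc]
  refine ae_of_all _ fun t ht => ?_
  have htT : max t 0 ∈ Icc 0 T :=
    ⟨le_max_right _ _, max_le (ht.2.trans (max_le hc hd)) hT.le⟩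
  have hs := hu.sobolev _ htT.1
  have h0 : 0 ≤ ε * energy p n ε a b (u (max t 0)) :=
    mul_nonneg hε.le (intervalIntegral.integral_nonneg hab.le fun x _ =>
      energyDensity_nonneg hp hn0 hε _ x)
  rw [Real.norm_eq_abs, abs_of_nonneg h0, mul_energy_eq hε]
  have i1 : IntervalIntegrable (fun x => ε ^ p / p * |deriv (u (max t 0)) x| ^ p) volume a b :=
    (intervalIntegrable_iff_integrableOn_Ioc_of_le hab.le).2 ((hs.integrableOn_rpow hp).const_mul _)
  have i2 : IntervalIntegrable (fun x => potential n (u (max t 0) x)) volume a b :=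
    ContinuousOn.intervalIntegrable_of_Icc hab.le
      ((continuous_potential hn0).comp_continuousOn (hs.continuousOn hab.le))
  rw [intervalIntegral.integral_add i1 i2, intervalIntegral.integral_const_mul]
  have e1 := hM _ htT
  have e2 : ∫ x in a..b, potential n (u (max t 0) x) ≤ ∫ x in a..b, D :=
    intervalIntegral.integral_mono_on hab.le i2 intervalIntegrable_const fun x hx =>
      (le_abs_self _).trans (hD _ (hR _ htT x hx))
  rw [intervalIntegral.integral_const, smul_eq_mul, mul_comm] at e2
  gcongr

/-- The subgradient inequality at T bounds E(T) by E(s) plus terms controlled by sup |u T - u s|. It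
needs the equation at the time T itself, which is why the energy inequality is obtained for almost
every T. -/
theorem IsSolution.lowerSemicontinuous_energy (hp : 1 < p) (hn : 1 < n) (hab : a < b) (hε : 0 < ε)
    (hu : IsSolution p n ε a b u₀ u) {T : ℝ} (hT : 0 < T) {v : ℝ → ℝ}
    (hv : WeakEquation p n ε a b v (u T)) {η : ℝ} (hη : 0 < η) :
    ∀ᶠ s in 𝓝[<] T, ε * energy p n ε a b (u T) - η ≤ ε * energy p n ε a b (u (max s 0)) := by
  set V := ∫ x in a..b, |v x| with hV
  have hV0 : 0 ≤ V := intervalIntegral.integral_nonneg hab.le fun x _ => abs_nonneg _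
  -- Chosen so that the time-derivative term κV and the reaction term κ(b-a) together stay below η.
  set κ := η / (V + (b - a) + 1) with hκ
  have hba : 0 < b - a := sub_pos.2 hab
  have hκ0 : 0 < κ := by positivity
  obtain ⟨ρ₁, hρ₁, H1⟩ := hu.exists_uniform_modulus T hκ0
  obtain ⟨ρ₂, hρ₂, H2⟩ := hu.exists_potential_modulus hn T zero_lt_one
  have hlt : max 0 (T - min ρ₁ ρ₂) < T := max_lt hT (by linarith [lt_min hρ₁ hρ₂])
  filter_upwards [Ioo_mem_nhdsLT hlt] with s hs
  have hs0 : 0 < s := (le_max_left _ _).trans_lt hs.1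
  have hs1 : T - min ρ₁ ρ₂ < s := (le_max_right _ _).trans_lt hs.1
  have hsT : s ∈ Icc 0 T := ⟨hs0.le, hs.2.le⟩
  have hTT : T ∈ Icc 0 T := ⟨hT.le, le_rfl⟩
  have hTs : |T - s| < min ρ₁ ρ₂ := by
    rw [abs_of_pos (by linarith [hs.2])]; linarith
  rw [max_eq_left hs0.le]
  have hgT := hu.sobolev T hT.le
  have hgs := hu.sobolev s hs0.le
  have hmain := subgradient_inequality hp hn hab hε hgT hgs hv.1 hv.2
  have b1 := H1 s hsT T hTT (hTs.trans_le (min_le_left _ _))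
  have b2 := H2 s hsT T hTT (hTs.trans_le (min_le_right _ _))
  have c1 : |∫ x in a..b, v x * (u T x - u s x)| ≤ κ * V := by
    rw [hV, ← intervalIntegral.integral_const_mul, ← Real.norm_eq_abs]
    refine intervalIntegral.norm_integral_le_of_norm_le hab.le (ae_of_all _ fun x hx => ?_)
      ((intervalIntegrable_iff_integrableOn_Ioc_of_le hab.le).2 (hv.1.abs.const_mul κ))
    rw [Real.norm_eq_abs, abs_mul, mul_comm]
    gcongr
    exact b1 x (Ioc_subset_Icc_self hx)
  have c2 : ∫ x in a..b, (reaction n (u T x) * (u T x - u s x) + potential n (u T x) -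
      potential n (u s x)) ≤ ∫ x in a..b, κ := by
    have hTc := hgT.continuousOn hab.le
    have hsc := hgs.continuousOn hab.le
    refine intervalIntegral.integral_mono_on hab.le
      (ContinuousOn.intervalIntegrable_of_Icc hab.le ?_) intervalIntegrable_const fun x hx => ?_
    · exact ((((continuous_reaction hn).comp_continuousOn hTc).mul (hTc.sub hsc)).add
        ((continuous_potential (by linarith)).comp_continuousOn hTc)).sub
        ((continuous_potential (by linarith)).comp_continuousOn hsc)
    · have := b2 x hx
      rw [one_mul] at this
      exact this.trans (b1 x hx)
  rw [intervalIntegral.integral_const, smul_eq_mul] at c2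
  have c3 : κ * V + (b - a) * κ ≤ η := by
    have : κ * (V + (b - a) + 1) = η := div_mul_cancel₀ _ (by positivity)
    nlinarith
  linarith [neg_abs_le (∫ x in a..b, v x * (u T x - u s x))]

end

end PLaplaceAC

namespace PLaplaceAC

/-! ### Discrete energy inequality and displacement bound -/

section
variable {p n ε a b : ℝ} {u₀ : ℝ → ℝ} {u : ℝ → ℝ → ℝ}

/-- An increment in time is a time average of the derivative. -/
theorem increment_eq_timeAverage {T : ℝ} {W : ℝ × ℝ → ℝ}
    (hWi : Integrable W) (hW0 : ∀ z, z ∉ Ioc 0 T ×ˢ Ioc a b → W z = 0)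
    (hWu : ∀ t ∈ Icc 0 T, ∀ᵐ x ∂volume.restrict (Ioc a b),
        u t x - u 0 x = ∫ s in (0 : ℝ)..t, W (s, x)) {t h : ℝ} (ht : t ∈ Ioc 0 T) (hh : 0 < h) :
    ∀ᵐ x ∂volume.restrict (Ioc a b), IntegrableOn (fun s => W (t - s, x)) (Ioc 0 h) ∧
      u t x - u (max (t - h) 0) x = ∫ s in (0 : ℝ)..h, W (t - s, x) := by
  have hmem : max (t - h) 0 ∈ Icc 0 T :=
    ⟨le_max_right _ _, max_le (by linarith [ht.2]) (ht.1.le.trans ht.2)⟩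
  have hsl : ∀ᵐ x ∂volume.restrict (Ioc a b), Integrable fun s => W (s, x) :=
    ae_restrict_of_ae hWi.prod_left_ae
  filter_upwards [hsl, hWu t ⟨ht.1.le, ht.2⟩, hWu _ hmem] with x h1 h2 h3
  -- W vanishes at nonpositive times, which matches freezing u at its initial value there.
  have hz : ∫ s in (0 : ℝ)..(max (t - h) 0), W (s, x) = ∫ s in (0 : ℝ)..(t - h), W (s, x) := by
    rcases le_total 0 (t - h) with h0 | h0
    · rw [max_eq_left h0]
    · rw [max_eq_right h0, intervalIntegral.integral_same, intervalIntegral.integral_symm,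
        intervalIntegral.integral_congr (g := fun _ => 0) fun s hs => ?_]
      · simp
      · rw [uIcc_of_le h0] at hs
        exact hW0 _ fun hz => absurd hz.1.1 (not_lt.2 hs.2)
  refine ⟨(h1.comp_sub_left t).integrableOn, ?_⟩
  rw [intervalIntegral.integral_comp_sub_left (fun s => W (s, x)), sub_zero,
    ← intervalIntegral.integral_interval_sub_left (a := 0) h1.intervalIntegrable
      h1.intervalIntegrable, ← hz, ← h2, ← h3]
  ring

/-- The subgradient inequality with g = u(t) and k = u(t-h). Uniform continuity of u makes the
reaction remainder at most η |u(t) - u(t-h)|, which is again bounded by a time average. -/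
theorem IsSolution.discrete_energy_inequality (hp : 1 < p) (hn : 1 < n) (hab : a < b) (hε : 0 < ε)
    (hu : IsSolution p n ε a b u₀ u) {T : ℝ} {W : ℝ × ℝ → ℝ}
    (hWm : Measurable W) (hW2 : MemLp W 2) (hWi : Integrable W)
    (hW0 : ∀ z, z ∉ Ioc 0 T ×ˢ Ioc a b → W z = 0)
    (hWe : ∀ᵐ t ∂volume.restrict (Ioc 0 T), WeakEquation p n ε a b (fun x => W (t, x)) (u t))
    (hWu : ∀ t ∈ Icc 0 T, ∀ᵐ x ∂volume.restrict (Ioc a b),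
        u t x - u 0 x = ∫ s in (0 : ℝ)..t, W (s, x)) {η : ℝ} (hη : 0 < η) :
    ∀ᶠ h in 𝓝[>] (0 : ℝ), ∀ᵐ t ∂volume.restrict (Ioc 0 T),
      ε * energy p n ε a b (u (max t 0)) +
        ∫ x, W (t, x) * (∫ s in (0 : ℝ)..h, W (t - s, x)) ≤
      ε * energy p n ε a b (u (max (t - h) 0)) +
        η * ∫ x, (Ioc 0 T ×ˢ Ioc a b).indicator 1 (t, x) *
          (∫ s in (0 : ℝ)..h, |W (t - s, x)|) := by
  obtain ⟨ρ, hρ, H⟩ := hu.exists_potential_modulus hn T hη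
  filter_upwards [Ioo_mem_nhdsGT hρ] with h hh
  obtain ⟨hh0, hhρ⟩ := hh
  have hQm : MeasurableSet (Ioc 0 T ×ˢ Ioc a b) := measurableSet_Ioc.prod measurableSet_Ioc
  have hχ2 : Integrable fun z => (Ioc 0 T ×ˢ Ioc a b).indicator (1 : ℝ × ℝ → ℝ) z ^ 2 := by
    have : (fun z => (Ioc 0 T ×ˢ Ioc a b).indicator (1 : ℝ × ℝ → ℝ) z ^ 2) =
        (Ioc 0 T ×ˢ Ioc a b).indicator 1 := by
      funext z
      by_cases hz : z ∈ Ioc 0 T ×ˢ Ioc a b <;> simp [hz]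
    rw [this, integrable_indicator_iff hQm]
    refine integrableOn_const ?_
    rw [Measure.volume_eq_prod, Measure.prod_prod]
    exact (ENNReal.mul_lt_top (by simp) (by simp)).ne
  have hWa2 : Integrable fun z => |W z| ^ 2 := by simpa only [sq_abs] using hW2.integrable_sq
  have hI := (integral_mul_timeAverage (measurable_one.indicator hQm)
    (hWm.abs : Measurable fun z => |W z|) hχ2 hWa2 hh0.le).1.prod_right_ae
  filter_upwards [hWe, ae_restrict_of_ae hI, ae_restrict_mem measurableSet_Ioc] with t h1 h2 ht
  have hmem : max (t - h) 0 ∈ Icc 0 T :=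
    ⟨le_max_right _ _, max_le (by linarith [ht.2]) (ht.1.le.trans ht.2)⟩
  have hts : |t - max (t - h) 0| < ρ := by
    rw [abs_of_nonneg (sub_nonneg.2 (max_le (by linarith) ht.1.le))]
    linarith [le_max_left (t - h) 0]
  have hinc := increment_eq_timeAverage hWi hW0 hWu ht hh0
  have hgt := hu.sobolev t ht.1.le
  have hgs := hu.sobolev _ hmem.1
  have hmain := subgradient_inequality hp hn hab hε hgt hgs h1.1 h1.2
  rw [max_eq_left ht.1.le]
  have e1 : ∫ x, W (t, x) * (∫ s in (0 : ℝ)..h, W (t - s, x)) =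
      ∫ x in a..b, W (t, x) * (u t x - u (max (t - h) 0) x) := by
    rw [intervalIntegral.integral_of_le hab.le, ← setIntegral_eq_integral_of_forall_compl_eq_zero
      (s := Ioc a b) fun x hx => by rw [hW0 _ fun hz => hx hz.2, zero_mul]]
    refine integral_congr_ae ?_
    filter_upwards [hinc] with x hx
    rw [hx.2]
  have e2 : ∫ x, (Ioc 0 T ×ˢ Ioc a b).indicator 1 (t, x) * (∫ s in (0 : ℝ)..h, |W (t - s, x)|) =
      ∫ x in Ioc a b, (Ioc 0 T ×ˢ Ioc a b).indicator 1 (t, x) *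
        (∫ s in (0 : ℝ)..h, |W (t - s, x)|) := by
    refine (setIntegral_eq_integral_of_forall_compl_eq_zero fun x hx => ?_).symm
    rw [indicator_of_notMem (fun hz => hx hz.2), zero_mul]
  have e3 : ∫ x in a..b, (reaction n (u t x) * (u t x - u (max (t - h) 0) x) +
      potential n (u t x) - potential n (u (max (t - h) 0) x)) ≤
      η * ∫ x in Ioc a b, (Ioc 0 T ×ˢ Ioc a b).indicator 1 (t, x) *
        (∫ s in (0 : ℝ)..h, |W (t - s, x)|) := by
    rw [intervalIntegral.integral_of_le hab.le, ← integral_const_mul]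
    have hTc := hgt.continuousOn hab.le
    have hsc := hgs.continuousOn hab.le
    refine integral_mono_ae ?_ (h2.integrableOn.const_mul η) ?_
    · have hcont : ContinuousOn (fun x => reaction n (u t x) *
          (u t x - u (max (t - h) 0) x) + potential n (u t x) -
          potential n (u (max (t - h) 0) x)) (Icc a b) :=
        ((((continuous_reaction hn).comp_continuousOn hTc).mul (hTc.sub hsc)).add
          ((continuous_potential (by linarith)).comp_continuousOn hTc)).sub
          ((continuous_potential (by linarith)).comp_continuousOn hsc)
      exact hcont.integrableOn_Icc.mono_set Ioc_subset_Icc_self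
    · filter_upwards [hinc, ae_restrict_mem measurableSet_Ioc] with x hx hx2
      refine (H _ hmem t ⟨ht.1.le, ht.2⟩ hts x (Ioc_subset_Icc_self hx2)).trans ?_
      have hin : (Ioc 0 T ×ˢ Ioc a b).indicator (1 : ℝ × ℝ → ℝ) (t, x) = 1 :=
        indicator_of_mem (show (t, x) ∈ Ioc 0 T ×ˢ Ioc a b from ⟨ht, hx2⟩) _
      rw [hin, one_mul, hx.2]
      gcongr
      exact intervalIntegral.abs_integral_le_integral_abs hh0.le
  rw [e1, e2]
  linarith

/-- The displacement in `L¹` is controlled by the `L²` norm of the time derivative. -/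
theorem sq_integral_abs_sub_le {T : ℝ} (hT : 0 < T) (hab : a < b) {W : ℝ × ℝ → ℝ}
    (hW2 : MemLp W 2) (hWi : Integrable W)
    (hW0 : ∀ z, z ∉ Ioc 0 T ×ˢ Ioc a b → W z = 0)
    (hWu : ∀ᵐ x ∂volume.restrict (Ioc a b), u T x - u 0 x = ∫ s in (0 : ℝ)..T, W (s, x)) :
    (∫ x in a..b, |u T x - u 0 x|) ^ 2 ≤ T * (b - a) * ∫ z, W z ^ 2 := by
  have hba : 0 < b - a := sub_pos.2 hab
  set I := ∫ z, |W z| with hI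
  have h1 : ∫ x in a..b, |u T x - u 0 x| ≤ I := by
    have hfub : I = ∫ x, ∫ s, |W (s, x)| := by
      rw [hI, Measure.volume_eq_prod]
      exact integral_prod_symm (fun z => |W z|) hWi.abs
    have hint : Integrable fun x => ∫ s, |W (s, x)| := hWi.abs.integral_prod_right
    rw [hfub, intervalIntegral.integral_of_le hab.le]
    refine le_trans ?_ (setIntegral_le_integral hint
      (ae_of_all _ fun x => integral_nonneg fun s => abs_nonneg _) (s := Ioc a b))
    refine integral_mono_of_nonneg (ae_of_all _ fun x => abs_nonneg _) hint.integrableOn ?_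
    filter_upwards [hWu, ae_restrict_of_ae hWi.prod_left_ae] with x hx hx2
    rw [hx]
    refine (intervalIntegral.abs_integral_le_integral_abs hT.le).trans ?_
    rw [intervalIntegral.integral_of_le hT.le]
    exact setIntegral_le_integral hx2.abs (ae_of_all _ fun s => abs_nonneg _)
  have h0 : 0 ≤ ∫ x in a..b, |u T x - u 0 x| :=
    intervalIntegral.integral_nonneg hab.le fun x _ => abs_nonneg _
  have h2 : (∫ x in a..b, |u T x - u 0 x|) ^ 2 ≤ I ^ 2 := by gcongr
  refine h2.trans ?_
  set Q : Set (ℝ × ℝ) := Ioc 0 T ×ˢ Ioc a b with hQ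
  have hq : volume.real Q = T * (b - a) := by
    rw [hQ, Measure.volume_eq_prod, measureReal_prod_prod]
    simp [hT.le, hab.le]
  have hQfin : volume Q ≠ ⊤ := by
    rw [hQ, Measure.volume_eq_prod, Measure.prod_prod]
    exact (ENNReal.mul_lt_top (by simp) (by simp)).ne
  have r1 : ∫ z in Q, |W z| = I := setIntegral_eq_integral_of_forall_compl_eq_zero
    fun z hz => by rw [hW0 z hz, abs_zero]
  have r2 : ∫ z in Q, W z ^ 2 = ∫ z, W z ^ 2 := setIntegral_eq_integral_of_forall_compl_eq_zero
    fun z hz => by rw [hW0 z hz]; simp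
  set q := T * (b - a) with hqdef
  have hq0 : 0 < q := by positivity
  -- Cauchy–Schwarz on Q, as nonnegativity of the integral of (|W| - mean)².
  have hsq : 0 ≤ ∫ z in Q, (W z ^ 2 - 2 * (I / q) * |W z| + (I / q) ^ 2) :=
    integral_nonneg fun z => by
      have : W z ^ 2 - 2 * (I / q) * |W z| + (I / q) ^ 2 = (|W z| - I / q) ^ 2 := by
        rw [← sq_abs (W z)]; ring
      simp only [this]
      positivity
  have j1 : IntegrableOn (fun z => W z ^ 2) Q := hW2.integrable_sq.integrableOn
  have j2 : IntegrableOn (fun z => 2 * (I / q) * |W z|) Q := (hWi.abs.const_mul _).integrableOn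
  have j3 : IntegrableOn (fun _ : ℝ × ℝ => (I / q) ^ 2) Q := integrableOn_const hQfin
  have j12 : IntegrableOn (fun z => W z ^ 2 - 2 * (I / q) * |W z|) Q := j1.sub j2
  rw [integral_add j12 j3,
    integral_sub j1 j2, integral_const_mul, r1, r2, setIntegral_const, hq, smul_eq_mul] at hsq
  have e : q * ((∫ z, W z ^ 2) - 2 * (I / q) * I + q * (I / q) ^ 2) =
      q * (∫ z, W z ^ 2) - I ^ 2 := by field_simp; ring
  nlinarith [mul_nonneg hq0.le hsq]

/-- The energy inequality: the displacement of a solution is controlled by the loss of energy. -/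
theorem IsSolution.sq_displacement_le (hp : 1 < p) (hn : 1 < n) (hab : a < b) (hε : 0 < ε)
    (hu : IsSolution p n ε a b u₀ u) :
    ∀ᵐ T ∂volume.restrict (Ioi (0 : ℝ)), (∫ x in a..b, |u T x - u 0 x|) ^ 2 ≤
      T * (b - a) * (ε * (energy p n ε a b (u 0) - energy p n ε a b (u T))) := by
  obtain ⟨hgood, hder⟩ := hu.exists_timeDeriv hab
  filter_upwards [hgood, ae_restrict_mem measurableSet_Ioi] with T hv hT
  replace hT : 0 < T := hT
  obtain ⟨v, hv⟩ := hv
  obtain ⟨W, hWm, hW2, hWi, hW0, hWe, hWu⟩ := hder T hT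
  have hdiss := energy_dissipation_of_discrete hT hWm hW2 hW0
    (Ψ := fun t => ε * energy p n ε a b (u (max t 0)))
    (fun c d hc hd => hu.intervalIntegrable_energy hp hn hab hε hT hc hd)
    (fun t ht => by simp only [max_eq_right ht, max_self])
    (fun η hη => by
      simp only [max_eq_left hT.le]
      exact hu.lowerSemicontinuous_energy hp hn hab hε hT hv hη)
    (fun η hη => hu.discrete_energy_inequality hp hn hab hε hWm hW2 hWi hW0 hWe hWu hη)
  simp only [max_eq_left hT.le, max_self] at hdiss
  refine (sq_integral_abs_sub_le hT hab hW2 hWi hW0 (hWu T ⟨hT.le, le_rfl⟩)).trans ?_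
  have : 0 < T * (b - a) := mul_pos hT (sub_pos.2 hab)
  gcongr
  linarith

end

end PLaplaceAC

namespace PLaplaceAC

/-! ### Slow motion of the interface -/

theorem exists_mem_of_ae_restrict_Ioi {P : ℝ → Prop} (hP : ∀ᵐ t ∂volume.restrict (Ioi (0 : ℝ)), P t)
    {s : Set ℝ} (hs : IsOpen s) (hne : s.Nonempty) (hsub : s ⊆ Ioi 0) : ∃ t ∈ s, P t := by
  by_contra! hcon
  have h1 : volume s = 0 := by
    rw [ae_restrict_iff' measurableSet_Ioi] at hP
    exact measure_mono_null (t := {t | ¬(t ∈ Ioi 0 → P t)})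
      (fun t ht hPt => hcon t ht (hPt (hsub ht))) (ae_iff.1 hP)
  exact (hs.measure_pos volume hne).ne' h1

/-- A violation at one time of [0, T] persists on a nonempty open subset of (0, T), which has
positive measure. -/
theorem le_of_ae_le_of_continuous {f : ℝ → ℝ} (hf : Continuous f) {T c : ℝ} (hT : 0 < T)
    (h : ∀ᵐ t ∂volume.restrict (Ioi (0 : ℝ)), t < T → f t ≤ c) {t : ℝ} (ht : t ∈ Icc 0 T) :
    f t ≤ c := by
  by_contra! hcon
  have hO : IsOpen {s | c < f s} := isOpen_lt continuous_const hf
  rw [← closure_Ioo hT.ne] at ht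
  obtain ⟨s, hs, hsP⟩ := exists_mem_of_ae_restrict_Ioi h (hO.inter isOpen_Ioo)
    (mem_closure_iff.1 ht _ hO hcon) fun s hs => hs.2.1
  exact absurd (hsP hs.2.2) (not_le.2 hs.1)

section
variable {p n a b r σ : ℝ} {N : ℕ} {h : Fin N → ℝ}

/-- `w` is uniformly close to the step function away from its jumps and takes values close to
`[-1, 1]`. -/
def IsLocalized (a b θ ρ σ : ℝ) (h : Fin N → ℝ) (w : ℝ → ℝ) : Prop :=
  (∀ x ∈ Icc a b, (∀ i, ρ ≤ |x - h i|) → |w x - stepFun σ h x| ≤ θ) ∧ ∀ x ∈ Icc a b, |w x| ≤ 1 + θ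

/-- Where w₁ takes a value in K, it is not near a well, so x is within ρ of some h i. Across [h i -
ρ, h i + ρ] the function w₂ passes from near one well to near the other, and so takes that same
value. -/
theorem IsLocalized.exists_dist_le (hσ : σ = 1 ∨ σ = -1) (hr : 0 < r)
    (hsep : ∀ i j : Fin N, i < j → h i + r < h j - r)
    (ha : ∀ i, a ≤ h i - r) (hb : ∀ i, h i + r ≤ b) {θ ρ : ℝ} (hρ0 : 0 < ρ) (hρr : ρ < r)
    {K : Set ℝ} (hK : ∀ s ∈ K, θ < |s - 1| ∧ θ < |s - -1|) {w₁ w₂ : ℝ → ℝ}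
    (h₁ : IsLocalized a b θ ρ σ h w₁) (h₂ : IsLocalized a b θ ρ σ h w₂)
    (hc : ContinuousOn w₂ (Icc a b)) {x : ℝ} (hx : x ∈ interfaceSet a b K w₁) :
    ∃ y ∈ interfaceSet a b K w₂, |x - y| ≤ 2 * ρ := by
  obtain ⟨hxI, hxK⟩ := hx
  obtain ⟨hK1, hK2⟩ := hK _ hxK
  have hnear : ∃ i, |x - h i| < ρ := by
    by_contra! hfar
    have h3 := h₁.1 x hxI hfar
    rcases stepFun_eq_or (h := h) hσ x with e | e <;> rw [e] at h3 <;> linarith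
  obtain ⟨i, hi⟩ := hnear
  have hai := ha i
  have hbi := hb i
  have hfar : ∀ y, |y - h i| = ρ → ∀ j, ρ ≤ |y - h j| := by
    intro y hy j
    by_cases hij : i = j
    · rw [← hij, hy]
    · have h3 := two_mul_lt_abs_sub hsep hij
      have h4 := abs_sub_le (h i) y (h j)
      rw [abs_sub_comm (h i) y] at h4
      linarith
  have hR := h₂.1 (h i + ρ) ⟨by linarith, by linarith⟩
    (hfar _ (by rw [add_sub_cancel_left, abs_of_pos hρ0]))
  have hL := h₂.1 (h i - ρ) ⟨by linarith, by linarith⟩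
    (hfar _ (by rw [sub_sub_cancel_left, abs_neg, abs_of_pos hρ0]))
  rw [stepFun_right hr hsep ⟨by linarith, by linarith⟩] at hR
  rw [stepFun_left hr hsep ⟨by linarith, by linarith⟩] at hL
  -- The bound |w₁| ≤ 1 + θ excludes values of K beyond the wells, which w₂ need not take.
  have hlow : -1 + θ < w₁ x ∧ w₁ x < 1 - θ := by
    have h3 := abs_le.1 (h₁.2 x hxI)
    constructor
    · rcases lt_abs.1 hK2 with h4 | h4 <;> linarith
    · rcases lt_abs.1 hK1 with h4 | h4 <;> linarith
  have hval : w₁ x ∈ uIcc (w₂ (h i - ρ)) (w₂ (h i + ρ)) := by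
    rw [abs_le] at hR hL
    rw [mem_uIcc]
    rcases stepFun_eq_or (h := h) hσ (h i + r) with e | e <;> rw [e] at hR hL
    · left; constructor <;> linarith
    · right; constructor <;> linarith
  have hsub : uIcc (h i - ρ) (h i + ρ) ⊆ Icc a b :=
    uIcc_subset_Icc ⟨by linarith, by linarith⟩ ⟨by linarith, by linarith⟩
  obtain ⟨y, hy, hyx⟩ := intermediate_value_uIcc (hc.mono hsub) hval
  refine ⟨y, ⟨hsub hy, by rwa [hyx]⟩, ?_⟩
  rw [uIcc_of_le (by linarith)] at hy
  rw [abs_lt] at hi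
  rw [abs_le]
  constructor <;> linarith [hy.1, hy.2]

/-- At the end points `deriv` depends on values outside [a, b]; the comparison is made on the open
interval. -/
theorem energy_congr {ε : ℝ} {f g : ℝ → ℝ} (hab : a ≤ b) (hfg : ∀ x ∈ Icc a b, f x = g x) :
    energy p n ε a b f = energy p n ε a b g := by
  unfold energy
  rw [intervalIntegral.integral_of_le hab, intervalIntegral.integral_of_le hab,
    integral_Ioc_eq_integral_Ioo, integral_Ioc_eq_integral_Ioo]
  refine setIntegral_congr_fun measurableSet_Ioo fun x hx => ?_
  have hEq : f =ᶠ[𝓝 x] g := by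
    filter_upwards [Icc_mem_nhds hx.1 hx.2] with y hy using hfg y hy
  simp only [hEq.deriv_eq, hEq.eq_of_nhds]

theorem IsSolution.continuous_apply {ε : ℝ} {u₀ : ℝ → ℝ} {u : ℝ → ℝ → ℝ}
    (hu : IsSolution p n ε a b u₀ u) {x : ℝ} (hx : x ∈ Icc a b) :
    Continuous fun t => u (max t 0) x :=
  hu.continuousOn.comp_continuous (f := fun t : ℝ => (max t 0, x)) (by fun_prop)
    fun t => ⟨(le_max_right _ _ : (0 : ℝ) ≤ max t 0), hx⟩

theorem IsSolution.continuous_displacement {ε : ℝ} {u₀ : ℝ → ℝ} {u : ℝ → ℝ → ℝ} (hab : a ≤ b)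
    (hu : IsSolution p n ε a b u₀ u) :
    Continuous fun t => ∫ x in a..b, |u (max t 0) x - u 0 x| := by
  let U : ℝ → ℝ → ℝ := fun t x => u (max t 0) (projIcc a b hab x)
  have hU : Continuous (Function.uncurry U) := by
    refine hu.continuousOn.comp_continuous
      (f := fun z : ℝ × ℝ => (max z.1 0, (projIcc a b hab z.2 : ℝ))) ?_ fun z =>
        ⟨(le_max_right _ _ : (0 : ℝ) ≤ max z.1 0), (projIcc a b hab z.2).2⟩
    exact (by fun_prop : Continuous fun z : ℝ × ℝ => max z.1 0).prodMk
      (continuous_subtype_val.comp (continuous_projIcc.comp continuous_snd))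
  have hV : Continuous (Function.uncurry fun t x => |U t x - U 0 x|) := by
    have h0 : Continuous fun z : ℝ × ℝ => U 0 z.2 :=
      hU.comp (by fun_prop : Continuous fun z : ℝ × ℝ => ((0 : ℝ), z.2))
    exact (hU.sub h0).abs
  have := intervalIntegral.continuous_parametric_intervalIntegral_of_continuous' (μ := volume)
    hV a b
  refine this.congr fun t => intervalIntegral.integral_congr fun x hx => ?_
  rw [uIcc_of_le hab] at hx
  simp only [U, projIcc_of_mem hab hx, max_self]

/-- Slow motion of the interface for a general small defect `d`: the solutions keep their
transition layers for times of order `1 / d ε`. -/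
theorem HasTailBound.slow_motion (hp : 1 < p) (hn : 1 < n) (hab : a < b)
    (hσ : σ = 1 ∨ σ = -1) (hr : 0 < r) (hsep : ∀ i j : Fin N, i < j → h i + r < h j - r)
    (ha : ∀ i, a ≤ h i - r) (hb : ∀ i, h i + r ≤ b) {d : ℝ → ℝ} (hd : ∀ ε > 0, 0 < d ε)
    (hd0 : Tendsto d (𝓝[>] 0) (𝓝 0)) (htail : HasTailBound p n r d)
    {u₀ : ℝ → ℝ → ℝ} {u : ℝ → ℝ → ℝ → ℝ}
    (hu : ∀ᶠ ε in 𝓝[>] (0 : ℝ), IsSolution p n ε a b (u₀ ε) (u ε))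
    (hlim : Tendsto (fun ε => ∫ x in a..b, |u₀ ε x - stepFun σ h x|) (𝓝[>] (0 : ℝ)) (𝓝 0))
    {K : Set ℝ} (hK : IsClosed K) (hK1 : (1 : ℝ) ∉ K) (hK2 : (-1 : ℝ) ∉ K)
    {δ : ℝ} (hδ : 0 < δ) (hδr : δ < r) {C : ℝ} (hC : 0 ≤ C)
    (hE : ∀ᶠ ε in 𝓝[>] (0 : ℝ),
      energy p n ε a b (u₀ ε) ≤ N * transitionEnergy p n + C * d ε) :
    ∀ᶠ ε in 𝓝[>] (0 : ℝ), (((d ε)⁻¹ : ℝ) : EReal) < exitTime a b K δ (u₀ ε) (u ε) := by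
  have hn0 : 0 < n := by linarith
  have hba : 0 < b - a := sub_pos.2 hab
  -- K is closed and misses ±1, so it keeps a positive distance from both.
  obtain ⟨θ, hθ0, hθ1, hθK⟩ : ∃ θ, 0 < θ ∧ θ < 1 ∧ ∀ s ∈ K, θ < |s - 1| ∧ θ < |s - -1| := by
    obtain ⟨r₁, hr₁, H1⟩ := Metric.isOpen_iff.1 hK.isOpen_compl 1 hK1
    obtain ⟨r₂, hr₂, H2⟩ := Metric.isOpen_iff.1 hK.isOpen_compl (-1) hK2
    have hm : 0 < min (min r₁ r₂) 1 := lt_min (lt_min hr₁ hr₂) one_pos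
    have m1 : min (min r₁ r₂) 1 ≤ r₁ := (min_le_left _ _).trans (min_le_left _ _)
    have m2 : min (min r₁ r₂) 1 ≤ r₂ := (min_le_left _ _).trans (min_le_right _ _)
    have m3 : min (min r₁ r₂) 1 ≤ 1 := min_le_right _ _
    refine ⟨min (min r₁ r₂) 1 / 2, by positivity, by linarith, fun s hs => ⟨?_, ?_⟩⟩
    · by_contra! hcon
      exact H1 (show s ∈ Metric.ball 1 r₁ by rw [Metric.mem_ball, Real.dist_eq]; linarith) hs
    · by_contra! hcon
      exact H2 (show s ∈ Metric.ball (-1) r₂ by rw [Metric.mem_ball, Real.dist_eq]; linarith) hs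
  -- Two points within ρ of the same jump are at distance at most δ.
  set ρ := δ / 2 with hρ
  have hρ0 : 0 < ρ := by positivity
  have hρr : ρ < r := by linarith
  obtain ⟨δ₁, hδ₁, C₁, hC₁, hLB⟩ :=
    htail.exists_energy_lower_bound hp hn0 hab hσ hr hsep ha hb (fun ε hε => (hd ε hε).le)
  obtain ⟨δ₂, hδ₂, hloc⟩ := exists_localization hp hn0 hab hσ hr hsep ha hb hθ0 hθ1 hρ0 hρr
  set δ₀ := min δ₁ δ₂ with hδ₀
  have hδ₀0 : 0 < δ₀ := lt_min hδ₁ hδ₂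
  have hL1 : ∀ᶠ ε in 𝓝[>] (0 : ℝ), ∫ x in a..b, |u₀ ε x - stepFun σ h x| < δ₀ / 2 :=
    hlim.eventually (gt_mem_nhds (by positivity))
  have hCd : ∀ᶠ ε in 𝓝[>] (0 : ℝ), C * d ε < δ₂ :=
    (show Tendsto (fun ε => C * d ε) (𝓝[>] 0) (𝓝 0) by simpa using hd0.const_mul C).eventually
      (gt_mem_nhds hδ₂)
  have hsmall : ∀ᶠ ε in 𝓝[>] (0 : ℝ), 2 * (b - a) * (C + C₁) * ε < (δ₀ / 4) ^ 2 := by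
    have : Tendsto (fun ε : ℝ => 2 * (b - a) * (C + C₁) * ε) (𝓝[>] 0) (𝓝 0) := by
      have h1 : Tendsto (fun ε : ℝ => 2 * (b - a) * (C + C₁) * ε) (𝓝 0)
          (𝓝 (2 * (b - a) * (C + C₁) * 0)) := by
        exact (continuous_const.mul continuous_id).tendsto 0
      rw [mul_zero] at h1
      exact h1.mono_left nhdsWithin_le_nhds
    exact this.eventually (gt_mem_nhds (by positivity))
  filter_upwards [hu, hE, hLB, hL1, hCd, hsmall, self_mem_nhdsWithin] with
    ε hu hE hLB hL1 hCd hsmall hε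
  replace hε : 0 < ε := hε
  have hdε := hd ε hε
  set v := stepFun σ h with hv
  have hE0 : energy p n ε a b (u ε 0) ≤ N * transitionEnergy p n + C * d ε := by
    rwa [energy_congr hab.le hu.initial]
  have hL10 : ∫ x in a..b, |u ε 0 x - v x| < δ₀ / 2 := by
    rwa [intervalIntegral.integral_congr (g := fun x => |u₀ ε x - v x|) fun x hx => ?_]
    rw [uIcc_of_le hab.le] at hx
    simp only [hu.initial x hx]
  set m : ℝ → ℝ := fun t => ∫ x in a..b, |u ε (max t 0) x - u ε 0 x| with hm
  have hmc : Continuous m := hu.continuous_displacement hab.le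
  have hm0 : m 0 = 0 := by simp [hm]
  -- The factor 2 makes the final inequality strict.
  set T := 2 * (d ε)⁻¹ with hT
  have hT0 : 0 < T := by positivity
  have hii : ∀ t, 0 ≤ t → IntervalIntegrable (fun x => |u ε t x - v x|) volume a b := fun t ht =>
    (intervalIntegrable_iff_integrableOn_Ioc_of_le hab.le).2
      (integrableOn_abs_sub_stepFun hσ ((hu.sobolev t ht).continuousOn hab.le))
  have htri : ∀ t, 0 ≤ t → ∫ x in a..b, |u ε t x - v x| ≤ m t + δ₀ / 2 := by
    intro t ht
    have hmi : IntervalIntegrable (fun x => |u ε t x - u ε 0 x|) volume a b :=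
      ContinuousOn.intervalIntegrable_of_Icc hab.le
        ((((hu.sobolev t ht).continuousOn hab.le).sub
          ((hu.sobolev 0 le_rfl).continuousOn hab.le)).abs)
    have h1 := intervalIntegral.integral_mono_on hab.le (hii t ht) (hmi.add (hii 0 le_rfl))
      fun x _ => abs_sub_le (u ε t x) (u ε 0 x) (v x)
    rw [intervalIntegral.integral_add hmi (hii 0 le_rfl)] at h1
    simp only [hm, max_eq_left ht]
    linarith
  have hdisp := hu.sq_displacement_le hp hn hab hε
  -- the solution does not move far
  have hmT : ∀ t ∈ Icc 0 T, m t < δ₀ / 2 := by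
    intro t ht
    by_contra! hcon
    -- The displacement bound holds only at almost every time, so the contradiction is sought on the
    -- open set where δ₀/4 < m < δ₀/2. It is nonempty because m takes the intermediate value 3δ₀/8.
    obtain ⟨t₁, ht₁, hmt₁⟩ := intermediate_value_Icc ht.1 hmc.continuousOn
      (show 3 * δ₀ / 8 ∈ Icc (m 0) (m t) by rw [hm0]; constructor <;> linarith)
    have ht₁0 : t₁ ≠ 0 := by rintro rfl; linarith
    have ht₁t : t₁ ≠ t := by rintro rfl; linarith
    obtain ⟨s, ⟨⟨hs1, hs2⟩, hs3⟩, hsP⟩ := exists_mem_of_ae_restrict_Ioi hdisp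
      ((isOpen_Ioo.preimage hmc).inter isOpen_Ioo)
      ⟨t₁, show m t₁ ∈ Ioo (δ₀ / 4) (δ₀ / 2) by rw [hmt₁]; constructor <;> linarith,
        show t₁ ∈ Ioo 0 T from ⟨ht₁.1.lt_of_ne' ht₁0, (ht₁.2.lt_of_ne ht₁t).trans_le ht.2⟩⟩
      fun s hs => hs.2.1
    have hms : m s = ∫ x in a..b, |u ε s x - u ε 0 x| := by simp only [hm, max_eq_left hs3.1.le]
    rw [← hms] at hsP
    have h1 := hLB (u ε s) (hu.sobolev s hs3.1.le)
      ((htri s hs3.1.le).trans (by linarith [min_le_left δ₁ δ₂]))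
    have h2 : s * (b - a) * (ε * (energy p n ε a b (u ε 0) - energy p n ε a b (u ε s))) ≤
        T * (b - a) * (ε * ((C + C₁) * d ε)) := by
      have h3 : energy p n ε a b (u ε 0) - energy p n ε a b (u ε s) ≤ (C + C₁) * d ε := by linarith
      have h4 : 0 ≤ (C + C₁) * d ε := by positivity
      have h5 := hs3.1
      have h6 := hs3.2.le
      calc s * (b - a) * (ε * (energy p n ε a b (u ε 0) - energy p n ε a b (u ε s)))
          ≤ s * (b - a) * (ε * ((C + C₁) * d ε)) := by gcongr
        _ ≤ T * (b - a) * (ε * ((C + C₁) * d ε)) := by gcongr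
    have h3 : T * (b - a) * (ε * ((C + C₁) * d ε)) = 2 * (b - a) * (C + C₁) * ε := by
      rw [hT]; field_simp
    have h4 : (δ₀ / 4) ^ 2 < m s ^ 2 := by gcongr
    linarith
  -- hence its transition layers persist
  have hae : ∀ᵐ t ∂volume.restrict (Ioi (0 : ℝ)), t < T → IsLocalized a b θ ρ σ h (u ε t) := by
    filter_upwards [hdisp, ae_restrict_mem measurableSet_Ioi] with t ht ht0 htT
    replace ht0 : 0 < t := ht0
    -- The displacement bound also gives E(t) ≤ E(0), its left side being a square.
    have h1 : 0 ≤ t * (b - a) * ε *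
        (energy p n ε a b (u ε 0) - energy p n ε a b (u ε t)) := by
      refine (sq_nonneg _).trans (ht.trans (le_of_eq ?_)); ring
    have h2 := nonneg_of_mul_nonneg_right h1 (by positivity)
    refine hloc ε hε _ (hu.sobolev t ht0.le) ?_ (by linarith)
    exact (htri t ht0.le).trans (by linarith [hmT t ⟨ht0.le, htT.le⟩, min_le_right δ₁ δ₂])
  -- For fixed x the localization bounds are closed conditions on a continuous function of time, so
  -- they extend from almost every time to all of [0, T].
  have hall : ∀ t ∈ Icc 0 T, IsLocalized a b θ ρ σ h (u ε t) := by
    intro t ht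
    have hmax : ∀ x, u ε t x = u ε (max t 0) x := fun x => by rw [max_eq_left ht.1]
    constructor
    · intro x hx hfar
      rw [hmax]
      refine le_of_ae_le_of_continuous (f := fun t => |u ε (max t 0) x - v x|)
        ((hu.continuous_apply hx).sub continuous_const).abs hT0 ?_ ht
      filter_upwards [hae, ae_restrict_mem measurableSet_Ioi] with s hs hs0 hsT
      rw [max_eq_left (le_of_lt hs0)]
      exact (hs hsT).1 x hx hfar
    · intro x hx
      rw [hmax]
      refine le_of_ae_le_of_continuous (f := fun t => |u ε (max t 0) x|)
        (hu.continuous_apply hx).abs hT0 ?_ ht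
      filter_upwards [hae, ae_restrict_mem measurableSet_Ioi] with s hs hs0 hsT
      rw [max_eq_left (le_of_lt hs0)]
      exact (hs hsT).2 x hx
  have h0 := hall 0 ⟨le_rfl, hT0.le⟩
  have hI0 : interfaceSet a b K (u₀ ε) = interfaceSet a b K (u ε 0) := by
    ext x
    simp only [interfaceSet, mem_ofPred_eq]
    exact and_congr_right fun hx => by rw [hu.initial x hx]
  have hhaus : ∀ t ∈ Icc 0 T, Metric.hausdorffEDist (interfaceSet a b K (u ε t))
      (interfaceSet a b K (u₀ ε)) ≤ ENNReal.ofReal δ := by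
    intro t ht
    rw [hI0]
    have hδρ : 2 * ρ = δ := by rw [hρ]; ring
    have hcont : ∀ s, 0 ≤ s → ContinuousOn (u ε s) (Icc a b) := fun s hs =>
      (hu.sobolev s hs).continuousOn hab.le
    refine Metric.hausdorffEDist_le_of_mem_edist (fun x hx => ?_) (fun x hx => ?_)
    · obtain ⟨y, hy, hxy⟩ := (hall t ht).exists_dist_le hσ hr hsep ha hb hρ0 hρr hθK h0
        (hcont 0 le_rfl) hx
      exact ⟨y, hy, by rw [edist_dist, Real.dist_eq]; exact ENNReal.ofReal_le_ofReal (hδρ ▸ hxy)⟩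
    · obtain ⟨y, hy, hxy⟩ := h0.exists_dist_le hσ hr hsep ha hb hρ0 hρr hθK (hall t ht)
        (hcont t ht.1) hx
      exact ⟨y, hy, by rw [edist_dist, Real.dist_eq]; exact ENNReal.ofReal_le_ofReal (hδρ ▸ hxy)⟩
  have hlt : (((d ε)⁻¹ : ℝ) : EReal) < (T : EReal) := by
    rw [EReal.coe_lt_coe_iff, hT]
    linarith [inv_pos.2 hdε]
  refine hlt.trans_le (le_sInf ?_)
  rintro _ ⟨t, ⟨ht0, ht⟩, rfl⟩
  rw [EReal.coe_le_coe_iff]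
  by_contra! hcon
  exact absurd (hhaus t ⟨ht0, hcon.le⟩) (not_le.2 ht)

end

/-! ### Limits of the two defects as ε → 0 -/

theorem kExp_pos {p n : ℝ} (hp : 1 < p) (hn : 0 < n) {m : ℕ} (hm : 2 ≤ m) : 0 < kExp p n m := by
  have hα : 0 < (p - 1) / p + 1 / n := add_pos (exponent_pos hp) (by positivity)
  have hnn : ∀ k, 0 ≤ kSeq ((p - 1) / p + 1 / n) k := by
    intro k
    induction k using kSeq.induct with
    | case1 => simp [kSeq]
    | case2 => simp [kSeq]
    | case3 k ih => simp only [kSeq]; positivity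
  -- The restriction m ≥ 2 excludes k₁ = 0, for which the defect ε^0 would not tend to 0.
  obtain ⟨k, rfl⟩ := Nat.exists_eq_add_of_le' hm
  have := hnn (k + 1)
  simp only [kExp, kSeq]
  positivity

theorem tendsto_exp_neg_div {c : ℝ} (hc : 0 < c) :
    Tendsto (fun ε : ℝ => Real.exp (-c / (2 * ε))) (𝓝[>] 0) (𝓝 0) := by
  refine Real.tendsto_exp_atBot.comp ?_
  have h1 : Tendsto (fun ε : ℝ => ε⁻¹) (𝓝[>] 0) atTop := tendsto_inv_nhdsGT_zero
  have h2 := h1.const_mul_atTop_of_neg (show -c / 2 < 0 by linarith)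
  refine h2.congr fun ε => ?_
  rw [neg_div, neg_div, neg_mul, ← div_eq_mul_inv, div_div]

theorem tendsto_rpow_nhdsGT_zero {k : ℝ} (hk : 0 < k) :
    Tendsto (fun ε : ℝ => ε ^ k) (𝓝[>] 0) (𝓝 0) := by
  have := (Real.continuousAt_rpow_const 0 k (Or.inr hk.le)).tendsto
  rw [Real.zero_rpow hk.ne'] at this
  exact this.mono_left nhdsWithin_le_nhds

theorem exists_forall_of_eventually_nhdsGT {P : ℝ → Prop} (h : ∀ᶠ ε in 𝓝[>] (0 : ℝ), P ε) :
    ∃ ε₀ : ℝ, 0 < ε₀ ∧ ∀ ε : ℝ, 0 < ε → ε < ε₀ → P ε := by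
  obtain ⟨ε₀, hε₀, H⟩ := mem_nhdsGT_iff_exists_Ioo_subset.1 h
  exact ⟨ε₀, hε₀, fun ε h1 h2 => H ⟨h1, h2⟩⟩

end PLaplaceAC

theorem mainTheorem3
    (p n a b : ℝ) (hp : 1 < p) (hn : 1 < n) (hab : a < b)
    -- the step function `v` with `N` jumps `h`, and the radius `r`
    (N : ℕ) (h : Fin N → ℝ) (σ : ℝ) (hσ : σ = 1 ∨ σ = -1)
    (r : ℝ) (hr : 0 < r) (hsep : ∀ i j : Fin N, i < j → h i + r < h j - r)
    (ha : ∀ i : Fin N, a ≤ h i - r) (hb : ∀ i : Fin N, h i + r ≤ b)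
    -- the initial data and the solutions, indexed by `ε`
    (u₀ : ℝ → ℝ → ℝ) (u : ℝ → ℝ → ℝ → ℝ)
    (hu : ∀ᶠ ε in 𝓝[>] (0 : ℝ), PLaplaceAC.IsSolution p n ε a b (u₀ ε) (u ε))
    (hlim : Tendsto (fun ε => ∫ x in a..b, |u₀ ε x - PLaplaceAC.stepFun σ h x|)
      (𝓝[>] (0 : ℝ)) (𝓝 0))
    (K : Set ℝ) (hK : IsClosed K) (hK1 : (1 : ℝ) ∉ K) (hK2 : (-1 : ℝ) ∉ K)
    (δ : ℝ) (hδ : 0 < δ) (hδr : δ < r) :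
    -- the critical case
    (n = p → ∀ A C : ℝ, 0 < A → A < r * √2 * PLaplaceAC.lam p → 0 < C →
      (∀ᶠ ε in 𝓝[>] (0 : ℝ), PLaplaceAC.energy p n ε a b (u₀ ε) ≤
        N * PLaplaceAC.transitionEnergy p n + C * Real.exp (-(A * p) / (2 * ε))) →
      ∃ ε₀ : ℝ, 0 < ε₀ ∧ ∀ ε : ℝ, 0 < ε → ε < ε₀ →
        ((Real.exp (A * p / (2 * ε)) : ℝ) : EReal) <
          PLaplaceAC.exitTime a b K δ (u₀ ε) (u ε)) ∧
    -- the degenerate case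
    (p < n → ∀ m : ℕ, 2 ≤ m →
      (∀ᶠ ε in 𝓝[>] (0 : ℝ), PLaplaceAC.energy p n ε a b (u₀ ε) ≤
        N * PLaplaceAC.transitionEnergy p n + ε ^ PLaplaceAC.kExp p n m) →
      ∃ ε₀ : ℝ, 0 < ε₀ ∧ ∀ ε : ℝ, 0 < ε → ε < ε₀ →
        ((ε ^ (-PLaplaceAC.kExp p n m) : ℝ) : EReal) <
          PLaplaceAC.exitTime a b K δ (u₀ ε) (u ε)) := by

  -- In both cases the inverse of the defect d(ε) is the claimed lifetime; the constant C of the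
  -- excess is 1 in the second.
  refine ⟨?_, ?_⟩
  · rintro rfl A C hA hAr hC hE
    refine PLaplaceAC.exists_forall_of_eventually_nhdsGT
      (((PLaplaceAC.hasTailBound_critical hp hr hAr).slow_motion hp hn hab hσ hr hsep ha hb
        (fun ε _ => Real.exp_pos _) (PLaplaceAC.tendsto_exp_neg_div (by positivity)) hu hlim hK
        hK1 hK2 hδ hδr hC.le hE).mono fun ε hε => ?_)
    rwa [← Real.exp_neg, neg_div, neg_neg] at hε
  · intro hpn m hm hE
    refine PLaplaceAC.exists_forall_of_eventually_nhdsGT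
      (((((PLaplaceAC.hasTailBound_degenerate hp hpn hr m).slow_motion hp hn hab hσ hr hsep ha hb
        (fun ε hε => Real.rpow_pos_of_pos hε _)
        (PLaplaceAC.tendsto_rpow_nhdsGT_zero (PLaplaceAC.kExp_pos hp (by linarith) hm)) hu hlim hK
        hK1 hK2 hδ hδr zero_le_one (C := 1) (by simpa using hE)).and
          self_mem_nhdsWithin)).mono fun ε hε => ?_)
    rw [Real.rpow_neg (le_of_lt hε.2)]
    exact hε.1
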